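/- **Notation.** Let $m\ge 2$, $n\ge 0$ be integers and $c\in\{1,\dots,m-1\}$. Let $E_{ab}$ ($1\le a,b\le m$) be the matrix units of $\mathfrak{gl}_m$ over $\mathbb C$, let $\mathfrak n$, $\mathfrak h$, $\mathfrak n'$ be the spans of the $E_{ab}$ with $a>b$, $a=b$, $a<b$ respectively, and identify $\mu\in\mathfrak h^*$ with $(\mu_1,\dots,\mu_m)$, $\mu_a=\mu(E_{aa})$. For a $\mathfrak{gl}_m$-module $W$ put $W_{\mathfrak n}=W/\mathfrak n W$. Let $\mathcal G=\mathcal G(\mathbb C^m\otimes\mathbb C^n)$ be the Grassmann (exterior) algebra on the anticommuting variables $x_{ak}$ ($1\le a\le m$, $1\le k\le n$), let $\partial_{ak}$ be the left derivation with respect to $x_{ak}$, and let $\mathcal{GD}=\operatorname{End}_{\mathbb C}\mathcal G$, which contains the left multiplications by $x_{ak}$ and the $\partial_{ak}$. Let $A=\mathrm U(\mathfrak{gl}_m)\otimes\mathcal{GD}$, with $\mathfrak{gl}_m$ embedded by $E_{ab}\mapsto E_{ab}\otimes1+\sum_{k=1}^n1\otimes x_{ak}\partial_{bk}$; below $E_{ab}$,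 when regarded as an element of $A$, means this image. Let $\overline{\mathrm U(\mathfrak h)}$ and $\bar A$ be the rings of fractions of $\mathrm U(\mathfrak h)$ and of $A$ with respect to the denominators $E_{aa}-E_{bb}+z$ ($a\ne b$, $z\in\mathbb Z$); elements of $\overline{\mathrm U(\mathfrak h)}$ are regarded as rational functions on $\mathfrak h^*$. Let $J$ be the right ideal of $A$ generated by $\mathfrak n$ and $\bar J=\overline{\mathrm U(\mathfrak h)}\,J$. For $\mu\in\mathfrak h^*$ let $I_\mu$ be the left ideal of $A$ generated by the $E_{ab}$ ($a<b$), the $E_{aa}-\mu_a$ and the $1\otimes\partial_{bk}$, and let $\bar I_\mu=\overline{\mathrm U(\mathfrak h)}\,I_\mu$. Let $M_\mu$ be the Verma module, that is, the quotient of $\mathrm U(\mathfrak{gl}_m)$ by the left ideal generated by the $E_{ab}$ ($a<b$) and the $E_{aa}-\mu_a$, and let $1_\mu\in M_\mu$ be the image of $1$. The algebra $A$ acts on $M_\mu\otimes\mathcal G$, and $\mathfrak{gl}_m\subset A$ acts diagonally. Put $E_c=E_{c,c+1}$, $F_c=E_{c+1,c}$, $H_c=E_{cc}-E_{c+1,c+1}$,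 $H_c^{(s)}=H_c(H_c-1)\cdots(H_c-s+1)$, and $\widehat F_c(Y)=[F_c,Y]$. Let $\varepsilon_c\in\mathfrak h^*$ be the simple root, $\varepsilon_c(E_{aa})=\delta_{a,c}-\delta_{a,c+1}$. For $Y\in A$ put $$\xi_c(Y)=Y+\sum_{s=1}^\infty\bigl(s!\,H_c^{(s)}\bigr)^{-1}E_c^{\,s}\,\widehat F_c^{\,s}(Y)\in\bar A$$ (a finite sum). Let $\bar\xi_c:\bar A\to\bar J\backslash\bar A$ be the linear map with $\bar\xi_c(XY)=Z\,\xi_c(Y)+\bar J$ for $X\in\overline{\mathrm U(\mathfrak h)}$ and $Y\in A$, where $Z(\lambda)=X(\lambda+\varepsilon_c)$ for $\lambda\in\mathfrak h^*$. The symmetric group $\mathfrak S_m$ acts on $A$ and $\bar A$ by automorphisms with $E_{ab}\otimes1\mapsto E_{\sigma(a)\sigma(b)}\otimes1$, $1\otimes x_{ak}\mapsto1\otimes x_{\sigma(a)k}$, $1\otimes\partial_{ak}\mapsto1\otimes\partial_{\sigma(a)k}$; let $\sigma_c$ be the transposition of $c$ and $c+1$. The Zhelobenko operator $\check\xi_c:\bar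 J\backslash\bar A\to\bar J\backslash\bar A$ is the map $Y+\bar J\mapsto\bar\xi_c(\sigma_c(Y))$. Finally let $\sigma_c\circ\mu=\sigma_c(\mu+\rho)-\rho$, where $\rho=(0,-1,\dots,1-m)$ and $(\sigma\mu)_a=\mu_{\sigma^{-1}(a)}$. **Proposition 3.6.** Suppose that $\mu_a-\mu_b\notin\mathbb Z$ whenever $a\ne b$. Then the linear maps $\bar\xi_c$ and $\check\xi_c$ are well defined (they exist and are unique). For $\nu=\mu$ and for $\nu=\sigma_c\circ\mu$ there is a unique linear isomorphism $\bar J\backslash\bar A/\bar I_\nu\cong(M_\nu\otimes\mathcal G)_{\mathfrak n}$ under which, for every $Y\in A$, the class of $Y$ corresponds to the class of $Y(1_\nu\otimes1)$. Via these identifications $\check\xi_c$ induces a (unique) linear map $$(M_\mu\otimes\mathcal G)_{\mathfrak n}\longrightarrow(M_{\sigma_c\circ\mu}\otimes\mathcal G)_{\mathfrak n},$$ and for all $s=0,1,2,\dots$ and $1\le i,j\le n$ this map commutes with the action of the generator $T_{ij}^{(s+1)}$ of the Yangian $\mathrm Y(\mathfrak{gl}_n)$, which acts on the source and on the target as the element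 $$\sum_{c_0,c_1,\dots,c_s=1}^m E_{c_1c_0}E_{c_2c_1}\cdots E_{c_sc_{s-1}}\otimes x_{c_0i}\,\partial_{c_sj}\ \in\ \mathrm U(\mathfrak{gl}_m)\otimes\mathcal{GD}$$ (for $s=0$ the first tensor factor is understood as $1$). -/

import Mathlib

open scoped TensorProduct

namespace MickelssonGL

noncomputable section

attribute [local instance] LieRing.ofAssociativeRing LieAlgebra.ofAssociativeAlgebra

/-! ### The algebra `U(gl_m) ⊗ GD(ℂ^m ⊗ ℂ^n)` -/

/-- The universal enveloping algebra `U(gl_m)`; indices run over `Fin m`, that is `0, …, m - 1`. -/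
abbrev Ugl (m : ℕ) := UniversalEnvelopingAlgebra ℂ (Matrix (Fin m) (Fin m) ℂ)

/-- The matrix unit `E_{ab}` as an element of `U(gl_m)`. -/
def eU {m : ℕ} (a b : Fin m) : Ugl m :=
  UniversalEnvelopingAlgebra.ι ℂ (Matrix.single a b (1 : ℂ))

/-- The Grassmann algebra `G(ℂ^m ⊗ ℂ^n)`, generated by anticommuting variables `x_{ak}`. -/
abbrev Grass (m n : ℕ) := ExteriorAlgebra ℂ (Fin m × Fin n → ℂ)

/-- The ring `GD(ℂ^m ⊗ ℂ^n)` of all `ℂ`-endomorphisms of the Grassmann algebra. -/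
abbrev GD (m n : ℕ) := Module.End ℂ (Grass m n)

/-- The operator of left multiplication by the variable `x_{ak}`. -/
def xOp {m n : ℕ} (a : Fin m) (k : Fin n) : GD m n :=
  LinearMap.mulLeft ℂ (ExteriorAlgebra.ι ℂ (Pi.single (a, k) (1 : ℂ)))

/-- The left derivation (inner multiplication) `∂_{ak}`. -/
def dOp {m n : ℕ} (a : Fin m) (k : Fin n) : GD m n :=
  CliffordAlgebra.contractLeft (LinearMap.proj (a, k) : (Fin m × Fin n → ℂ) →ₗ[ℂ] ℂ)

/-- The algebra `A`, realised as the tensor product `U(gl_m) ⊗ GD(ℂ^m ⊗ ℂ^n)`. -/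
def AA (m n : ℕ) : Type := Ugl m ⊗[ℂ] GD m n

instance (m n : ℕ) : Ring (AA m n) := inferInstanceAs (Ring (Ugl m ⊗[ℂ] GD m n))

instance (m n : ℕ) : Algebra ℂ (AA m n) := inferInstanceAs (Algebra ℂ (Ugl m ⊗[ℂ] GD m n))

/-- The homomorphism `u ↦ u ⊗ 1`. -/
def inU {m : ℕ} (n : ℕ) : Ugl m →ₐ[ℂ] AA m n :=
  (Algebra.TensorProduct.includeLeft : Ugl m →ₐ[ℂ] Ugl m ⊗[ℂ] GD m n)

/-- The homomorphism `Y ↦ 1 ⊗ Y`. -/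
def inG {m n : ℕ} : GD m n →ₐ[ℂ] AA m n :=
  (Algebra.TensorProduct.includeRight : GD m n →ₐ[ℂ] Ugl m ⊗[ℂ] GD m n)

/-- `γ(E_{ab}) = ∑_k x_{ak} ∂_{bk}`. -/
def gam {m : ℕ} (n : ℕ) (a b : Fin m) : GD m n := ∑ k, xOp a k * dOp b k

/-- The image `E_{ab} ⊗ 1 + 1 ⊗ γ(E_{ab})` of `E_{ab}` under the (diagonal) embedding of
`gl_m` into `A`. -/
def eA {m : ℕ} (n : ℕ) (a b : Fin m) : AA m n := inU n (eU a b) + inG (gam n a b)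

/-! ### Commutation relations -/

section Relations

variable {m n : ℕ}

lemma inU_mul_inG (u : Ugl m) (Y : GD m n) :
    inU n u * inG Y = (u ⊗ₜ[ℂ] Y : Ugl m ⊗[ℂ] GD m n) := by
  change (u ⊗ₜ[ℂ] (1 : GD m n)) * ((1 : Ugl m) ⊗ₜ[ℂ] Y) = u ⊗ₜ[ℂ] Y
  simp

lemma inG_mul_inU (u : Ugl m) (Y : GD m n) : inG Y * inU n u = inU n u * inG Y := by
  rw [inU_mul_inG]
  change ((1 : Ugl m) ⊗ₜ[ℂ] Y) * (u ⊗ₜ[ℂ] (1 : GD m n)) = u ⊗ₜ[ℂ] Y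
  simp

lemma AA_induction {P : AA m n → Prop} (h0 : P 0) (h1 : ∀ u Y, P (inU n u * inG Y))
    (h2 : ∀ X Y, P X → P Y → P (X + Y)) (Y : AA m n) : P Y := by
  refine TensorProduct.induction_on (motive := P) Y h0 (fun u Z => ?_) h2
  exact inU_mul_inG u Z ▸ h1 u Z

lemma eA_inU (a b : Fin m) (u : Ugl m) :
    eA n a b * inU n u - inU n u * eA n a b = inU n (eU a b * u - u * eU a b) := by
  rw [eA, add_mul, mul_add, inG_mul_inU, map_sub, map_mul, map_mul]
  abel

lemma eA_inG (a b : Fin m) (Y : GD m n) :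
    eA n a b * inG Y - inG Y * eA n a b = inG (gam n a b * Y - Y * gam n a b) := by
  rw [eA, add_mul, mul_add, inG_mul_inU, map_sub, map_mul, map_mul]
  abel

lemma xOp_mul_xOp (a b : Fin m) (k l : Fin n) :
    (xOp a k * xOp b l : GD m n) = -(xOp b l * xOp a k) := by
  refine LinearMap.ext fun w => ?_
  simp only [xOp, Module.End.mul_apply, LinearMap.mulLeft_apply, LinearMap.neg_apply]
  rw [← mul_assoc, ← mul_assoc, ← neg_mul]
  congr 1
  exact eq_neg_of_add_eq_zero_left (ExteriorAlgebra.ι_add_mul_swap _ _)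

lemma dOp_mul_dOp (a b : Fin m) (k l : Fin n) :
    (dOp a k * dOp b l : GD m n) = -(dOp b l * dOp a k) := by
  refine LinearMap.ext fun w => ?_
  simp only [dOp, Module.End.mul_apply, LinearMap.neg_apply]
  exact CliffordAlgebra.contractLeft_comm (Q := (0 : QuadraticForm ℂ (Fin m × Fin n → ℂ))) _ _ w

lemma dOp_mul_xOp (a b : Fin m) (k l : Fin n) :
    (dOp b l * xOp a k : GD m n) = (if a = b ∧ k = l then 1 else 0) - xOp a k * dOp b l := by
  refine LinearMap.ext fun w => ?_
  simp only [dOp, xOp, Module.End.mul_apply, LinearMap.mulLeft_apply, LinearMap.sub_apply]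
  refine (CliffordAlgebra.contractLeft_ι_mul _ _ _).trans ?_
  congr 1
  by_cases h : a = b ∧ k = l
  · obtain ⟨rfl, rfl⟩ := h
    simp
  · simp [h]

lemma gam_xOp (a b c : Fin m) (l : Fin n) :
    gam n a b * xOp c l - xOp c l * gam n a b = if b = c then xOp a l else 0 := by
  have key : ∀ k : Fin n, xOp a k * dOp b k * xOp c l - xOp c l * (xOp a k * dOp b k)
      = if c = b ∧ l = k then (xOp a k : GD m n) else 0 := by
    intro k
    rw [mul_assoc, dOp_mul_xOp, mul_sub, ← mul_assoc, ← mul_assoc, xOp_mul_xOp c a l k]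
    split_ifs <;> simp
  rw [gam, Finset.sum_mul, Finset.mul_sum, ← Finset.sum_sub_distrib,
    Finset.sum_congr rfl fun k _ => key k]
  by_cases h : b = c
  · subst h; simp
  · simp [h, Ne.symm h]

lemma gam_dOp (a b c : Fin m) (l : Fin n) :
    gam n a b * dOp c l - dOp c l * gam n a b = if a = c then -dOp b l else 0 := by
  have key : ∀ k : Fin n, xOp a k * dOp b k * dOp c l - dOp c l * (xOp a k * dOp b k)
      = if a = c ∧ k = l then (-dOp b k : GD m n) else 0 := by
    intro k
    rw [← mul_assoc (dOp c l), dOp_mul_xOp, sub_mul, mul_assoc, mul_assoc, dOp_mul_dOp c b l k]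
    split_ifs <;> simp
  rw [gam, Finset.sum_mul, Finset.mul_sum, ← Finset.sum_sub_distrib,
    Finset.sum_congr rfl fun k _ => key k]
  by_cases h : a = c
  · subst h; simp
  · simp [h]

lemma gam_xd (a b p q : Fin m) (i j : Fin n) :
    gam n a b * (xOp p i * dOp q j) - (xOp p i * dOp q j) * gam n a b =
      (if b = p then xOp a i * dOp q j else 0) - (if a = q then xOp p i * dOp b j else 0) := by
  have h : gam n a b * (xOp p i * dOp q j) - (xOp p i * dOp q j) * gam n a b =
      (gam n a b * xOp p i - xOp p i * gam n a b) * dOp q j +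
        xOp p i * (gam n a b * dOp q j - dOp q j * gam n a b) := by noncomm_ring
  rw [h, gam_xOp, gam_dOp]
  split_ifs <;> simp [sub_eq_add_neg]

lemma gam_gam (a b c d : Fin m) :
    gam n a b * gam n c d - gam n c d * gam n a b =
      (if b = c then gam n a d else 0) - (if a = d then gam n c b else 0) := by
  conv_lhs => rw [gam.eq_1 n c d]
  rw [Finset.sum_mul, Finset.mul_sum, ← Finset.sum_sub_distrib,
    Finset.sum_congr rfl fun k _ => gam_xd a b c d k k, Finset.sum_sub_distrib]
  split_ifs <;> simp [gam]

lemma eU_eU (a b c d : Fin m) :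
    eU a b * eU c d - eU c d * eU a b =
      (if b = c then eU a d else 0) - (if a = d then eU c b else 0) := by
  rw [eU, eU, ← LieRing.of_associative_ring_bracket, ← LieHom.map_lie,
    LieRing.of_associative_ring_bracket, map_sub]
  congr 1
  · split_ifs with h
    · subst h; simp [eU]
    · simp [h]
  · split_ifs with h
    · subst h; simp [eU]
    · simp [Ne.symm h]

lemma eA_eA (a b c d : Fin m) :
    eA n a b * eA n c d - eA n c d * eA n a b =
      (if b = c then eA n a d else 0) - (if a = d then eA n c b else 0) := by
  have h : eA n a b * eA n c d - eA n c d * eA n a b =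
      (eA n a b * inU n (eU c d) - inU n (eU c d) * eA n a b) +
        (eA n a b * inG (gam n c d) - inG (gam n c d) * eA n a b) := by
    rw [eA.eq_1 n c d, mul_add, add_mul]
    abel
  rw [h, eA_inU, eA_inG, eU_eU, gam_gam]
  split_ifs <;> simp [eA] <;> abel

lemma eA_diag_comm (a b : Fin m) : eA n a a * eA n b b = eA n b b * eA n a a := by
  have h := eA_eA (n := n) a a b b
  rw [← sub_eq_zero, h]
  by_cases e : a = b
  · subst e; simp
  · simp [e]

end Relations

/-! ### The Ore condition -/

section Ore

/-- If every element of a `ℂ`-algebra is annihilated by a product of operators `ad g - z` with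
integers `z`, then left fractions with denominators `g - z` exist; one denominator. -/
lemma ore_step {B : Type*} [Ring B] [Algebra ℂ B] (S : Submonoid B) (g : B)
    (hg : ∀ z : ℤ, g - algebraMap ℂ B z ∈ S) (l : List ℤ) (Y : B) :
    ∃ s ∈ S, ∃ K : B,
      (l.map fun z : ℤ => LinearMap.mulLeft ℂ g - LinearMap.mulRight ℂ g -
        algebraMap ℂ (Module.End ℂ B) (z : ℂ)).prod Y = s * Y - K * g ∧
      (Y * g = 0 → K * g = 0) := by
  induction l with
  | nil => exact ⟨1, S.one_mem, 0, by simp, by simp⟩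
  | cons z l ih =>
    obtain ⟨s, hs, K, hK, h0⟩ := ih
    refine ⟨(g - algebraMap ℂ B z) * s, S.mul_mem (hg z) hs,
      (g - algebraMap ℂ B z) * K + s * Y - K * g, ?_, ?_⟩
    · rw [List.map_cons, List.prod_cons, Module.End.mul_apply, hK]
      simp only [LinearMap.sub_apply, LinearMap.mulLeft_apply, LinearMap.mulRight_apply,
        Module.algebraMap_end_apply, Algebra.smul_def]
      noncomm_ring
    · intro h
      have h1 := h0 h
      have : ((g - algebraMap ℂ B z) * K + s * Y - K * g) * g =
          (g - algebraMap ℂ B z) * (K * g) + s * (Y * g) - (K * g) * g := by noncomm_ring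
      rw [this, h1, h]; simp

lemma ore_annih {B : Type*} [Ring B] [Algebra ℂ B] (g : B)
    (hspan : Submodule.span ℂ {Y : B | ∃ z : ℤ, g * Y - Y * g = (z : ℂ) • Y} = ⊤) (Y : B) :
    ∃ l : List ℤ, (l.map fun z : ℤ => LinearMap.mulLeft ℂ g - LinearMap.mulRight ℂ g -
        algebraMap ℂ (Module.End ℂ B) (z : ℂ)).prod Y = 0 := by
  set δ : Module.End ℂ B := LinearMap.mulLeft ℂ g - LinearMap.mulRight ℂ g with hδ
  have hcomm : ∀ l₁ l₂ : List ℤ,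
      Commute (l₁.map fun z : ℤ => δ - algebraMap ℂ (Module.End ℂ B) (z : ℂ)).prod
        (l₂.map fun z : ℤ => δ - algebraMap ℂ (Module.End ℂ B) (z : ℂ)).prod := by
    intro l₁ l₂
    refine Commute.list_prod_left _ _ fun x hx => Commute.list_prod_right _ _ fun y hy => ?_
    obtain ⟨z, -, rfl⟩ := List.mem_map.1 hx
    obtain ⟨w, -, rfl⟩ := List.mem_map.1 hy
    exact ((Commute.refl δ).sub_left (Algebra.commutes _ _)).sub_right
      (Algebra.commutes _ _).symm
  have hY : Y ∈ Submodule.span ℂ {Y : B | ∃ z : ℤ, g * Y - Y * g = (z : ℂ) • Y} :=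
    hspan ▸ Submodule.mem_top
  induction hY using Submodule.span_induction with
  | mem x hx =>
    obtain ⟨z, hz⟩ := hx
    refine ⟨[z], ?_⟩
    rw [List.map_singleton, List.prod_singleton, LinearMap.sub_apply, hδ, LinearMap.sub_apply,
      LinearMap.mulLeft_apply, LinearMap.mulRight_apply, hz, Module.algebraMap_end_apply, sub_self]
  | zero => exact ⟨[], by simp⟩
  | add x y _ _ hx hy =>
    obtain ⟨l₁, h₁⟩ := hx
    obtain ⟨l₂, h₂⟩ := hy
    refine ⟨l₁ ++ l₂, ?_⟩
    rw [List.map_append, List.prod_append, map_add]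
    nth_rewrite 1 [(hcomm l₁ l₂).eq]
    rw [Module.End.mul_apply, Module.End.mul_apply, h₁, h₂]
    simp
  | smul c x _ hx =>
    obtain ⟨l, h⟩ := hx
    exact ⟨l, by rw [map_smul, h, smul_zero]⟩

/-- The multiplicative closure of a set of elements whose adjoint actions are diagonalisable with
integer eigenvalues, and which is stable under integer shifts, is an Ore set. -/
lemma ore_closure {B : Type*} [Ring B] [Algebra ℂ B] (G : Set B)
    (hshift : ∀ g ∈ G, ∀ z : ℤ, g - algebraMap ℂ B z ∈ G)
    (hspan : ∀ g ∈ G,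
      Submodule.span ℂ {Y : B | ∃ z : ℤ, g * Y - Y * g = (z : ℂ) • Y} = ⊤) :
    Nonempty (OreLocalization.OreSet (Submonoid.closure G)) := by
  have step : ∀ g ∈ G, ∀ Y : B, ∃ s ∈ Submonoid.closure G, ∃ K : B, s * Y = K * g ∧
      (Y * g = 0 → K * g = 0) := by
    intro g hg Y
    obtain ⟨l, hl⟩ := ore_annih g (hspan g hg) Y
    obtain ⟨s, hs, K, hK, h0⟩ := ore_step (Submonoid.closure G) g
      (fun z => Submonoid.subset_closure (hshift g hg z)) l Y
    exact ⟨s, hs, K, sub_eq_zero.1 (hK.symm.trans hl), h0⟩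
  rw [OreLocalization.nonempty_oreSet_iff]
  constructor
  · have main : ∀ s ∈ Submonoid.closure G, ∀ Y : B, Y * s = 0 →
        ∃ s' ∈ Submonoid.closure G, s' * Y = 0 := by
      intro s hs
      induction hs using Submonoid.closure_induction with
      | mem g hg =>
        intro Y hY
        obtain ⟨s, hs, K, h1, h2⟩ := step g hg Y
        exact ⟨s, hs, h1.trans (h2 hY)⟩
      | one => exact fun Y hY => ⟨1, Submonoid.one_mem _, by simpa using hY⟩
      | mul x y _ _ hx hy =>
        intro Y hY
        obtain ⟨s₁, h₁, e₁⟩ := hy (Y * x) (by rw [mul_assoc, hY])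
        obtain ⟨s₂, h₂, e₂⟩ := hx (s₁ * Y) (by rw [mul_assoc, e₁])
        exact ⟨s₂ * s₁, Submonoid.mul_mem _ h₂ h₁, by rw [mul_assoc, e₂]⟩
    intro r₁ r₂ s h
    obtain ⟨s', hs', e⟩ := main s s.2 (r₁ - r₂) (by rw [sub_mul, h, sub_self])
    exact ⟨⟨s', hs'⟩, by rwa [mul_sub, sub_eq_zero] at e⟩
  · have main : ∀ s ∈ Submonoid.closure G, ∀ Y : B,
        ∃ Y' : B, ∃ s' ∈ Submonoid.closure G, s' * Y = Y' * s := by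
      intro s hs
      induction hs using Submonoid.closure_induction with
      | mem g hg =>
        intro Y
        obtain ⟨s, hs, K, h1, -⟩ := step g hg Y
        exact ⟨K, s, hs, h1⟩
      | one => exact fun Y => ⟨Y, 1, Submonoid.one_mem _, by simp⟩
      | mul x y _ _ hx hy =>
        intro Y
        obtain ⟨Y₁, s₁, h₁, e₁⟩ := hy Y
        obtain ⟨Y₂, s₂, h₂, e₂⟩ := hx Y₁
        exact ⟨Y₂, s₂ * s₁, Submonoid.mul_mem _ h₂ h₁, by
          rw [mul_assoc, e₁, ← mul_assoc, e₂, mul_assoc]⟩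
    intro r s
    obtain ⟨Y', s', hs', e⟩ := main s s.2 r
    exact ⟨Y', ⟨s', hs'⟩, e⟩

/-- The span of the eigenvectors of `ad h` with integer eigenvalues. -/
def intSpan {B : Type*} [Ring B] [Algebra ℂ B] (h : B) : Submodule ℂ B :=
  Submodule.span ℂ {Y : B | ∃ z : ℤ, h * Y - Y * h = (z : ℂ) • Y}

lemma intSpan_mul {B : Type*} [Ring B] [Algebra ℂ B] (h : B) {X Y : B}
    (hX : X ∈ intSpan h) (hY : Y ∈ intSpan h) : X * Y ∈ intSpan h := by
  have : X * Y ∈ intSpan h * intSpan h := Submodule.mul_mem_mul hX hY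
  rw [intSpan, Submodule.span_mul_span] at this
  refine Submodule.span_mono ?_ this
  rintro _ ⟨U, ⟨z, hz⟩, V, ⟨w, hw⟩, rfl⟩
  refine ⟨z + w, ?_⟩
  have e : h * (U * V) - U * V * h = (h * U - U * h) * V + U * (h * V - V * h) := by
    noncomm_ring
  change h * (U * V) - U * V * h = _
  rw [e, hz, hw]
  simp [add_smul]

lemma intSpan_idem {B : Type*} [Ring B] [Algebra ℂ B] {ι : Type*} (T : Finset ι) (p : ι → B)
    (hp : ∀ i, p i * p i = p i) (hc : ∀ i j, p i * p j = p j * p i) (c : ι → ℤ) :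
    intSpan (∑ i ∈ T, (c i : ℂ) • p i) = ⊤ := by
  classical
  induction T using Finset.induction_on with
  | empty =>
    rw [eq_top_iff]
    intro Y _
    exact Submodule.subset_span ⟨0, by simp⟩
  | insert i T hi ih =>
    rw [Finset.sum_insert hi]
    set q := ∑ i ∈ T, (c i : ℂ) • p i with hq
    have hqp : q * p i = p i * q := by
      rw [hq, Finset.sum_mul, Finset.mul_sum]
      exact Finset.sum_congr rfl fun j _ => by
        rw [smul_mul_assoc, mul_smul_comm, hc]
    rw [eq_top_iff, ← ih]
    refine Submodule.span_le.2 ?_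
    rintro Y ⟨z, hz⟩
    have hz' : q * Y = Y * q + (z : ℂ) • Y := by rw [← hz]; abel
    have dec : Y = p i * Y * p i + p i * Y * (1 - p i) + (1 - p i) * Y * p i
        + (1 - p i) * Y * (1 - p i) := by noncomm_ring
    have ev : ∀ (u v : B) (k : ℤ), q * u = u * q → q * v = v * q →
        p i * u * Y * v - u * Y * v * p i = (k : ℂ) • (u * Y * v) →
        u * Y * v ∈ intSpan ((c i : ℂ) • p i + q) := by
      intro u v k hu hv hk
      refine Submodule.subset_span ⟨c i * k + z, ?_⟩
      have e : ((c i : ℂ) • p i + q) * (u * Y * v) - u * Y * v * ((c i : ℂ) • p i + q) =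
          (c i : ℂ) • (p i * u * Y * v - u * Y * v * p i) +
            (q * u * Y * v - u * Y * (v * q)) := by
        simp only [add_mul, mul_add, smul_mul_assoc, mul_smul_comm, smul_sub, mul_assoc]
        abel
      rw [e, hk, hu, ← hv, mul_assoc u q Y, hz', smul_smul]
      push_cast
      rw [add_smul, mul_add, add_mul, mul_smul_comm, smul_mul_assoc]
      simp only [mul_assoc]
      abel
    have h1 : p i * (1 - p i) = 0 := by rw [mul_sub, hp, mul_one, sub_self]
    have h2 : (1 - p i) * p i = 0 := by rw [sub_mul, hp, one_mul, sub_self]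
    have hq1 : q * (1 - p i) = (1 - p i) * q := by rw [mul_sub, sub_mul, hqp]; simp
    rw [SetLike.mem_coe, dec]
    refine Submodule.add_mem _ (Submodule.add_mem _ (Submodule.add_mem _ ?_ ?_) ?_) ?_
    · exact ev _ _ 0 hqp hqp (by rw [hp, mul_assoc (p i * Y), hp]; simp)
    · exact ev _ _ 1 hqp hq1 (by rw [hp, mul_assoc (p i * Y), h2]; simp)
    · exact ev _ _ (-1) hq1 hqp (by rw [h1, mul_assoc ((1 - p i) * Y), hp]; simp)
    · exact ev _ _ 0 hq1 hq1 (by rw [h1, mul_assoc ((1 - p i) * Y), h2]; simp)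

variable {m n : ℕ}

lemma xd_idem (i : Fin m × Fin n) :
    (xOp i.1 i.2 * dOp i.1 i.2 * (xOp i.1 i.2 * dOp i.1 i.2) : GD m n) =
      xOp i.1 i.2 * dOp i.1 i.2 := by
  have h0 : (dOp i.1 i.2 * dOp i.1 i.2 : GD m n) = 0 := by
    refine LinearMap.ext fun w => ?_
    exact CliffordAlgebra.contractLeft_contractLeft
      (Q := (0 : QuadraticForm ℂ (Fin m × Fin n → ℂ))) _ w
  rw [← mul_assoc, mul_assoc (xOp i.1 i.2) (dOp i.1 i.2) (xOp i.1 i.2), dOp_mul_xOp]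
  simp [mul_sub, sub_mul, mul_assoc, h0]

lemma xd_comm (i j : Fin m × Fin n) :
    (xOp i.1 i.2 * dOp i.1 i.2 * (xOp j.1 j.2 * dOp j.1 j.2) : GD m n) =
      xOp j.1 j.2 * dOp j.1 j.2 * (xOp i.1 i.2 * dOp i.1 i.2) := by
  by_cases hij : i = j
  · rw [hij]
  have h1 : ¬ (j.1 = i.1 ∧ j.2 = i.2) := fun h => hij (Prod.ext h.1.symm h.2.symm)
  have h2 : ¬ (i.1 = j.1 ∧ i.2 = j.2) := fun h => hij (Prod.ext h.1 h.2)
  have e1 := dOp_mul_xOp (m := m) (n := n) j.1 i.1 j.2 i.2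
  have e2 := dOp_mul_xOp (m := m) (n := n) i.1 j.1 i.2 j.2
  rw [if_neg h1, zero_sub] at e1
  rw [if_neg h2, zero_sub] at e2
  calc (xOp i.1 i.2 * dOp i.1 i.2 * (xOp j.1 j.2 * dOp j.1 j.2) : GD m n)
      = xOp i.1 i.2 * (dOp i.1 i.2 * xOp j.1 j.2) * dOp j.1 j.2 := by noncomm_ring
    _ = -(xOp i.1 i.2 * xOp j.1 j.2 * (dOp i.1 i.2 * dOp j.1 j.2)) := by
        rw [e1]; noncomm_ring
    _ = -(xOp j.1 j.2 * xOp i.1 i.2 * (dOp j.1 j.2 * dOp i.1 i.2)) := by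
        rw [xOp_mul_xOp, dOp_mul_dOp]; noncomm_ring
    _ = xOp j.1 j.2 * (dOp j.1 j.2 * xOp i.1 i.2) * dOp i.1 i.2 := by
        rw [e2]; noncomm_ring
    _ = _ := by noncomm_ring

lemma intSpan_gam (a b : Fin m) : intSpan (gam n a a - gam n b b) = ⊤ := by
  have h := intSpan_idem (B := GD m n) (Finset.univ : Finset (Fin m × Fin n))
    (fun i => xOp i.1 i.2 * dOp i.1 i.2) xd_idem xd_comm
    (fun i => (if i.1 = a then 1 else 0) - (if i.1 = b then 1 else 0))
  convert h using 2
  rw [Fintype.sum_prod_type]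
  simp [sub_smul, ite_smul, Finset.sum_sub_distrib, gam, Finset.sum_ite_irrel]

lemma intSpan_eA (a b : Fin m) : intSpan (eA n a a - eA n b b) = ⊤ := by
  set h : AA m n := eA n a a - eA n b b with hh
  have hone : (1 : AA m n) ∈ intSpan h := Submodule.subset_span ⟨0, by simp⟩
  let E : Subalgebra ℂ (AA m n) := (intSpan h).toSubalgebra hone (fun _ _ => intSpan_mul h)
  have hR : ∀ Y : GD m n, inG Y ∈ intSpan h := by
    intro Y
    have hY : Y ∈ intSpan (gam n a a - gam n b b) := by rw [intSpan_gam]; trivial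
    induction hY using Submodule.span_induction with
    | mem Y hY =>
      obtain ⟨z, hz⟩ := hY
      refine Submodule.subset_span ⟨z, ?_⟩
      have e : h * inG Y - inG Y * h =
          (eA n a a * inG Y - inG Y * eA n a a) - (eA n b b * inG Y - inG Y * eA n b b) := by
        rw [hh, sub_mul, mul_sub]; abel
      rw [e, eA_inG, eA_inG, ← map_sub, ← map_smul, ← hz]
      congr 1
      rw [sub_mul, mul_sub]; abel
    | zero => rw [map_zero]; exact Submodule.zero_mem _
    | add x y _ _ hx hy => rw [map_add]; exact Submodule.add_mem _ hx hy
    | smul c x _ hx => rw [map_smul]; exact Submodule.smul_mem _ c hx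
  have hgen : ∀ p q : Fin m, inU n (eU p q) ∈ intSpan h := by
    intro p q
    refine Submodule.subset_span
      ⟨((if a = p then 1 else 0) - (if a = q then 1 else 0)) -
        ((if b = p then 1 else 0) - (if b = q then 1 else 0)), ?_⟩
    have e : h * inU n (eU p q) - inU n (eU p q) * h =
        (eA n a a * inU n (eU p q) - inU n (eU p q) * eA n a a) -
          (eA n b b * inU n (eU p q) - inU n (eU p q) * eA n b b) := by
      rw [hh, sub_mul, mul_sub]; abel
    have f : ∀ a : Fin m, eU a a * eU p q - eU p q * eU a a =
        (((if a = p then 1 else 0) - (if a = q then 1 else 0) : ℤ) : ℂ) • eU p q := by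
      intro a
      rw [eU_eU]
      push_cast
      rw [sub_smul, ite_smul, ite_smul]
      congr 1
      · split_ifs with h1
        · rw [h1]; simp
        · simp
      · split_ifs with h1
        · rw [h1]; simp
        · simp
    rw [e, eA_inU, eA_inU, f, f, map_smul, map_smul, ← sub_smul]
    push_cast
    rfl
  have hL : ∀ u : Ugl m, inU n u ∈ intSpan h := by
    intro u
    let E' : Subalgebra ℂ (Ugl m) := E.comap (inU n)
    have hmat : ∀ M : Matrix (Fin m) (Fin m) ℂ, UniversalEnvelopingAlgebra.ι ℂ M ∈ E' := by
      intro M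
      rw [Matrix.matrix_eq_sum_single M, map_sum]
      refine Subalgebra.sum_mem _ fun p _ => ?_
      rw [map_sum]
      refine Subalgebra.sum_mem _ fun q _ => ?_
      have : Matrix.single p q (M p q) = M p q • Matrix.single p q (1 : ℂ) := by
        rw [Matrix.smul_single, smul_eq_mul, mul_one]
      rw [this, map_smul]
      exact Subalgebra.smul_mem _ (hgen p q) _
    let f : Matrix (Fin m) (Fin m) ℂ →ₗ⁅ℂ⁆ E' :=
      { toFun := fun M => ⟨UniversalEnvelopingAlgebra.ι ℂ M, hmat M⟩
        map_add' := fun x y => Subtype.ext (map_add _ x y)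
        map_smul' := fun c x => Subtype.ext (map_smul _ c x)
        map_lie' := fun {x y} => Subtype.ext (LieHom.map_lie _ x y) }
    have hid : E'.val.comp (UniversalEnvelopingAlgebra.lift ℂ f) = AlgHom.id ℂ (Ugl m) := by
      refine UniversalEnvelopingAlgebra.hom_ext ℂ (LieHom.ext fun x => ?_)
      simp [f]
    have := (UniversalEnvelopingAlgebra.lift ℂ f u).2
    have e2 : ((UniversalEnvelopingAlgebra.lift ℂ f u : E') : Ugl m) = u :=
      DFunLike.congr_fun hid u
    rw [e2] at this
    exact this
  rw [eq_top_iff]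
  intro Y _
  refine AA_induction (Submodule.zero_mem _) (fun u Y => ?_)
    (fun X Y hX hY => Submodule.add_mem _ hX hY) Y
  exact intSpan_mul h (hL u) (hR Y)

end Ore

/-! ### The ring of fractions `Ā` and the ideals `J`, `J̄` -/

/-- The denominators: all products of elements `E_{aa} - E_{bb} + z` of `A` with `a ≠ b` and
`z` an integer. -/
def den (m n : ℕ) : Submonoid (AA m n) :=
  Submonoid.closure {Y | ∃ (a b : Fin m) (z : ℤ), a ≠ b ∧
    Y = eA n a a - eA n b b + algebraMap ℂ (AA m n) z}

lemma nonempty_oreSet_den (m n : ℕ) : Nonempty (OreLocalization.OreSet (den m n)) := by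
  refine ore_closure _ ?_ ?_
  · rintro _ ⟨a, b, z, hab, rfl⟩ w
    refine ⟨a, b, z - w, hab, ?_⟩
    rw [Int.cast_sub, map_sub, add_sub_assoc]
  · rintro _ ⟨a, b, z, hab, rfl⟩
    rw [← intSpan_eA (n := n) a b, intSpan]
    congr 1
    ext Y
    have : (eA n a a - eA n b b + algebraMap ℂ (AA m n) z) * Y -
        Y * (eA n a a - eA n b b + algebraMap ℂ (AA m n) z) =
        (eA n a a - eA n b b) * Y - Y * (eA n a a - eA n b b) := by
      rw [add_mul, mul_add, Algebra.commutes (z : ℂ) Y]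
      abel
    simp only [Set.mem_ofPred_eq, this]

instance (m n : ℕ) : OreLocalization.OreSet (den m n) := (nonempty_oreSet_den m n).some

/-- The ring `Ā` of left fractions `s⁻¹ Y` with `Y` in `A` and `s` in `den`. -/
abbrev Abar (m n : ℕ) := OreLocalization (den m n) (AA m n)

/-- The canonical homomorphism `A → Ā`. -/
def toBar {m n : ℕ} (Y : AA m n) : Abar m n := OreLocalization.oreDiv Y 1

/-- The same denominators in `U(h) = ℂ[E_{11}, …, E_{mm}]`, regarded as the algebra of polynomial
functions on the dual of the Cartan subalgebra `h` (the variable `X a` stands for `E_{aa}`). -/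
def denPoly (m : ℕ) : Submonoid (MvPolynomial (Fin m) ℂ) :=
  Submonoid.closure {q | ∃ (a b : Fin m) (z : ℤ), a ≠ b ∧
    q = MvPolynomial.X a - MvPolynomial.X b + MvPolynomial.C (z : ℂ)}

lemma adjoin_comm (m n : ℕ) :
    ∀ X ∈ Set.range (fun a : Fin m => eA n a a), ∀ Y ∈ Set.range (fun a : Fin m => eA n a a),
      X * Y = Y * X := by
  rintro _ ⟨a, rfl⟩ _ ⟨b, rfl⟩
  exact eA_diag_comm a b

open scoped IsMulCommutative in
/-- The homomorphism `U(h) → A` which sends `X a` to `E_{aa}`. -/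
def hPoly (m n : ℕ) : MvPolynomial (Fin m) ℂ →ₐ[ℂ] AA m n :=
  haveI := Algebra.isMulCommutative_adjoin ℂ (adjoin_comm m n)
  (Algebra.adjoin ℂ (Set.range fun a : Fin m => eA n a a)).val.comp
    (MvPolynomial.aeval (R := ℂ)
      (S₁ := Algebra.adjoin ℂ (Set.range fun a : Fin m => eA n a a))
      fun a => ⟨eA n a a, Algebra.subset_adjoin ⟨a, rfl⟩⟩)

open scoped IsMulCommutative in
lemma hPoly_X {m : ℕ} (n : ℕ) (a : Fin m) :
    hPoly m n (MvPolynomial.X a) = eA n a a := by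
  have := Algebra.isMulCommutative_adjoin ℂ (adjoin_comm m n)
  simp [hPoly]

lemma hPoly_den {m : ℕ} (n : ℕ) {q : MvPolynomial (Fin m) ℂ} (hq : q ∈ denPoly m) :
    hPoly m n q ∈ den m n := by
  induction hq using Submonoid.closure_induction with
  | mem q hq =>
    obtain ⟨a, b, z, hab, rfl⟩ := hq
    refine Submonoid.subset_closure ⟨a, b, z, hab, ?_⟩
    rw [map_add, map_sub, hPoly_X, hPoly_X, ← MvPolynomial.algebraMap_eq, AlgHom.commutes]
  | one => rw [map_one]; exact Submonoid.one_mem _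
  | mul x y _ _ hx hy => rw [map_mul]; exact Submonoid.mul_mem _ hx hy

/-- The rational function `p / q`, as an element of the ring of fractions of `U(h)` inside `Ā`. -/
def frac {m : ℕ} (n : ℕ) (p : MvPolynomial (Fin m) ℂ) (q : denPoly m) : Abar m n :=
  OreLocalization.oreDiv (hPoly m n p) ⟨hPoly m n q, hPoly_den n q.2⟩

/-- For a subspace `K` of `A`, the span in `Ā` of the products of all fractions of `U(h)` by the
elements of `K`. -/
def barSpan {m n : ℕ} (K : Submodule ℂ (AA m n)) : Submodule ℂ (Abar m n) :=
  Submodule.span ℂ {W | ∃ (p : MvPolynomial (Fin m) ℂ) (q : denPoly m), ∃ Y ∈ K,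
    W = frac n p q * toBar Y}

/-- The right ideal `J` of `A` generated by the `E_{ab}` with `a > b`. -/
def J (m n : ℕ) : Submodule ℂ (AA m n) :=
  Submodule.span ℂ {Y | ∃ (a b : Fin m) (Z : AA m n), b < a ∧ Y = eA n a b * Z}

/-- The right ideal `J̄` of `Ā`. -/
def Jbar (m n : ℕ) : Submodule ℂ (Abar m n) := barSpan (J m n)

/-! ### The action of the symmetric group -/

/-- The action of a permutation on the Grassmann algebra, `x_{ak} ↦ x_{σ(a)k}`. -/
def permGrass {m : ℕ} (n : ℕ) (σ : Equiv.Perm (Fin m)) : Grass m n →ₐ[ℂ] Grass m n :=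
  ExteriorAlgebra.map (LinearMap.funLeft ℂ ℂ (Prod.map σ.symm id))

lemma permGrass_ι {m n : ℕ} (σ : Equiv.Perm (Fin m)) (a : Fin m) (k : Fin n) :
    permGrass n σ (ExteriorAlgebra.ι ℂ (Pi.single (a, k) (1 : ℂ))) =
      ExteriorAlgebra.ι ℂ (Pi.single (σ a, k) (1 : ℂ)) := by
  rw [permGrass, ExteriorAlgebra.map_apply_ι]
  congr 1
  ext ⟨b, l⟩
  simp [LinearMap.funLeft_apply, Pi.single_apply, Equiv.symm_apply_eq]

lemma permGrass_comp {m n : ℕ} (σ τ : Equiv.Perm (Fin m)) :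
    (permGrass n σ).comp (permGrass n τ) = permGrass n (σ * τ) := by
  rw [permGrass, permGrass, ExteriorAlgebra.map_comp_map]
  rfl

lemma permGrass_one {m n : ℕ} : permGrass n (1 : Equiv.Perm (Fin m)) = AlgHom.id ℂ _ := by
  rw [permGrass, ← ExteriorAlgebra.map_id]
  rfl

/-- The same as a linear automorphism. -/
def permGrassEquiv {m : ℕ} (n : ℕ) (σ : Equiv.Perm (Fin m)) : Grass m n ≃ₗ[ℂ] Grass m n :=
  (AlgEquiv.ofAlgHom (permGrass n σ) (permGrass n σ⁻¹)
    (by rw [permGrass_comp, mul_inv_cancel, permGrass_one])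
    (by rw [permGrass_comp, inv_mul_cancel, permGrass_one])).toLinearEquiv

/-- The action of a permutation on `GD(ℂ^m ⊗ ℂ^n)`, by conjugation; it sends `x_{ak}` to
`x_{σ(a)k}` and `∂_{ak}` to `∂_{σ(a)k}`, see `permGD_xOp` and `permGD_dOp`. -/
def permGD {m : ℕ} (n : ℕ) (σ : Equiv.Perm (Fin m)) : GD m n →ₐ[ℂ] GD m n :=
  (LinearEquiv.conjAlgEquiv ℂ (permGrassEquiv n σ)).toAlgHom

lemma permGD_comp {m n : ℕ} (σ : Equiv.Perm (Fin m)) (Y Z : GD m n)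
    (h : ∀ w, permGrass n σ (Y w) = Z (permGrass n σ w)) : permGD n σ Y = Z := by
  refine LinearMap.ext fun w => ?_
  change permGrass n σ (Y (permGrass n σ⁻¹ w)) = Z w
  rw [h]
  have := DFunLike.congr_fun (permGrass_comp (n := n) σ σ⁻¹) w
  rw [mul_inv_cancel, permGrass_one] at this
  exact congrArg Z this

lemma permGD_xOp {m n : ℕ} (σ : Equiv.Perm (Fin m)) (a : Fin m) (k : Fin n) :
    permGD n σ (xOp a k) = xOp (σ a) k := by
  refine permGD_comp σ _ _ fun w => ?_
  simp only [xOp, LinearMap.mulLeft_apply, map_mul, permGrass_ι]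

lemma permGD_dOp {m n : ℕ} (σ : Equiv.Perm (Fin m)) (a : Fin m) (k : Fin n) :
    permGD n σ (dOp a k) = dOp (σ a) k := by
  refine permGD_comp σ _ _ fun w => ?_
  induction w using CliffordAlgebra.left_induction with
  | algebraMap r =>
    have h1 : permGrass n σ (algebraMap ℂ (Grass m n) r) = algebraMap ℂ (Grass m n) r :=
      AlgHom.commutes _ r
    have h2 : ∀ b : Fin m, dOp b k (algebraMap ℂ (Grass m n) r) = 0 := fun b =>
      CliffordAlgebra.contractLeft_algebraMap (Q := (0 : QuadraticForm ℂ (Fin m × Fin n → ℂ))) _ r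
    change permGrass n σ (dOp a k (algebraMap ℂ (Grass m n) r)) =
      dOp (σ a) k (permGrass n σ (algebraMap ℂ (Grass m n) r))
    rw [h1, h2, h2, map_zero]
  | add x y hx hy => simp only [map_add, hx, hy]
  | ι_mul x v hx =>
    have h1 : ∀ (b : Fin m) (v : Fin m × Fin n → ℂ) (x : Grass m n),
        dOp b k (ExteriorAlgebra.ι ℂ v * x) = v (b, k) • x - ExteriorAlgebra.ι ℂ v * dOp b k x :=
      fun b v x => CliffordAlgebra.contractLeft_ι_mul
        (Q := (0 : QuadraticForm ℂ (Fin m × Fin n → ℂ))) _ v x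
    change permGrass n σ (dOp a k (ExteriorAlgebra.ι ℂ v * x)) =
      dOp (σ a) k (permGrass n σ (ExteriorAlgebra.ι ℂ v * x))
    have h2 : permGrass n σ (ExteriorAlgebra.ι ℂ v) =
        ExteriorAlgebra.ι ℂ (LinearMap.funLeft ℂ ℂ (Prod.map σ.symm id) v) :=
      ExteriorAlgebra.map_apply_ι _ _
    rw [h1, map_sub, map_mul, map_mul, h2, h1, map_smul, hx]
    simp [LinearMap.funLeft_apply]

/-- The action of a permutation on `U(gl_m)`, `E_{ab} ↦ E_{σ(a)σ(b)}`. -/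
def permU {m : ℕ} (σ : Equiv.Perm (Fin m)) : Ugl m →ₐ[ℂ] Ugl m :=
  UniversalEnvelopingAlgebra.lift ℂ
    ((UniversalEnvelopingAlgebra.ι ℂ).comp (Matrix.reindexLieEquiv σ).toLieHom)

lemma permU_eU {m : ℕ} (σ : Equiv.Perm (Fin m)) (a b : Fin m) :
    permU σ (eU a b) = eU (σ a) (σ b) := by
  rw [permU, eU, UniversalEnvelopingAlgebra.lift_ι_apply]
  simp [eU]

/-- The action of a permutation on `A`. -/
def permA {m : ℕ} (n : ℕ) (σ : Equiv.Perm (Fin m)) : AA m n →ₐ[ℂ] AA m n :=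
  (Algebra.TensorProduct.map (permU σ) (permGD n σ) :
    Ugl m ⊗[ℂ] GD m n →ₐ[ℂ] Ugl m ⊗[ℂ] GD m n)

lemma permA_inU {m n : ℕ} (σ : Equiv.Perm (Fin m)) (u : Ugl m) :
    permA n σ (inU n u) = inU n (permU σ u) := by
  refine (Algebra.TensorProduct.map_tmul (permU σ) (permGD n σ) u 1).trans ?_
  rw [map_one]; rfl

lemma permA_inG {m n : ℕ} (σ : Equiv.Perm (Fin m)) (Y : GD m n) :
    permA n σ (inG Y) = inG (permGD n σ Y) := by
  refine (Algebra.TensorProduct.map_tmul (permU σ) (permGD n σ) 1 Y).trans ?_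
  rw [map_one]; rfl

lemma permA_eA {m n : ℕ} (σ : Equiv.Perm (Fin m)) (a b : Fin m) :
    permA n σ (eA n a b) = eA n (σ a) (σ b) := by
  simp [eA, gam, permA_inU, permA_inG, permU_eU, permGD_xOp, permGD_dOp]

lemma permA_den {m n : ℕ} (σ : Equiv.Perm (Fin m)) {s : AA m n} (hs : s ∈ den m n) :
    permA n σ s ∈ den m n := by
  induction hs using Submonoid.closure_induction with
  | mem s hs =>
    obtain ⟨a, b, z, hab, rfl⟩ := hs
    refine Submonoid.subset_closure ⟨σ a, σ b, z, σ.injective.ne hab, ?_⟩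
    rw [map_add, map_sub, permA_eA, permA_eA, AlgHom.commutes]
  | one => rw [map_one]; exact Submonoid.one_mem _
  | mul x y _ _ hx hy => rw [map_mul]; exact Submonoid.mul_mem _ hx hy

/-- The action of a permutation on `Ā`; it sends `s⁻¹ Y` to `σ(s)⁻¹ σ(Y)`. -/
def permBar {m : ℕ} (n : ℕ) (σ : Equiv.Perm (Fin m)) : Abar m n →+* Abar m n :=
  OreLocalization.universalHom
    ((OreLocalization.numeratorRingHom : AA m n →+* Abar m n).comp (permA n σ).toRingHom)
    { toFun := fun s => OreLocalization.numeratorUnit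
        (⟨permA n σ s, permA_den σ s.2⟩ : den m n)
      map_one' := by
        refine Units.ext ?_
        change OreLocalization.oreDiv (permA n σ (1 : AA m n)) 1 = 1
        rw [map_one]; exact (OreLocalization.one_def).symm
      map_mul' := fun s t => by
        refine Units.ext ?_
        change (OreLocalization.numeratorHom (permA n σ ((s : AA m n) * t)) : Abar m n) =
          OreLocalization.numeratorHom (permA n σ (s : AA m n)) *
            OreLocalization.numeratorHom (permA n σ (t : AA m n))
        rw [map_mul, map_mul] }
    (fun _ => rfl)

/-! ### Zhelobenko operators

Here `c` and `d = c + 1` are two adjacent indices, so that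
`E_c = E_{cd}`, `F_c = E_{dc}` and `H_c = E_{cc} - E_{dd}`. -/

/-- `H_c^{(s)} = H_c (H_c - 1) ⋯ (H_c - s + 1)`. -/
def Hfall {m : ℕ} (n : ℕ) (c d : Fin m) : ℕ → AA m n
  | 0 => 1
  | s + 1 => Hfall n c d s * (eA n c c - eA n d d - algebraMap ℂ (AA m n) (s : ℂ))

lemma Hfall_den {m n : ℕ} {c d : Fin m} (hcd : (d : ℕ) = c + 1) (s : ℕ) :
    Hfall n c d s ∈ den m n := by
  induction s with
  | zero => exact Submonoid.one_mem _
  | succ s ih =>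
    refine Submonoid.mul_mem _ ih (Submonoid.subset_closure ⟨c, d, -(s : ℤ), ?_, ?_⟩)
    · rintro rfl
      omega
    · push_cast
      simp only [map_natCast, map_neg, sub_eq_add_neg]

/-- The adjoint action of `F_c` on `A`, `Y ↦ [F_c, Y]`. -/
def adF {m n : ℕ} (c d : Fin m) (Y : AA m n) : AA m n := eA n d c * Y - Y * eA n d c

/-- `ξ_c(Y) = Y + ∑_{s ≥ 1} (s! H_c^{(s)})⁻¹ E_c^s F̂_c^s(Y)`, where `F̂_c` is the adjoint action of
`F_c` (the term with `s = 0` is `Y`; only finitely many terms differ from zero). -/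
def xi {m n : ℕ} (c d : Fin m) (hcd : (d : ℕ) = c + 1) (Y : AA m n) : Abar m n :=
  ∑ᶠ s : ℕ, ((s.factorial : ℂ)⁻¹) •
    OreLocalization.oreDiv (eA n c d ^ s * (adF c d)^[s] Y)
      (⟨Hfall n c d s, Hfall_den hcd s⟩ : den m n)

/-- The labels of the simple root `ε_c`. -/
def eps {m : ℕ} (c d a : Fin m) : ℤ := (if a = c then 1 else 0) - (if a = d then 1 else 0)

/-- The shift of a polynomial function `X(μ)` to `X(μ + ε_c)`. -/
def shift {m : ℕ} (c d : Fin m) : MvPolynomial (Fin m) ℂ →ₐ[ℂ] MvPolynomial (Fin m) ℂ :=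
  MvPolynomial.aeval fun a => MvPolynomial.X a + MvPolynomial.C (eps c d a : ℂ)

lemma shift_den {m : ℕ} (c d : Fin m) {q : MvPolynomial (Fin m) ℂ} (hq : q ∈ denPoly m) :
    shift c d q ∈ denPoly m := by
  induction hq using Submonoid.closure_induction with
  | mem q hq =>
    obtain ⟨a, b, z, hab, rfl⟩ := hq
    refine Submonoid.subset_closure ⟨a, b, z + eps c d a - eps c d b, hab, ?_⟩
    simp only [shift, map_add, map_sub, MvPolynomial.aeval_X, MvPolynomial.algHom_C,
      MvPolynomial.algebraMap_eq, Int.cast_add, Int.cast_sub]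
    abel
  | one => rw [map_one]; exact Submonoid.one_mem _
  | mul x y _ _ hx hy => rw [map_mul]; exact Submonoid.mul_mem _ hx hy

/-- The defining property of the linear map `ξ̄_c : Ā → J̄ \ Ā`: for any `Y` in `A` and any fraction
`X = p / q` of `U(h)`, `ξ̄_c(X Y) = Z ξ_c(Y) + J̄` where `Z(μ) = X(μ + ε_c)`. -/
def IsXiBar {m n : ℕ} (c d : Fin m) (hcd : (d : ℕ) = c + 1)
    (f : Abar m n →ₗ[ℂ] Abar m n ⧸ Jbar m n) : Prop :=
  ∀ (p : MvPolynomial (Fin m) ℂ) (q : denPoly m) (Y : AA m n),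
    f (frac n p q * toBar Y) =
      (Jbar m n).mkQ (frac n (shift c d p) ⟨shift c d q, shift_den c d q.2⟩ * xi c d hcd Y)

/-- The defining property of the Zhelobenko operator `ξ̌_c` on `J̄ \ Ā`: it is the
composition `ξ̄_c σ_c`, applied to elements of `Ā` taken modulo `J̄`. -/
def IsZhelobenko {m n : ℕ} (c d : Fin m) (hcd : (d : ℕ) = c + 1)
    (g : (Abar m n ⧸ Jbar m n) →ₗ[ℂ] Abar m n ⧸ Jbar m n) : Prop :=
  ∃ f : Abar m n →ₗ[ℂ] Abar m n ⧸ Jbar m n, IsXiBar c d hcd f ∧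
    ∀ Y : Abar m n, g ((Jbar m n).mkQ Y) = f (permBar n (Equiv.swap c d) Y)

/-! ### Verma modules and coinvariants -/

/-- The left ideal of `U(gl_m)` generated by `E_{ab}` with `a < b` and by `E_{aa} - μ_a`. -/
def vermaIdeal {m : ℕ} (μ : Fin m → ℂ) : Submodule (Ugl m) (Ugl m) :=
  Submodule.span (Ugl m) ({u | ∃ a b : Fin m, a < b ∧ u = eU a b} ∪
    {u | ∃ a : Fin m, u = eU a a - algebraMap ℂ (Ugl m) (μ a)})

/-- The Verma module `M_μ`. -/
abbrev Verma {m : ℕ} (μ : Fin m → ℂ) := Ugl m ⧸ vermaIdeal μ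

/-- The vector space `M_μ ⊗ G(ℂ^m ⊗ ℂ^n)`. -/
abbrev VG {m : ℕ} (n : ℕ) (μ : Fin m → ℂ) := Verma μ ⊗[ℂ] Grass m n

/-- The action of `A = U(gl_m) ⊗ GD(ℂ^m ⊗ ℂ^n)` on `M_μ ⊗ G(ℂ^m ⊗ ℂ^n)`. -/
def act {m : ℕ} (n : ℕ) (μ : Fin m → ℂ) : AA m n →ₐ[ℂ] Module.End ℂ (VG n μ) :=
  ((Module.endTensorEndAlgHom (R := ℂ) (S := ℂ) (A := ℂ) (M := Verma μ) (N := Grass m n)).comp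
    (Algebra.TensorProduct.map (Algebra.lsmul ℂ ℂ (Verma μ)) (AlgHom.id ℂ (GD m n))) :
      Ugl m ⊗[ℂ] GD m n →ₐ[ℂ] Module.End ℂ (VG n μ))

/-- The vector `1_μ ⊗ 1`. -/
def vac {m : ℕ} (n : ℕ) (μ : Fin m → ℂ) : VG n μ := (vermaIdeal μ).mkQ 1 ⊗ₜ 1

/-- The subspace `n · (M_μ ⊗ G(ℂ^m ⊗ ℂ^n))`, with `n` spanned by the `E_{ab}` with `a > b` acting
diagonally. -/
def nSub {m : ℕ} (n : ℕ) (μ : Fin m → ℂ) : Submodule ℂ (VG n μ) :=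
  Submodule.span ℂ {w | ∃ (a b : Fin m) (v : VG n μ), b < a ∧ w = act n μ (eA n a b) v}

/-- The space of `n`-coinvariants of `M_μ ⊗ G(ℂ^m ⊗ ℂ^n)`. -/
abbrev Coinv {m : ℕ} (n : ℕ) (μ : Fin m → ℂ) := VG n μ ⧸ nSub n μ

/-- The left ideal `I_μ` of `A` generated by `E_{ab}` with `a < b`, by `E_{aa} - μ_a` and by all
the `∂_{bk}`. -/
def Imu {m : ℕ} (n : ℕ) (μ : Fin m → ℂ) : Submodule (AA m n) (AA m n) :=
  Submodule.span (AA m n) ({Y | ∃ a b : Fin m, a < b ∧ Y = eA n a b} ∪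
    {Y | ∃ a : Fin m, Y = eA n a a - algebraMap ℂ (AA m n) (μ a)} ∪
    {Y | ∃ (b : Fin m) (k : Fin n), Y = inG (dOp b k)})

/-- The left ideal `Ī_μ` of `Ā`. -/
def Ibar {m : ℕ} (n : ℕ) (μ : Fin m → ℂ) : Submodule ℂ (Abar m n) :=
  barSpan ((Imu n μ).restrictScalars ℂ)

/-- The double quotient `J̄ \ Ā / Ī_μ`. -/
abbrev DQ {m : ℕ} (n : ℕ) (μ : Fin m → ℂ) := Abar m n ⧸ (Jbar m n ⊔ Ibar n μ)

/-- The defining property of the identification of `J̄ \ Ā / Ī_μ` with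
`(M_μ ⊗ G(ℂ^m ⊗ ℂ^n))_n`: the class of `Y` in `A` corresponds to the class of `Y (1_μ ⊗ 1)`. -/
def IsIdent {m n : ℕ} (μ : Fin m → ℂ) (e : DQ n μ ≃ₗ[ℂ] Coinv n μ) : Prop :=
  ∀ Y : AA m n, e ((Jbar m n ⊔ Ibar n μ).mkQ (toBar Y)) = (nSub n μ).mkQ (act n μ Y (vac n μ))

/-- The shifted action `σ ∘ μ = σ(μ + ρ) - ρ`, where `ρ = (0, -1, …, 1 - m)`. -/
def dot {m : ℕ} (σ : Equiv.Perm (Fin m)) (μ : Fin m → ℂ) : Fin m → ℂ :=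
  fun a => (μ (σ⁻¹ a) - ((σ⁻¹ a : Fin m) : ℕ)) + (a : ℕ)

/-- The linear map `I` from `(M_μ ⊗ G)_n` to `(M_ν ⊗ G)_n` is induced by the operator `g` on
`J̄ \ Ā`, via the identifications `e` and `e'`. -/
def IsInduced {m n : ℕ} {μ ν : Fin m → ℂ}
    (g : (Abar m n ⧸ Jbar m n) →ₗ[ℂ] Abar m n ⧸ Jbar m n)
    (e : DQ n μ ≃ₗ[ℂ] Coinv n μ) (e' : DQ n ν ≃ₗ[ℂ] Coinv n ν)
    (I : Coinv n μ →ₗ[ℂ] Coinv n ν) : Prop :=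
  ∀ y : Abar m n ⧸ Jbar m n,
    I (e (Submodule.factor (le_sup_left : Jbar m n ≤ Jbar m n ⊔ Ibar n μ) y)) =
      e' (Submodule.factor (le_sup_left : Jbar m n ≤ Jbar m n ⊔ Ibar n ν) (g y))

/-! ### The action of the Yangian generators -/

/-- The element
`∑ E_{c₁c₀} E_{c₂c₁} ⋯ E_{c_s c_{s-1}} ⊗ x_{c₀i} ∂_{c_s j}` (sum over `c₀, …, c_s`) of
`U(gl_m) ⊗ GD(ℂ^m ⊗ ℂ^n)`, by which the Yangian generator `T_{ij}^{(s+1)}` acts. -/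
def TA {m n : ℕ} (s : ℕ) (i j : Fin n) : AA m n :=
  ∑ c : Fin (s + 1) → Fin m,
    inU n (List.ofFn fun k : Fin s => eU (c k.succ) (c k.castSucc)).prod *
      inG (xOp (c 0) i * dOp (c (Fin.last s)) j)

/-- Auxiliary: the sum of `E_{c₁c₀} ⋯ E_{c_s c_{s-1}}` over all paths from `c₀ = p` to
`c_s = q`. -/
def pathSum {m : ℕ} : ℕ → Fin m → Fin m → Ugl m
  | 0, p, q => if p = q then 1 else 0
  | s + 1, p, q => ∑ r, pathSum s p r * eU q r

lemma pathSum_eU {m : ℕ} (s : ℕ) (a b p q : Fin m) :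
    eU a b * pathSum s p q - pathSum s p q * eU a b =
      (if b = q then pathSum s p a else 0) - (if a = p then pathSum s b q else 0) := by
  induction s generalizing q with
  | zero =>
    by_cases h1 : p = q
    · subst h1
      by_cases h2 : b = p
      · by_cases h3 : a = p
        · simp [pathSum, h2, h3]
        · simp [pathSum, h2, h3, Ne.symm h3]
      · simp [pathSum, h2]
    · by_cases h2 : b = q
      · by_cases h3 : a = p
        · simp [pathSum, h1, h2, h3]
        · simp [pathSum, h1, h2, h3, Ne.symm h3]
      · simp [pathSum, h1, h2]
  | succ s ih =>
    have h : ∀ r, eU a b * (pathSum s p r * eU q r) - pathSum s p r * eU q r * eU a b =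
        ((if b = q then pathSum s p r * eU a r else 0) -
          (if a = r then pathSum s p a * eU q b else 0)) +
        ((if b = r then pathSum s p a * eU q b else 0) -
          (if a = p then pathSum s b r * eU q r else 0)) := by
      intro r
      have e : eU a b * (pathSum s p r * eU q r) - pathSum s p r * eU q r * eU a b =
          pathSum s p r * (eU a b * eU q r - eU q r * eU a b) +
            (eU a b * pathSum s p r - pathSum s p r * eU a b) * eU q r := by noncomm_ring
      rw [e, ih, eU_eU, mul_sub, sub_mul, mul_ite, mul_ite, ite_mul, ite_mul, mul_zero, zero_mul]
      congr 2
      · split_ifs with h1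
        · rw [h1]
        · rfl
      · split_ifs with h1
        · rw [h1]
        · rfl
    simp only [pathSum]
    rw [Finset.mul_sum, Finset.sum_mul, ← Finset.sum_sub_distrib,
      Finset.sum_congr rfl fun r _ => h r]
    rw [Finset.sum_add_distrib, Finset.sum_sub_distrib, Finset.sum_sub_distrib]
    simp only [Finset.sum_ite_eq, Finset.mem_univ, if_true]
    split_ifs <;> simp <;> abel

lemma sum_paths {m n : ℕ} (s : ℕ) (f : Fin m → Fin m → AA m n) :
    ∑ c : Fin (s + 1) → Fin m,
      inU n (List.ofFn fun k : Fin s => eU (c k.succ) (c k.castSucc)).prod *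
        f (c 0) (c (Fin.last s)) =
      ∑ p, ∑ q, inU n (pathSum s p q) * f p q := by
  induction s generalizing f with
  | zero =>
    rw [← (Equiv.funUnique (Fin 1) (Fin m)).symm.sum_comp]
    refine Finset.sum_congr rfl fun p _ => ?_
    rw [Finset.sum_eq_single p]
    · simp [pathSum]
    · intro q _ hq
      simp [pathSum, Ne.symm hq]
    · simp
  | succ s ih =>
    have h : ∀ q : Fin m, ∑ c : Fin (s + 1) → Fin m,
        inU n (List.ofFn fun k : Fin s => eU (c k.succ) (c k.castSucc)).prod *
          (inU n (eU q (c (Fin.last s))) * f (c 0) q) =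
        ∑ p, ∑ r, inU n (pathSum s p r) * (inU n (eU q r) * f p q) :=
      fun q => ih fun p r => inU n (eU q r) * f p q
    rw [← (Fin.snocEquiv fun _ : Fin (s + 2) => Fin m).sum_comp, Fintype.sum_prod_type]
    have h2 : ∀ q : Fin m, ∑ c : Fin (s + 1) → Fin m,
        inU n (List.ofFn fun k : Fin (s + 1) =>
          eU ((Fin.snoc c q : Fin (s + 2) → Fin m) k.succ)
            ((Fin.snoc c q : Fin (s + 2) → Fin m) k.castSucc)).prod *
          f ((Fin.snoc c q : Fin (s + 2) → Fin m) 0)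
            ((Fin.snoc c q : Fin (s + 2) → Fin m) (Fin.last (s + 1))) =
        ∑ p, ∑ r, inU n (pathSum s p r) * (inU n (eU q r) * f p q) := by
      intro q
      rw [← h q]
      refine Finset.sum_congr rfl fun c _ => ?_
      have h0 : (Fin.snoc c q : Fin (s + 2) → Fin m) 0 = c 0 :=
        Fin.snoc_castSucc (α := fun _ => Fin m) q c 0
      rw [List.ofFn_succ', List.concat_eq_append, List.prod_append, List.prod_singleton, map_mul,
        h0, Fin.snoc_last, mul_assoc]
      congr 3
      · congr 1
        funext k
        rw [← Fin.castSucc_succ]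
        simp only [Fin.snoc_castSucc]
      · rw [Fin.succ_last, Fin.snoc_last, Fin.snoc_castSucc]
    refine (Finset.sum_congr rfl fun q _ => h2 q).trans ?_
    rw [Finset.sum_comm]
    refine Finset.sum_congr rfl fun p _ => Finset.sum_congr rfl fun q _ => ?_
    rw [pathSum, map_sum, Finset.sum_mul]
    exact Finset.sum_congr rfl fun r _ => by rw [map_mul, mul_assoc]

lemma TA_eq {m n : ℕ} (s : ℕ) (i j : Fin n) :
    (TA s i j : AA m n) = ∑ p, ∑ q, inU n (pathSum s p q) * inG (xOp p i * dOp q j) :=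
  sum_paths s fun p q => inG (xOp p i * dOp q j)

lemma TA_eA {m n : ℕ} (s : ℕ) (i j : Fin n) (a b : Fin m) :
    eA n a b * TA s i j = TA s i j * eA n a b := by
  rw [← sub_eq_zero, TA_eq]
  have h : ∀ p q : Fin m, eA n a b * (inU n (pathSum s p q) * inG (xOp p i * dOp q j)) -
      (inU n (pathSum s p q) * inG (xOp p i * dOp q j)) * eA n a b =
      ((if b = q then inU n (pathSum s p a) * inG (xOp p i * dOp b j) else 0) -
        (if a = p then inU n (pathSum s b q) * inG (xOp a i * dOp q j) else 0)) +
      ((if b = p then inU n (pathSum s b q) * inG (xOp a i * dOp q j) else 0) -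
        (if a = q then inU n (pathSum s p a) * inG (xOp p i * dOp b j) else 0)) := by
    intro p q
    have e : eA n a b * (inU n (pathSum s p q) * inG (xOp p i * dOp q j)) -
        (inU n (pathSum s p q) * inG (xOp p i * dOp q j)) * eA n a b =
        (eA n a b * inU n (pathSum s p q) - inU n (pathSum s p q) * eA n a b) *
          inG (xOp p i * dOp q j) +
        inU n (pathSum s p q) * (eA n a b * inG (xOp p i * dOp q j) -
          inG (xOp p i * dOp q j) * eA n a b) := by noncomm_ring
    rw [e, eA_inU, eA_inG, pathSum_eU, gam_xd, map_sub, map_sub, sub_mul, mul_sub]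
    congr 2
    · split_ifs with h1
      · rw [h1]
      · rw [map_zero, zero_mul]
    · split_ifs with h1
      · rw [h1]
      · rw [map_zero, zero_mul]
    · split_ifs with h1
      · rw [h1]
      · rw [map_zero, mul_zero]
    · split_ifs with h1
      · rw [h1]
      · rw [map_zero, mul_zero]
  simp_rw [Finset.mul_sum, Finset.sum_mul, ← Finset.sum_sub_distrib, h]
  simp [Finset.sum_add_distrib, Finset.sum_sub_distrib, Finset.sum_ite_irrel]

/-- The action of `T_{ij}^{(s+1)}` on the space of `n`-coinvariants of `M_μ ⊗ G(ℂ^m ⊗ ℂ^n)`. -/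
def TCoinv {m n : ℕ} (μ : Fin m → ℂ) (s : ℕ) (i j : Fin n) : Coinv n μ →ₗ[ℂ] Coinv n μ :=
  (nSub n μ).mapQ (nSub n μ) (act n μ (TA s i j)) (by
    refine Submodule.span_le.2 ?_
    rintro _ ⟨a, b, v, hab, rfl⟩
    refine Submodule.subset_span ⟨a, b, act n μ (TA s i j) v, hab, ?_⟩
    rw [← Module.End.mul_apply, ← Module.End.mul_apply, ← map_mul, ← map_mul, TA_eA])

end

end MickelssonGL

open MickelssonGL

/-!
The argument is a computation modulo `J̄`. Put `θ_s(w) = (s! H_c^{(s)})⁻¹ w + J̄` and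
`y_s = F̂_c^s(Y)`, so that `ξ_c(Y)` is the sum of the terms `θ_s(E_c^s y_s)`; the sum is finite
since the adjoint action of `F_c` is locally nilpotent on `A` (`mem_adFNil`). The relation
`E_c^{s+1} F_c = F_c E_c^{s+1} + (s+1)(H_c - s) E_c^s` gives
`θ_{s+1}(E_c^{s+1} F_c w) = θ_s(E_c^s w)` (`theta_pow_mul_F`), because a factor `F_c` on the left is
killed by `J̄`. With it the series for `E_c Y` and `Y F_c` telescope to zero, and those for
`E_{aa} Y` and `Y E_{aa}` telescope to shifted copies of the series for `Y`
(`xiQ_E_mul`, `xiQ_mul_F`, `xiQ_hPoly_mul`, `xiQ_mul_cartan`).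

These identities have the following consequences. The left shift property shows that `ξ̄_c` is
compatible with clearing denominators, hence well defined. The vanishing on `E_c A`, together with
the invariance under `E_c` and `F̂_c` of the right ideal generated by the other lowering operators,
shows `ξ̄_c(σ_c(J̄)) = 0`, so that the Zhelobenko operator exists. The vanishing on `A F_c`, the
right shift property and the invariance under `F̂_c` of the left ideal generated by the derivations
and the raising operators other than `E_c` show that `ξ_c` sends `σ_c(I_μ)` to `J̄ + Ī_ν` for
`ν = σ_c ∘ μ`: the right shift of `E_{aa}` by `ε_c` accounts for the shifted action
(`xiQ_permA_of_mem_Imu`).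

For the identification with coinvariants, the denominators act invertibly on `M_ν ⊗ G` when `ν` is
generic, because `M_ν ⊗ G` is spanned by eigenvectors of `E_{aa} - E_{bb}` with eigenvalues in
`ν_a - ν_b + ℤ`. Thus `Ā` acts on `M_ν ⊗ G`, and `y ↦ y (1_ν ⊗ 1)` maps onto the coinvariants. Its
kernel is `J̄ + Ī_ν` (`ker_toCoinv`), because the annihilator of `1_ν ⊗ 1` in `A` is exactly `I_ν`
(`act_vac_eq_zero_iff`); the last fact holds since, modulo the left ideal generated by the
derivations, every endomorphism of the Grassmann algebra is a left multiplication
(`sub_mulLeft_mem_dIdeal`).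

Finally, the elements by which the Yangian generators act commute with `gl_m` and are fixed by
`𝔖_m`, so left multiplication by them commutes with the Zhelobenko operator
(`IsZhelobenko.comm_TQ`).
-/

namespace MickelssonGL

noncomputable section

attribute [local instance] LieRing.ofAssociativeRing LieAlgebra.ofAssociativeAlgebra

/-! ### Fractions -/

section Fractions

variable {m n : ℕ}

/-- The map `toBar` as an algebra homomorphism. -/
def toBarHom (m n : ℕ) : AA m n →ₐ[ℂ] Abar m n :=
  { (OreLocalization.numeratorRingHom : AA m n →+* Abar m n) with
    commutes' := fun _ => rfl }

lemma toBar_mul (X Y : AA m n) : toBar (X * Y) = toBar X * toBar Y :=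
  map_mul (toBarHom m n) X Y

lemma toBar_add (X Y : AA m n) : toBar (X + Y) = toBar X + toBar Y :=
  map_add (toBarHom m n) X Y

lemma toBar_smul (z : ℂ) (Y : AA m n) : toBar (z • Y) = z • toBar Y :=
  map_smul (toBarHom m n) z Y

lemma toBar_one : toBar (1 : AA m n) = 1 := map_one (toBarHom m n)

lemma oreDiv_eq_frac_mul (w : AA m n) (s : den m n) (q : denPoly m) (h : hPoly m n q = s) :
    (OreLocalization.oreDiv w s : Abar m n) = frac n 1 q * toBar w := by
  obtain ⟨s, hs⟩ := s
  subst h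
  rw [frac, map_one, toBar, OreLocalization.mul_div_one, one_mul]

lemma frac_eq (p : MvPolynomial (Fin m) ℂ) (q : denPoly m) :
    frac n p q = frac n 1 q * toBar (hPoly m n p) :=
  oreDiv_eq_frac_mul _ _ q rfl

lemma toBar_hPoly_mul_frac (q : denPoly m) : toBar (hPoly m n q) * frac n 1 q = 1 := by
  rw [frac, map_one]
  exact OreLocalization.mul_inv ⟨hPoly m n q, hPoly_den n q.2⟩ 1

lemma frac_mul_toBar_hPoly (q : denPoly m) : frac n 1 q * toBar (hPoly m n q) = 1 := by
  rw [frac, map_one]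
  exact OreLocalization.mul_inv 1 ⟨hPoly m n q, hPoly_den n q.2⟩

lemma hPoly_mul_comm (p q : MvPolynomial (Fin m) ℂ) :
    hPoly m n p * hPoly m n q = hPoly m n q * hPoly m n p := by
  rw [← map_mul, mul_comm, map_mul]

/-- An element of `A` which commutes with `q` commutes with `q⁻¹`. -/
lemma toBar_mul_frac_comm (Y : AA m n) (q : denPoly m)
    (h : Y * hPoly m n q = hPoly m n q * Y) : toBar Y * frac n 1 q = frac n 1 q * toBar Y := by
  calc toBar Y * frac n 1 q
      = frac n 1 q * toBar (hPoly m n q) * toBar Y * frac n 1 q := by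
        rw [frac_mul_toBar_hPoly, one_mul]
    _ = frac n 1 q * toBar Y * (toBar (hPoly m n q) * frac n 1 q) := by
        rw [mul_assoc (frac n 1 q), ← toBar_mul, ← h, toBar_mul]; simp only [mul_assoc]
    _ = _ := by rw [toBar_hPoly_mul_frac, mul_one]

lemma toBar_hPoly_mul_frac_comm (p : MvPolynomial (Fin m) ℂ) (q : denPoly m) :
    toBar (hPoly m n p) * frac n 1 q = frac n 1 q * toBar (hPoly m n p) :=
  toBar_mul_frac_comm _ q (hPoly_mul_comm p q)

lemma frac_one_mul (q r : denPoly m) : frac n 1 (q * r) = frac n 1 q * frac n 1 r := by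
  have h : toBar (hPoly m n (q * r : denPoly m)) * (frac n 1 q * frac n 1 r) = 1 := by
    rw [Submonoid.coe_mul, mul_comm, map_mul, toBar_mul, mul_assoc,
      ← mul_assoc (toBar (hPoly m n (q : MvPolynomial (Fin m) ℂ))), toBar_hPoly_mul_frac, one_mul,
      toBar_hPoly_mul_frac]
  calc frac n 1 (q * r) = frac n 1 (q * r) *
        (toBar (hPoly m n (q * r : denPoly m)) * (frac n 1 q * frac n 1 r)) := by rw [h, mul_one]
    _ = _ := by rw [← mul_assoc, frac_mul_toBar_hPoly, one_mul]

lemma frac_mul_frac (p p' : MvPolynomial (Fin m) ℂ) (q q' : denPoly m) :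
    frac n p q * frac n p' q' = frac n (p * p') (q * q') := by
  rw [frac_eq p, frac_eq p', frac_eq (p * p'), frac_one_mul, map_mul, toBar_mul,
    mul_assoc, ← mul_assoc (toBar (hPoly m n p)), toBar_hPoly_mul_frac_comm]
  simp only [mul_assoc]

lemma frac_one_right (p : MvPolynomial (Fin m) ℂ) : frac n p 1 = toBar (hPoly m n p) := by
  have h := toBar_hPoly_mul_frac (n := n) (1 : denPoly m)
  rw [Submonoid.coe_one, map_one, toBar_one, one_mul] at h
  rw [frac_eq, h, one_mul]

lemma exists_hPoly_eq {s : AA m n} (hs : s ∈ den m n) : ∃ q : denPoly m, hPoly m n q = s := by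
  induction hs using Submonoid.closure_induction with
  | mem s hs =>
    obtain ⟨a, b, z, hab, rfl⟩ := hs
    refine ⟨⟨_, Submonoid.subset_closure ⟨a, b, z, hab, rfl⟩⟩, ?_⟩
    rw [map_add, map_sub, hPoly_X, hPoly_X, ← MvPolynomial.algebraMap_eq, AlgHom.commutes]
  | one => exact ⟨1, by simp⟩
  | mul x y _ _ hx hy =>
    obtain ⟨p, rfl⟩ := hx
    obtain ⟨q, rfl⟩ := hy
    exact ⟨p * q, by simp⟩

lemma exists_frac_mul (y : Abar m n) :
    ∃ (q : denPoly m) (Y : AA m n), y = frac n 1 q * toBar Y := by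
  induction y using OreLocalization.ind with
  | _ Y s =>
    obtain ⟨q, hq⟩ := exists_hPoly_eq s.2
    exact ⟨q, Y, oreDiv_eq_frac_mul Y s q hq⟩

lemma exists_of_toBar_eq {X Y : AA m n} (h : toBar X = toBar Y) :
    ∃ q : denPoly m, hPoly m n q * X = hPoly m n q * Y := by
  rw [toBar, toBar, OreLocalization.oreDiv_eq_iff] at h
  obtain ⟨u, v, h1, h2⟩ := h
  obtain ⟨q, hq⟩ := exists_hPoly_eq u.2
  refine ⟨q, ?_⟩
  have h3 : (u : AA m n) = v := by simpa using h2
  have h4 : (u : AA m n) * Y = v * X := h1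
  rw [hq, h4, h3]

/-- The subalgebra of the elements whose left multiplication preserves a subspace. -/
def leftStab {B : Type*} [Ring B] [Algebra ℂ B] (K : Submodule ℂ B) : Subalgebra ℂ B where
  carrier := {x | ∀ y ∈ K, x * y ∈ K}
  mul_mem' := fun {a b} ha hb y hy => by rw [mul_assoc]; exact ha _ (hb _ hy)
  add_mem' := fun {a b} ha hb y hy => by rw [add_mul]; exact K.add_mem (ha _ hy) (hb _ hy)
  algebraMap_mem' := fun r y hy => by rw [← Algebra.smul_def]; exact K.smul_mem _ hy

/-- The action of the stabiliser of `K` on the quotient by `K`, by left multiplication. -/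
def quotMul {B : Type*} [Ring B] [Algebra ℂ B] (K : Submodule ℂ B) (x : leftStab K) :
    (B ⧸ K) →ₗ[ℂ] B ⧸ K :=
  K.mapQ K (LinearMap.mulLeft ℂ (x : B)) x.2

lemma frac_mem_leftStab (K : Submodule ℂ (AA m n)) (p : MvPolynomial (Fin m) ℂ)
    (q : denPoly m) : frac n p q ∈ leftStab (barSpan K) := by
  intro y hy
  induction hy using Submodule.span_induction with
  | mem y hy =>
    obtain ⟨p', q', Y, hY, rfl⟩ := hy
    refine Submodule.subset_span ⟨p * p', q * q', Y, hY, ?_⟩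
    rw [← mul_assoc, frac_mul_frac]
  | zero => rw [mul_zero]; exact Submodule.zero_mem _
  | add x y _ _ hx hy => rw [mul_add]; exact Submodule.add_mem _ hx hy
  | smul c x _ hx => rw [mul_smul_comm]; exact Submodule.smul_mem _ _ hx

lemma frac_mul_toBar_mem (K : Submodule ℂ (AA m n)) (p : MvPolynomial (Fin m) ℂ)
    (q : denPoly m) {Y : AA m n} (hY : Y ∈ K) : frac n p q * toBar Y ∈ barSpan K :=
  Submodule.subset_span ⟨p, q, Y, hY, rfl⟩

/-- Left multiplication by an element of `A` which commutes with `U(h)` and preserves `K`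
preserves the span of the fractions of `U(h)` times `K`. -/
lemma toBar_mem_leftStab (K : Submodule ℂ (AA m n)) (T : AA m n)
    (hT : ∀ p, T * hPoly m n p = hPoly m n p * T) (hK : ∀ Y ∈ K, T * Y ∈ K) :
    toBar T ∈ leftStab (barSpan K) := by
  intro y hy
  induction hy using Submodule.span_induction with
  | mem y hy =>
    obtain ⟨p, q, Y, hY, rfl⟩ := hy
    refine Submodule.subset_span ⟨p, q, T * Y, hK Y hY, ?_⟩
    rw [frac_eq, ← mul_assoc, ← mul_assoc, toBar_mul_frac_comm _ _ (hT q), toBar_mul,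
      mul_assoc (frac n 1 q), ← toBar_mul, hT, toBar_mul]
    simp only [mul_assoc]
  | zero => rw [mul_zero]; exact Submodule.zero_mem _
  | add x y _ _ hx hy => rw [mul_add]; exact Submodule.add_mem _ hx hy
  | smul c x _ hx => rw [mul_smul_comm]; exact Submodule.smul_mem _ _ hx

end Fractions

/-! ### Local nilpotency of the adjoint action of `F_c` -/

section LocallyNilpotent

variable {m n : ℕ}

lemma subalgebra_Ugl_eq_top (S : Subalgebra ℂ (Ugl m)) (h : ∀ a b, eU a b ∈ S) : S = ⊤ := by
  have hmat : ∀ M : Matrix (Fin m) (Fin m) ℂ, UniversalEnvelopingAlgebra.ι ℂ M ∈ S := by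
    intro M
    rw [Matrix.matrix_eq_sum_single M, map_sum]
    refine Subalgebra.sum_mem _ fun p _ => ?_
    rw [map_sum]
    refine Subalgebra.sum_mem _ fun q _ => ?_
    have : Matrix.single p q (M p q) = M p q • Matrix.single p q (1 : ℂ) := by
      rw [Matrix.smul_single, smul_eq_mul, mul_one]
    rw [this, map_smul]
    exact Subalgebra.smul_mem _ (h p q) _
  let f : Matrix (Fin m) (Fin m) ℂ →ₗ⁅ℂ⁆ S :=
    { toFun := fun M => ⟨UniversalEnvelopingAlgebra.ι ℂ M, hmat M⟩
      map_add' := fun x y => Subtype.ext (map_add _ x y)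
      map_smul' := fun c x => Subtype.ext (map_smul _ c x)
      map_lie' := fun {x y} => Subtype.ext (LieHom.map_lie _ x y) }
  have hid : S.val.comp (UniversalEnvelopingAlgebra.lift ℂ f) = AlgHom.id ℂ (Ugl m) := by
    refine UniversalEnvelopingAlgebra.hom_ext ℂ (LieHom.ext fun x => ?_)
    simp [f]
  rw [eq_top_iff]
  intro u _
  have e : ((UniversalEnvelopingAlgebra.lift ℂ f u : S) : Ugl m) = u := DFunLike.congr_fun hid u
  exact e ▸ (UniversalEnvelopingAlgebra.lift ℂ f u).2

/-- The adjoint action of `F_c` as a linear map. -/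
def adFLin (n : ℕ) (c d : Fin m) : Module.End ℂ (AA m n) :=
  LinearMap.mulLeft ℂ (eA n d c) - LinearMap.mulRight ℂ (eA n d c)

lemma adFLin_apply (c d : Fin m) (Y : AA m n) :
    adFLin n c d Y = eA n d c * Y - Y * eA n d c := rfl

lemma iterate_adF (c d : Fin m) (s : ℕ) (Y : AA m n) :
    (adF c d)^[s] Y = (adFLin n c d ^ s) Y := by
  rw [Module.End.pow_apply]
  rfl

lemma adFLin_mul (c d : Fin m) (X Y : AA m n) :
    adFLin n c d (X * Y) = adFLin n c d X * Y + X * adFLin n c d Y := by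
  simp only [adFLin_apply]
  noncomm_ring

/-- The elements of `A` killed by some power of the adjoint action of `F_c`. -/
def adFNil (n : ℕ) (c d : Fin m) : Subalgebra ℂ (AA m n) where
  carrier := {Y | ∃ N : ℕ, (adFLin n c d ^ N) Y = 0}
  mul_mem' := by
    have key : ∀ (k a b : ℕ) (X Y : AA m n), a + b = k → (adFLin n c d ^ a) X = 0 →
        (adFLin n c d ^ b) Y = 0 → (adFLin n c d ^ k) (X * Y) = 0 := by
      intro k
      induction k with
      | zero =>
        intro a b X Y hab hX hY
        obtain ⟨rfl, rfl⟩ : a = 0 ∧ b = 0 := by omega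
        have h : X = 0 := by simpa using hX
        rw [h, zero_mul, map_zero]
      | succ k ih =>
        intro a b X Y hab hX hY
        rcases a with _ | a
        · have h : X = 0 := by simpa using hX
          rw [h, zero_mul, map_zero]
        rcases b with _ | b
        · have h : Y = 0 := by simpa using hY
          rw [h, mul_zero, map_zero]
        rw [pow_succ, Module.End.mul_apply, adFLin_mul, map_add,
          ih a (b + 1) _ _ (by omega) (by rwa [pow_succ] at hX) hY,
          ih (a + 1) b _ _ (by omega) hX (by rwa [pow_succ] at hY), add_zero]
    rintro X Y ⟨a, ha⟩ ⟨b, hb⟩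
    exact ⟨a + b, key _ a b X Y rfl ha hb⟩
  add_mem' := by
    rintro X Y ⟨a, ha⟩ ⟨b, hb⟩
    have hX : (adFLin n c d ^ (a + b)) X = 0 := by
      rw [add_comm, pow_add, Module.End.mul_apply, ha, map_zero]
    have hY : (adFLin n c d ^ (a + b)) Y = 0 := by
      rw [pow_add, Module.End.mul_apply, hb, map_zero]
    exact ⟨a + b, by rw [map_add, hX, hY, add_zero]⟩
  algebraMap_mem' := fun r => ⟨1, by
    rw [pow_one, adFLin_apply, Algebra.commutes, sub_self]⟩

lemma mem_adFNil_of_intertwine {c d : Fin m} {V : Type*} [AddCommGroup V] [Module ℂ V]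
    (φ : V →ₗ[ℂ] AA m n) (δ : Module.End ℂ V) (h : ∀ v, adFLin n c d (φ v) = φ (δ v))
    (hδ : IsNilpotent δ) (v : V) : φ v ∈ adFNil n c d := by
  obtain ⟨N, hN⟩ := hδ
  have key : ∀ (k : ℕ) (v : V), (adFLin n c d ^ k) (φ v) = φ ((δ ^ k) v) := by
    intro k
    induction k with
    | zero => intro v; simp
    | succ k ih =>
      intro v
      rw [pow_succ, pow_succ, Module.End.mul_apply, Module.End.mul_apply, h, ih]
  exact ⟨N, by rw [key, hN, LinearMap.zero_apply, map_zero]⟩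

lemma isNilpotent_mulLeft_sub_mulRight {B : Type*} [Ring B] [Algebra ℂ B] {x : B}
    (hx : IsNilpotent x) : IsNilpotent (LinearMap.mulLeft ℂ x - LinearMap.mulRight ℂ x) :=
  (LinearMap.commute_mulLeft_right (R := ℂ) (A := B) x x).isNilpotent_sub
    ((LinearMap.isNilpotent_mulLeft_iff ℂ x).2 hx) ((LinearMap.isNilpotent_mulRight_iff ℂ x).2 hx)

lemma dOp_mul_self (a : Fin m) (k : Fin n) : (dOp a k * dOp a k : GD m n) = 0 :=
  LinearMap.ext fun w => CliffordAlgebra.contractLeft_contractLeft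
    (Q := (0 : QuadraticForm ℂ (Fin m × Fin n → ℂ))) _ w

/-- An operator `x_{ak} ∂_{bk}` with `a ≠ b` squares to zero, and such operators with different
`k` commute. -/
lemma isNilpotent_gam {a b : Fin m} (hab : a ≠ b) : IsNilpotent (gam n a b : GD m n) := by
  have anti : ∀ k l : Fin n, (dOp b k * xOp a l : GD m n) = -(xOp a l * dOp b k) := by
    intro k l
    rw [dOp_mul_xOp, if_neg (fun h => hab h.1), zero_sub]
  have hmul : ∀ k l : Fin n, (xOp a k * dOp b k * (xOp a l * dOp b l) : GD m n) =
      -(xOp a k * xOp a l * (dOp b k * dOp b l)) := by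
    intro k l
    calc (xOp a k * dOp b k * (xOp a l * dOp b l) : GD m n)
        = xOp a k * (dOp b k * xOp a l) * dOp b l := by noncomm_ring
      _ = _ := by rw [anti]; noncomm_ring
  refine Commute.isNilpotent_sum (fun k _ => ⟨2, ?_⟩) (fun k l _ _ => ?_)
  · rw [pow_two, hmul, dOp_mul_self, mul_zero, neg_zero]
  · change xOp a k * dOp b k * (xOp a l * dOp b l) = xOp a l * dOp b l * (xOp a k * dOp b k)
    rw [hmul, hmul, xOp_mul_xOp a a k l, dOp_mul_dOp b b k l]
    noncomm_ring

lemma mem_adFNil {c d : Fin m} (hcd : c ≠ d) (Y : AA m n) : Y ∈ adFNil n c d := by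
  refine AA_induction (Subalgebra.zero_mem _) (fun u Z => Subalgebra.mul_mem _ ?_ ?_)
    (fun X Y hX hY => Subalgebra.add_mem _ hX hY) Y
  · have h : (adFNil n c d).comap (inU n) = ⊤ := by
      refine subalgebra_Ugl_eq_top _ fun a b => ?_
      refine mem_adFNil_of_intertwine
        ((inU n).toLinearMap ∘ₗ (UniversalEnvelopingAlgebra.ι ℂ : _ →ₗ⁅ℂ⁆ Ugl m).toLinearMap)
        (LinearMap.mulLeft ℂ (Matrix.single d c (1 : ℂ)) -
          LinearMap.mulRight ℂ (Matrix.single d c (1 : ℂ))) (fun M => ?_)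
        (isNilpotent_mulLeft_sub_mulRight ⟨2, ?_⟩) (Matrix.single a b (1 : ℂ))
      · rw [adFLin_apply]
        refine (eA_inU d c _).trans (congrArg (inU n) ?_)
        exact (LieHom.map_lie (UniversalEnvelopingAlgebra.ι ℂ : _ →ₗ⁅ℂ⁆ Ugl m)
          (Matrix.single d c (1 : ℂ)) M).symm
      · rw [pow_two, Matrix.single_mul_single_of_ne _ _ _ _ hcd]
    exact (h ▸ Algebra.mem_top : u ∈ (adFNil n c d).comap (inU n))
  · exact mem_adFNil_of_intertwine (inG : GD m n →ₐ[ℂ] AA m n).toLinearMap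
      (LinearMap.mulLeft ℂ (gam n d c) - LinearMap.mulRight ℂ (gam n d c))
      (fun M => eA_inG d c M) (isNilpotent_mulLeft_sub_mulRight (isNilpotent_gam hcd.symm)) Z

lemma exists_adFLin_pow_eq_zero {c d : Fin m} (hcd : c ≠ d) (Y : AA m n) :
    ∃ N : ℕ, ∀ s ≥ N, (adFLin n c d ^ s) Y = 0 := by
  obtain ⟨N, hN⟩ := mem_adFNil hcd Y
  refine ⟨N, fun s hs => ?_⟩
  obtain ⟨k, rfl⟩ := Nat.exists_eq_add_of_le' hs
  rw [pow_add, Module.End.mul_apply, hN, map_zero]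

end LocallyNilpotent

/-! ### The terms of the series `ξ_c` modulo `J̄` -/

section Terms

variable {m n : ℕ}

lemma pow_mul_cartan {B : Type*} [Ring B] [Algebra ℂ B] {e x : B} {z : ℂ}
    (h : e * x = x * e - z • e) (s : ℕ) : e ^ s * x = x * e ^ s - ((s : ℂ) * z) • e ^ s := by
  induction s with
  | zero => simp
  | succ s ih =>
    rw [pow_succ', mul_assoc, ih, mul_sub, ← mul_assoc, h, sub_mul, mul_smul_comm,
      smul_mul_assoc, mul_assoc]
    push_cast
    module

lemma pow_succ_mul_sl2 {B : Type*} [Ring B] [Algebra ℂ B] {e f h : B}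
    (hef : e * f = f * e + h) (heh : e * h = h * e - (2 : ℂ) • e) (s : ℕ) :
    e ^ (s + 1) * f = f * e ^ (s + 1) +
      ((s : ℂ) + 1) • ((h - algebraMap ℂ B (s : ℂ)) * e ^ s) := by
  induction s with
  | zero => simp [hef]
  | succ s ih =>
    have h1 : e * ((h - algebraMap ℂ B (s : ℂ)) * e ^ s) =
        h * e ^ (s + 1) - ((s : ℂ) + 2) • e ^ (s + 1) := by
      rw [← mul_assoc, mul_sub, heh, ← Algebra.commutes, sub_mul, sub_mul, mul_assoc, ← pow_succ',
        smul_mul_assoc, ← pow_succ', mul_assoc, ← pow_succ', ← Algebra.smul_def]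
      module
    rw [pow_succ' e (s + 1), mul_assoc, ih, mul_add, mul_smul_comm, h1, ← mul_assoc, hef, add_mul,
      sub_mul, ← Algebra.smul_def, mul_assoc f e]
    push_cast
    module

lemma ne_of_succ {c d : Fin m} (hcd : (d : ℕ) = c + 1) : c ≠ d := by
  rintro rfl
  omega

lemma adFLin_cartan (c d a : Fin m) :
    adFLin n c d (eA n a a) = (eps c d a : ℂ) • eA n d c := by
  rw [adFLin_apply, eA_eA, eps]
  push_cast
  rw [sub_smul]
  congr 1
  · split_ifs with h1 h2 h2 <;> simp_all
  · split_ifs with h1 h2 h2 <;> simp_all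

lemma E_mul_cartan (c d a : Fin m) :
    eA n c d * eA n a a = eA n a a * eA n c d - (eps c d a : ℂ) • eA n c d := by
  rw [sub_eq_add_neg, ← sub_eq_iff_eq_add', eA_eA, eps]
  push_cast
  rw [sub_smul, neg_sub]
  congr 1
  · split_ifs with h1 h2 h2 <;> simp_all
  · split_ifs with h1 h2 h2 <;> simp_all

lemma E_mul_H {c d : Fin m} (hcd : c ≠ d) :
    eA n c d * (eA n c c - eA n d d) =
      (eA n c c - eA n d d) * eA n c d - (2 : ℂ) • eA n c d := by
  rw [mul_sub, E_mul_cartan, E_mul_cartan, eps, eps, if_pos rfl, if_pos rfl, if_neg hcd,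
    if_neg hcd.symm, sub_mul]
  push_cast
  module

lemma eA_pow_mul_F {c d : Fin m} (hcd : c ≠ d) (s : ℕ) :
    eA n c d ^ (s + 1) * eA n d c = eA n d c * eA n c d ^ (s + 1) + ((s : ℂ) + 1) •
      ((eA n c c - eA n d d - algebraMap ℂ (AA m n) (s : ℂ)) * eA n c d ^ s) := by
  refine pow_succ_mul_sl2 ?_ (E_mul_H hcd) s
  rw [← sub_eq_iff_eq_add', eA_eA]
  simp

/-- `H_c^{(s)}` as a denominator in `U(h)`. -/
def HfallPoly (c d : Fin m) (hcd : (d : ℕ) = c + 1) (s : ℕ) : denPoly m :=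
  ⟨∏ i ∈ Finset.range s,
      (MvPolynomial.X c - MvPolynomial.X d + MvPolynomial.C ((-(i : ℤ) : ℤ) : ℂ)),
    Submonoid.prod_mem _ fun i _ => Submonoid.subset_closure
      ⟨c, d, -(i : ℤ), ne_of_succ hcd, rfl⟩⟩

lemma hPoly_HfallPoly {c d : Fin m} (hcd : (d : ℕ) = c + 1) (s : ℕ) :
    hPoly m n (HfallPoly c d hcd s) = Hfall n c d s := by
  induction s with
  | zero => simp [HfallPoly, Hfall]
  | succ s ih =>
    have h : (HfallPoly c d hcd (s + 1) : MvPolynomial (Fin m) ℂ) =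
        (HfallPoly c d hcd s : MvPolynomial (Fin m) ℂ) *
        (MvPolynomial.X c - MvPolynomial.X d + MvPolynomial.C ((-(s : ℤ) : ℤ) : ℂ)) :=
      Finset.prod_range_succ (fun i : ℕ => (MvPolynomial.X c - MvPolynomial.X d +
        MvPolynomial.C ((-(i : ℤ) : ℤ) : ℂ) : MvPolynomial (Fin m) ℂ)) s
    rw [h, map_mul, ih, Hfall, map_add, map_sub, hPoly_X, hPoly_X, ← MvPolynomial.algebraMap_eq,
      AlgHom.commutes]
    push_cast
    simp only [sub_eq_add_neg]

/-- The map `w ↦ (s! H_c^{(s)})⁻¹ w + J̄` from `A` to `J̄ \ Ā`. -/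
def theta (n : ℕ) (c d : Fin m) (hcd : (d : ℕ) = c + 1) (s : ℕ) :
    AA m n →ₗ[ℂ] Abar m n ⧸ Jbar m n :=
  ((s.factorial : ℂ)⁻¹) • ((Jbar m n).mkQ ∘ₗ
    LinearMap.mulLeft ℂ (frac n 1 (HfallPoly c d hcd s)) ∘ₗ (toBarHom m n).toLinearMap)

lemma theta_apply {c d : Fin m} (hcd : (d : ℕ) = c + 1) (s : ℕ) (w : AA m n) :
    theta n c d hcd s w = ((s.factorial : ℂ)⁻¹) •
      (Jbar m n).mkQ (frac n 1 (HfallPoly c d hcd s) * toBar w) := rfl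

lemma theta_of_mem {c d : Fin m} (hcd : (d : ℕ) = c + 1) (s : ℕ) {w : AA m n} (hw : w ∈ J m n) :
    theta n c d hcd s w = 0 := by
  have h : (Jbar m n).mkQ (frac n 1 (HfallPoly c d hcd s) * toBar w) = 0 :=
    (Submodule.Quotient.mk_eq_zero _).2 (frac_mul_toBar_mem _ _ _ hw)
  rw [theta_apply, h, smul_zero]

lemma eA_mul_mem_J {a b : Fin m} (hab : b < a) (Z : AA m n) : eA n a b * Z ∈ J m n :=
  Submodule.subset_span ⟨a, b, Z, hab, rfl⟩

lemma lt_of_succ {c d : Fin m} (hcd : (d : ℕ) = c + 1) : c < d := by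
  rw [Fin.lt_def]
  omega

lemma toBar_hPoly_mem_leftStab (K : Submodule ℂ (AA m n)) (p : MvPolynomial (Fin m) ℂ) :
    toBar (hPoly m n p) ∈ leftStab (barSpan K) :=
  frac_one_right (n := n) p ▸ frac_mem_leftStab K p 1

/-- The action of `U(h)` on `J̄ \ Ā` by left multiplication. -/
def cartanMul (n : ℕ) (p : MvPolynomial (Fin m) ℂ) :
    (Abar m n ⧸ Jbar m n) →ₗ[ℂ] Abar m n ⧸ Jbar m n :=
  quotMul (Jbar m n) ⟨toBar (hPoly m n p), toBar_hPoly_mem_leftStab _ p⟩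

lemma cartanMul_mkQ (p : MvPolynomial (Fin m) ℂ) (y : Abar m n) :
    cartanMul n p ((Jbar m n).mkQ y) = (Jbar m n).mkQ (toBar (hPoly m n p) * y) := rfl

lemma theta_hPoly_mul {c d : Fin m} (hcd : (d : ℕ) = c + 1) (s : ℕ)
    (p : MvPolynomial (Fin m) ℂ) (w : AA m n) :
    theta n c d hcd s (hPoly m n p * w) = cartanMul n p (theta n c d hcd s w) := by
  rw [theta_apply, theta_apply, map_smul, cartanMul_mkQ, toBar_mul, ← mul_assoc, ← mul_assoc,
    toBar_hPoly_mul_frac_comm]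

lemma theta_succ {c d : Fin m} (hcd : (d : ℕ) = c + 1) (s : ℕ) (w : AA m n) :
    theta n c d hcd (s + 1) (((s : ℂ) + 1) •
      ((eA n c c - eA n d d - algebraMap ℂ (AA m n) (s : ℂ)) * w)) = theta n c d hcd s w := by
  have h1 : frac n 1 (HfallPoly c d hcd (s + 1)) *
      toBar (eA n c c - eA n d d - algebraMap ℂ (AA m n) (s : ℂ)) =
        frac n 1 (HfallPoly c d hcd s) := by
    calc _ = frac n 1 (HfallPoly c d hcd (s + 1)) * toBar (hPoly m n (HfallPoly c d hcd s) *
          (eA n c c - eA n d d - algebraMap ℂ (AA m n) (s : ℂ))) *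
            frac n 1 (HfallPoly c d hcd s) := ?_
      _ = _ := ?_
    · have h2 : eA n c c - eA n d d - algebraMap ℂ (AA m n) (s : ℂ) =
          hPoly m n (MvPolynomial.X c - MvPolynomial.X d - MvPolynomial.C (s : ℂ)) := by
        rw [map_sub, map_sub, hPoly_X, hPoly_X, ← MvPolynomial.algebraMap_eq, AlgHom.commutes]
      rw [h2, hPoly_mul_comm, toBar_mul]
      simp only [mul_assoc]
      rw [toBar_hPoly_mul_frac, mul_one]
    · rw [hPoly_HfallPoly, ← Hfall.eq_2, ← hPoly_HfallPoly hcd, frac_mul_toBar_hPoly, one_mul]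
  rw [map_smul, theta_apply, theta_apply, toBar_mul, ← mul_assoc, h1, smul_smul,
    Nat.factorial_succ]
  congr 1
  have : (s : ℂ) + 1 ≠ 0 := Nat.cast_add_one_ne_zero s
  push_cast
  field_simp

/-- Moving `F_c` to the left through `E_c^{s+1}`, where it is killed modulo `J̄`, lowers `s`. -/
lemma theta_pow_mul_F {c d : Fin m} (hcd : (d : ℕ) = c + 1) (s : ℕ) (w : AA m n) :
    theta n c d hcd (s + 1) (eA n c d ^ (s + 1) * (eA n d c * w)) =
      theta n c d hcd s (eA n c d ^ s * w) := by
  rw [← mul_assoc, eA_pow_mul_F (ne_of_succ hcd), add_mul, map_add, mul_assoc,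
    theta_of_mem hcd _ (eA_mul_mem_J (lt_of_succ hcd) _), zero_add, smul_mul_assoc, mul_assoc,
    theta_succ]

lemma mkQ_xi {c d : Fin m} (hcd : (d : ℕ) = c + 1) (Y : AA m n) {N : ℕ}
    (hN : ∀ s ≥ N, (adFLin n c d ^ s) Y = 0) :
    (Jbar m n).mkQ (xi c d hcd Y) = ∑ s ∈ Finset.range N,
      theta n c d hcd s (eA n c d ^ s * (adFLin n c d ^ s) Y) := by
  have h : ∀ s, ((s.factorial : ℂ)⁻¹) •
      (OreLocalization.oreDiv (eA n c d ^ s * (adF c d)^[s] Y)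
        (⟨Hfall n c d s, Hfall_den hcd s⟩ : den m n) : Abar m n) =
      ((s.factorial : ℂ)⁻¹) • (frac n 1 (HfallPoly c d hcd s) *
        toBar (eA n c d ^ s * (adFLin n c d ^ s) Y)) := fun s => by
    rw [oreDiv_eq_frac_mul _ _ _ (hPoly_HfallPoly hcd s), iterate_adF]
  rw [xi, finsum_congr h, finsum_eq_sum_of_support_subset (s := Finset.range N), map_sum]
  · exact Finset.sum_congr rfl fun s _ => map_smul _ _ _
  · intro s hs
    rw [Finset.coe_range, Set.mem_Iio]
    by_contra hsN
    refine hs ?_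
    have h0 : toBar (0 : AA m n) = 0 := map_zero (toBarHom m n)
    simp only [hN s (not_lt.1 hsN), mul_zero, h0, smul_zero]

/-- The map `Y ↦ ξ_c(Y) + J̄` from `A` to `J̄ \ Ā`. -/
def xiQ (n : ℕ) (c d : Fin m) (hcd : (d : ℕ) = c + 1) : AA m n →ₗ[ℂ] Abar m n ⧸ Jbar m n where
  toFun Y := (Jbar m n).mkQ (xi c d hcd Y)
  map_add' X Y := by
    obtain ⟨M, hM⟩ := exists_adFLin_pow_eq_zero (ne_of_succ hcd) X
    obtain ⟨N, hN⟩ := exists_adFLin_pow_eq_zero (ne_of_succ hcd) Y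
    rw [mkQ_xi hcd X (N := max M N) fun s hs => hM s (le_of_max_le_left hs),
      mkQ_xi hcd Y (N := max M N) fun s hs => hN s (le_of_max_le_right hs),
      mkQ_xi hcd (X + Y) (N := max M N) fun s hs => by
        rw [map_add, hM s (le_of_max_le_left hs), hN s (le_of_max_le_right hs), add_zero],
      ← Finset.sum_add_distrib]
    exact Finset.sum_congr rfl fun s _ => by rw [map_add, mul_add, map_add]
  map_smul' z Y := by
    obtain ⟨N, hN⟩ := exists_adFLin_pow_eq_zero (ne_of_succ hcd) Y
    rw [mkQ_xi hcd Y hN, mkQ_xi hcd (z • Y) (N := N) fun s hs => by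
        rw [map_smul, hN s hs, smul_zero],
      RingHom.id_apply, Finset.smul_sum]
    exact Finset.sum_congr rfl fun s _ => by rw [map_smul, mul_smul_comm, map_smul]

/-- The series for `ξ_c` may be truncated at a common order for finitely many elements. -/
lemma exists_xiQ_eq {c d : Fin m} (hcd : (d : ℕ) = c + 1) (Y Z : AA m n) :
    ∃ N : ℕ, (∀ s ≥ N, (adFLin n c d ^ s) Y = 0) ∧ ∀ K ≥ N,
      xiQ n c d hcd Y = ∑ s ∈ Finset.range K,
        theta n c d hcd s (eA n c d ^ s * (adFLin n c d ^ s) Y) ∧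
      xiQ n c d hcd Z = ∑ s ∈ Finset.range K,
        theta n c d hcd s (eA n c d ^ s * (adFLin n c d ^ s) Z) := by
  obtain ⟨M, hM⟩ := exists_adFLin_pow_eq_zero (ne_of_succ hcd) Y
  obtain ⟨N, hN⟩ := exists_adFLin_pow_eq_zero (ne_of_succ hcd) Z
  exact ⟨max M N, fun s hs => hM s (le_of_max_le_left hs), fun K hK =>
    ⟨mkQ_xi hcd Y fun s hs => hM s (le_trans (le_of_max_le_left hK) hs),
      mkQ_xi hcd Z fun s hs => hN s (le_trans (le_of_max_le_right hK) hs)⟩⟩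

end Terms

/-! ### Properties of `ξ_c` modulo `J̄` -/

section XiIdentities

variable {m n : ℕ} {c d : Fin m}

lemma adFLin_F : adFLin n c d (eA n d c) = 0 := by rw [adFLin_apply, sub_self]

lemma adFLin_pow_succ (s : ℕ) (Y : AA m n) :
    (adFLin n c d ^ (s + 1)) Y = adFLin n c d ((adFLin n c d ^ s) Y) := by
  rw [pow_succ', Module.End.mul_apply]

lemma adFLin_pow_cartan_mul (a : Fin m) (s : ℕ) (Y : AA m n) :
    (adFLin n c d ^ (s + 1)) (eA n a a * Y) = eA n a a * (adFLin n c d ^ (s + 1)) Y +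
      (((s : ℂ) + 1) * eps c d a) • (eA n d c * (adFLin n c d ^ s) Y) := by
  induction s with
  | zero => simp [adFLin_mul, adFLin_cartan, add_comm]
  | succ s ih =>
    rw [adFLin_pow_succ, ih, map_add, map_smul, adFLin_mul, adFLin_mul, adFLin_F,
      adFLin_cartan, zero_mul, zero_add, ← adFLin_pow_succ, ← adFLin_pow_succ, smul_mul_assoc]
    push_cast
    module

lemma adFLin_pow_mul_cartan (a : Fin m) (s : ℕ) (Y : AA m n) :
    (adFLin n c d ^ (s + 1)) (Y * eA n a a) = (adFLin n c d ^ (s + 1)) Y * eA n a a +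
      (((s : ℂ) + 1) * eps c d a) • ((adFLin n c d ^ s) Y * eA n d c) := by
  induction s with
  | zero => simp [adFLin_mul, adFLin_cartan, add_comm]
  | succ s ih =>
    rw [adFLin_pow_succ, ih, map_add, map_smul, adFLin_mul, adFLin_mul, adFLin_F,
      adFLin_cartan, mul_zero, add_zero, ← adFLin_pow_succ, ← adFLin_pow_succ, mul_smul_comm]
    push_cast
    module

lemma adFLin_pow_mul_F (s : ℕ) (Y : AA m n) :
    (adFLin n c d ^ s) (Y * eA n d c) = (adFLin n c d ^ s) Y * eA n d c := by
  induction s with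
  | zero => simp
  | succ s ih => rw [adFLin_pow_succ, ih, adFLin_mul, adFLin_F, mul_zero, add_zero,
      ← adFLin_pow_succ]

/-- The term of order `s` of the series for `ξ_c(Y)`, modulo `J̄`. -/
def xiTerm (n : ℕ) (c d : Fin m) (hcd : (d : ℕ) = c + 1) (s : ℕ) (Y : AA m n) :
    Abar m n ⧸ Jbar m n :=
  theta n c d hcd s (eA n c d ^ s * (adFLin n c d ^ s) Y)

lemma theta_F_mul_zero (hcd : (d : ℕ) = c + 1) (Y : AA m n) :
    theta n c d hcd 0 (eA n c d ^ 0 * (eA n d c * Y)) = 0 := by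
  rw [pow_zero, one_mul]
  exact theta_of_mem hcd 0 (eA_mul_mem_J (lt_of_succ hcd) _)

lemma cartanMul_one (y : Abar m n ⧸ Jbar m n) : cartanMul n 1 y = y := by
  obtain ⟨y, rfl⟩ := (Jbar m n).mkQ_surjective y
  rw [cartanMul_mkQ, map_one, toBar_one, one_mul]

lemma cartanMul_add (p q : MvPolynomial (Fin m) ℂ) (y : Abar m n ⧸ Jbar m n) :
    cartanMul n (p + q) y = cartanMul n p y + cartanMul n q y := by
  obtain ⟨y, rfl⟩ := (Jbar m n).mkQ_surjective y
  rw [cartanMul_mkQ, cartanMul_mkQ, cartanMul_mkQ, map_add, toBar_add, add_mul, map_add]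

lemma cartanMul_mul (p q : MvPolynomial (Fin m) ℂ) (y : Abar m n ⧸ Jbar m n) :
    cartanMul n (p * q) y = cartanMul n p (cartanMul n q y) := by
  obtain ⟨y, rfl⟩ := (Jbar m n).mkQ_surjective y
  rw [cartanMul_mkQ, cartanMul_mkQ, cartanMul_mkQ, map_mul (hPoly m n), toBar_mul, mul_assoc]

lemma hPoly_C (z : ℂ) : hPoly m n (MvPolynomial.C z) = algebraMap ℂ (AA m n) z := by
  rw [← MvPolynomial.algebraMap_eq, AlgHom.commutes]

lemma cartanMul_C (z : ℂ) (y : Abar m n ⧸ Jbar m n) :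
    cartanMul n (MvPolynomial.C z) y = z • y := by
  obtain ⟨y, rfl⟩ := (Jbar m n).mkQ_surjective y
  rw [cartanMul_mkQ, hPoly_C, Algebra.algebraMap_eq_smul_one, toBar_smul, toBar_one, smul_mul_assoc,
    one_mul, map_smul]

lemma pow_E_mul_cartan (a : Fin m) (s : ℕ) (w : AA m n) :
    eA n c d ^ s * (eA n a a * w) =
      eA n a a * (eA n c d ^ s * w) - ((s : ℂ) * eps c d a) • (eA n c d ^ s * w) := by
  rw [← mul_assoc, pow_mul_cartan (E_mul_cartan c d a), sub_mul, mul_assoc, smul_mul_assoc]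

/-- `ξ_c(X Y) = (X + ε_c(X)) ξ_c(Y)` modulo `J̄`, for `X = E_{aa}`. -/
lemma xiQ_cartan_mul (hcd : (d : ℕ) = c + 1) (a : Fin m) (Y : AA m n) :
    xiQ n c d hcd (eA n a a * Y) =
      cartanMul n (MvPolynomial.X a + MvPolynomial.C (eps c d a : ℂ)) (xiQ n c d hcd Y) := by
  obtain ⟨N, hN, h⟩ := exists_xiQ_eq hcd Y (eA n a a * Y)
  have hX : ∀ s w, theta n c d hcd s (eA n a a * w) =
      cartanMul n (MvPolynomial.X a) (theta n c d hcd s w) := fun s w => by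
    rw [← hPoly_X, theta_hPoly_mul]
  have partial_sum : ∀ K, ∑ s ∈ Finset.range (K + 1),
      theta n c d hcd s (eA n c d ^ s * (adFLin n c d ^ s) (eA n a a * Y)) =
      cartanMul n (MvPolynomial.X a + MvPolynomial.C (eps c d a : ℂ))
        (∑ s ∈ Finset.range (K + 1), xiTerm n c d hcd s Y) -
      (((K : ℂ) + 1) * eps c d a) • xiTerm n c d hcd K Y := by
    intro K
    rw [cartanMul_add, cartanMul_C]
    induction K with
    | zero =>
      rw [Finset.sum_range_one, Finset.sum_range_one, xiTerm]
      simp only [pow_zero, one_mul, Module.End.one_apply, hX]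
      push_cast
      module
    | succ K ih =>
      rw [Finset.sum_range_succ, ih, Finset.sum_range_succ _ (K + 1), adFLin_pow_cartan_mul,
        mul_add, map_add, pow_E_mul_cartan, map_sub, hX, mul_smul_comm, map_smul, map_smul,
        theta_pow_mul_F, map_add]
      change _ + (cartanMul n _ (xiTerm n c d hcd (K + 1) Y) -
        _ • xiTerm n c d hcd (K + 1) Y + _ • xiTerm n c d hcd K Y) = _
      push_cast
      module
  obtain ⟨h1, h2⟩ := h (N + 1) (Nat.le_succ N)
  rw [h2, partial_sum, h1, xiTerm, hN N le_rfl, mul_zero, map_zero, smul_zero, sub_zero]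
  rfl

/-- `ξ_c(X Y) = Z ξ_c(Y)` modulo `J̄` for any `X` in `U(h)`, where `Z` is the shift of `X`. -/
lemma xiQ_hPoly_mul (hcd : (d : ℕ) = c + 1) (p : MvPolynomial (Fin m) ℂ) (Y : AA m n) :
    xiQ n c d hcd (hPoly m n p * Y) = cartanMul n (shift c d p) (xiQ n c d hcd Y) := by
  induction p using MvPolynomial.induction_on generalizing Y with
  | C z =>
    rw [hPoly_C, shift, MvPolynomial.algHom_C, MvPolynomial.algebraMap_eq, cartanMul_C,
      ← Algebra.smul_def, map_smul]
  | add p q hp hq => rw [map_add, add_mul, map_add, map_add, cartanMul_add, hp, hq]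
  | mul_X p a hp =>
    rw [map_mul (hPoly m n), mul_assoc, hp, hPoly_X, xiQ_cartan_mul, map_mul (shift c d),
      cartanMul_mul]
    simp only [shift, MvPolynomial.aeval_X]

/-- `ξ_c(Y F_c) ∈ J̄`. -/
lemma xiQ_mul_F (hcd : (d : ℕ) = c + 1) (Y : AA m n) : xiQ n c d hcd (Y * eA n d c) = 0 := by
  obtain ⟨N, hN, h⟩ := exists_xiQ_eq hcd Y (Y * eA n d c)
  have partial_sum : ∀ K, ∑ s ∈ Finset.range (K + 1),
      theta n c d hcd s (eA n c d ^ s * (adFLin n c d ^ s) (Y * eA n d c)) =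
      -theta n c d hcd K (eA n c d ^ K * (adFLin n c d ^ (K + 1)) Y) := by
    have h1 : ∀ s, (adFLin n c d ^ s) (Y * eA n d c) =
        eA n d c * (adFLin n c d ^ s) Y - (adFLin n c d ^ (s + 1)) Y := fun s => by
      rw [adFLin_pow_mul_F, adFLin_pow_succ, adFLin_apply, sub_sub_cancel]
    intro K
    induction K with
    | zero =>
      rw [Finset.sum_range_one, h1, mul_sub, map_sub, theta_F_mul_zero, zero_sub]
    | succ K ih =>
      rw [Finset.sum_range_succ, ih, h1, mul_sub, map_sub, theta_pow_mul_F]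
      abel
  rw [(h (N + 1) (Nat.le_succ N)).2, partial_sum, hN (N + 1) (Nat.le_succ N), mul_zero, map_zero,
    neg_zero]

lemma adFLin_E : adFLin n c d (eA n c d) = -(eA n c c - eA n d d) := by
  rw [adFLin_apply, eA_eA, if_pos rfl, if_pos rfl, neg_sub]

lemma adFLin_H (hcd : c ≠ d) :
    adFLin n c d (eA n c c - eA n d d) = (2 : ℂ) • eA n d c := by
  rw [map_sub, adFLin_cartan, adFLin_cartan, eps, eps, if_pos rfl, if_pos rfl, if_neg hcd,
    if_neg hcd.symm]
  push_cast
  module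

lemma adFLin_pow_E_mul (hcd : c ≠ d) (s : ℕ) (Y : AA m n) :
    (adFLin n c d ^ (s + 2)) (eA n c d * Y) = eA n c d * (adFLin n c d ^ (s + 2)) Y
      - ((s : ℂ) + 2) • ((eA n c c - eA n d d) * (adFLin n c d ^ (s + 1)) Y)
      - (((s : ℂ) + 2) * (s + 1)) • (eA n d c * (adFLin n c d ^ s) Y) := by
  induction s with
  | zero =>
    simp only [pow_succ', pow_zero, mul_one, Module.End.mul_apply, adFLin_mul, adFLin_E,
      adFLin_H hcd, map_add, map_neg, Module.End.one_apply, neg_mul, smul_mul_assoc]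
    push_cast
    module
  | succ s ih =>
    rw [adFLin_pow_succ, ih, map_sub, map_sub, map_smul, map_smul, adFLin_mul, adFLin_mul,
      adFLin_mul, adFLin_F, adFLin_E, adFLin_H hcd, zero_mul, zero_add, ← adFLin_pow_succ,
      ← adFLin_pow_succ, ← adFLin_pow_succ, smul_mul_assoc, neg_mul]
    push_cast
    module

lemma smul_theta_pow_mul_H (hcd : (d : ℕ) = c + 1) (s : ℕ) (w : AA m n) :
    ((s : ℂ) + 1) • theta n c d hcd (s + 1)
        (eA n c d ^ (s + 1) * ((eA n c c - eA n d d) * w)) =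
      theta n c d hcd s (eA n c d ^ (s + 1) * w) -
        (((s : ℂ) + 1) * (s + 2)) • theta n c d hcd (s + 1) (eA n c d ^ (s + 1) * w) := by
  have h : eA n c d ^ (s + 1) * ((eA n c c - eA n d d) * w) =
      (eA n c c - eA n d d - algebraMap ℂ (AA m n) (s : ℂ)) * (eA n c d ^ (s + 1) * w) -
        ((s : ℂ) + 2) • (eA n c d ^ (s + 1) * w) := by
    rw [← mul_assoc, pow_mul_cartan (E_mul_H (ne_of_succ hcd)), sub_mul, sub_mul _ _ (_ * w),
      ← Algebra.smul_def, mul_assoc, smul_mul_assoc]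
    push_cast
    module
  rw [h, map_sub, smul_sub, map_smul, smul_smul, ← map_smul, theta_succ]

/-- `ξ_c(E_c Y) ∈ J̄`. -/
lemma xiQ_E_mul (hcd : (d : ℕ) = c + 1) (Y : AA m n) : xiQ n c d hcd (eA n c d * Y) = 0 := by
  obtain ⟨N, hN, h⟩ := exists_xiQ_eq hcd Y (eA n c d * Y)
  have hne := ne_of_succ hcd
  -- the series telescopes: with `a_s = θ_s(E^{s+1} y_s)` and `b_s = θ_s(E^s y_{s-1})`, its term of
  -- order `s` is `a_s - a_{s-1} + s(s+1) b_s - (s-1)s b_{s-1}`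
  have partial_sum : ∀ K : ℕ, ∑ s ∈ Finset.range (K + 2),
      theta n c d hcd s (eA n c d ^ s * (adFLin n c d ^ s) (eA n c d * Y)) =
      theta n c d hcd (K + 1) (eA n c d ^ (K + 2) * (adFLin n c d ^ (K + 1)) Y) +
        (((K : ℂ) + 1) * (K + 2)) •
          theta n c d hcd (K + 1) (eA n c d ^ (K + 1) * (adFLin n c d ^ K) Y) := by
    intro K
    induction K with
    | zero =>
      have h0 := smul_theta_pow_mul_H hcd 0 Y
      simp only [Nat.cast_zero, zero_add, one_smul] at h0
      rw [Finset.sum_range_succ, Finset.sum_range_one]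
      simp only [zero_add, pow_one, pow_zero, Module.End.one_apply, one_mul, adFLin_mul,
        adFLin_E, neg_mul, mul_add, mul_neg, map_add, map_neg] at h0 ⊢
      rw [h0, pow_two, mul_assoc]
      push_cast
      module
    | succ K ih =>
      have h0 := smul_theta_pow_mul_H hcd (K + 1) ((adFLin n c d ^ (K + 1)) Y)
      have e : ((K + 1 : ℕ) : ℂ) + 1 = (K : ℂ) + 2 := by push_cast; ring
      rw [e] at h0
      rw [Finset.sum_range_succ, ih, adFLin_pow_E_mul hne, mul_sub, mul_sub, map_sub, map_sub,
        mul_smul_comm, mul_smul_comm, map_smul, map_smul, h0, theta_pow_mul_F, ← mul_assoc,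
        ← pow_succ]
      push_cast
      module
  rw [(h (N + 2) (Nat.le_add_right N 2)).2, partial_sum, hN (N + 1) (Nat.le_succ N), hN N le_rfl,
    mul_zero, mul_zero, map_zero, smul_zero, add_zero]

/-- `ξ_c(Y (E_{aa} - κ)) = ξ_c(Y) (E_{aa} + ε_c(E_{aa}) - κ)` modulo `J̄`. -/
lemma xiQ_mul_cartan (hcd : (d : ℕ) = c + 1) (a : Fin m) (κ : ℂ) (Y : AA m n) :
    ∃ N : ℕ, xiQ n c d hcd (Y * (eA n a a - algebraMap ℂ (AA m n) κ)) = ∑ s ∈ Finset.range N,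
      theta n c d hcd s (eA n c d ^ s * (adFLin n c d ^ s) Y *
        (eA n a a - algebraMap ℂ (AA m n) (κ - eps c d a))) := by
  obtain ⟨N, hN, h⟩ := exists_xiQ_eq hcd Y (Y * eA n a a)
  have partial_sum : ∀ K, ∑ s ∈ Finset.range (K + 1),
      theta n c d hcd s (eA n c d ^ s * (adFLin n c d ^ s) (Y * eA n a a)) =
      ∑ s ∈ Finset.range (K + 1), (theta n c d hcd s (eA n c d ^ s *
        ((adFLin n c d ^ s) Y * eA n a a)) + (eps c d a : ℂ) • xiTerm n c d hcd s Y) -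
      (((K : ℂ) + 1) * eps c d a) • xiTerm n c d hcd K Y := by
    intro K
    induction K with
    | zero =>
      rw [Finset.sum_range_one, Finset.sum_range_one]
      simp only [pow_zero, one_mul, Module.End.one_apply]
      push_cast
      module
    | succ K ih =>
      have hF : (adFLin n c d ^ K) Y * eA n d c =
          eA n d c * (adFLin n c d ^ K) Y - (adFLin n c d ^ (K + 1)) Y := by
        rw [adFLin_pow_succ, adFLin_apply, sub_sub_cancel]
      rw [Finset.sum_range_succ, ih, Finset.sum_range_succ _ (K + 1), adFLin_pow_mul_cartan, hF,
        mul_add, map_add, mul_smul_comm, map_smul, mul_sub, map_sub, theta_pow_mul_F]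
      change _ + (_ + _ • (xiTerm n c d hcd K Y - xiTerm n c d hcd (K + 1) Y)) = _
      push_cast
      module
  obtain ⟨h1, h2⟩ := h (N + 1) (Nat.le_succ N)
  refine ⟨N + 1, ?_⟩
  rw [mul_sub, map_sub, h2, partial_sum, ← Algebra.commutes, ← Algebra.smul_def, map_smul, h1,
    Finset.smul_sum, xiTerm, hN N le_rfl, mul_zero, map_zero, smul_zero, sub_zero,
    ← Finset.sum_sub_distrib]
  refine Finset.sum_congr rfl fun s _ => ?_
  rw [mul_sub, map_sub, ← Algebra.commutes (κ - _), ← Algebra.smul_def, map_smul, mul_assoc, xiTerm]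
  module

end XiIdentities

/-! ### The map `ξ̄_c` -/

section XiBar

variable {m n : ℕ} {c d : Fin m}

/-- The action of the fractions of `U(h)` on `J̄ \ Ā` by left multiplication. -/
def fracMul (n : ℕ) (p : MvPolynomial (Fin m) ℂ) (q : denPoly m) :
    (Abar m n ⧸ Jbar m n) →ₗ[ℂ] Abar m n ⧸ Jbar m n :=
  quotMul (Jbar m n) ⟨frac n p q, frac_mem_leftStab _ p q⟩

lemma fracMul_mkQ (p : MvPolynomial (Fin m) ℂ) (q : denPoly m) (y : Abar m n) :
    fracMul n p q ((Jbar m n).mkQ y) = (Jbar m n).mkQ (frac n p q * y) := rfl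

lemma cartanMul_fracMul (p : MvPolynomial (Fin m) ℂ) (q : denPoly m) (y : Abar m n ⧸ Jbar m n) :
    cartanMul n q (fracMul n p q y) = cartanMul n p y := by
  obtain ⟨y, rfl⟩ := (Jbar m n).mkQ_surjective y
  rw [fracMul_mkQ, cartanMul_mkQ, cartanMul_mkQ, ← mul_assoc, frac_eq, ← mul_assoc,
    toBar_hPoly_mul_frac, one_mul]

lemma cartanMul_injective (q : denPoly m) :
    Function.Injective (cartanMul n (q : MvPolynomial (Fin m) ℂ)) := by
  refine Function.LeftInverse.injective (g := fracMul n 1 q) fun y => ?_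
  obtain ⟨y, rfl⟩ := (Jbar m n).mkQ_surjective y
  rw [cartanMul_mkQ, fracMul_mkQ, ← mul_assoc, frac_mul_toBar_hPoly, one_mul]

lemma cartanMul_comm (p q : MvPolynomial (Fin m) ℂ) (y : Abar m n ⧸ Jbar m n) :
    cartanMul n p (cartanMul n q y) = cartanMul n q (cartanMul n p y) := by
  rw [← cartanMul_mul, mul_comm, cartanMul_mul]

/-- The shift `q(μ) ↦ q(μ + ε_c)` of denominators. -/
def shiftDen (c d : Fin m) (q : denPoly m) : denPoly m := ⟨shift c d q, shift_den c d q.2⟩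

/-- The value of `ξ̄_c` at `q⁻¹ Y`, for some choice of the representation of an element of `Ā` as
a fraction `q⁻¹ Y`; it does not depend on that choice by `cartanMul_xiBarFun`. -/
def xiBarFun (hcd : (d : ℕ) = c + 1) (y : Abar m n) : Abar m n ⧸ Jbar m n :=
  fracMul n 1 (shiftDen c d (exists_frac_mul y).choose)
    (xiQ n c d hcd (exists_frac_mul y).choose_spec.choose)

lemma cartanMul_xiBarFun (hcd : (d : ℕ) = c + 1) {y : Abar m n} {q : denPoly m} {Y : AA m n}
    (h : toBar (hPoly m n q) * y = toBar Y) :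
    cartanMul n (shift c d q) (xiBarFun hcd y) = xiQ n c d hcd Y := by
  set r := (exists_frac_mul y).choose
  set Z := (exists_frac_mul y).choose_spec.choose
  have hy : y = frac n 1 r * toBar Z := (exists_frac_mul y).choose_spec.choose_spec
  have hZ : cartanMul n (shift c d r) (xiBarFun hcd y) = xiQ n c d hcd Z := by
    refine (cartanMul_fracMul 1 (shiftDen c d r) _).trans (cartanMul_one _)
  have e : toBar (hPoly m n q * Z) = toBar (hPoly m n r * Y) := by
    rw [toBar_mul (hPoly m n r), ← h, ← mul_assoc, ← toBar_mul, hPoly_mul_comm, toBar_mul,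
      toBar_mul, mul_assoc]
    congr 1
    rw [hy, ← mul_assoc, toBar_hPoly_mul_frac, one_mul]
  obtain ⟨t, ht⟩ := exists_of_toBar_eq e
  have ht' := congrArg (xiQ n c d hcd) ht
  rw [xiQ_hPoly_mul, xiQ_hPoly_mul, xiQ_hPoly_mul, xiQ_hPoly_mul] at ht'
  have ht'' := cartanMul_injective (shiftDen c d t) ht'
  rw [← hZ, cartanMul_comm] at ht''
  exact cartanMul_injective (shiftDen c d r) ht''

lemma exists_hPoly_mul_eq (y : Abar m n) :
    ∃ (q : denPoly m) (Y : AA m n), toBar (hPoly m n q) * y = toBar Y := by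
  obtain ⟨q, Y, rfl⟩ := exists_frac_mul y
  exact ⟨q, Y, by rw [← mul_assoc, toBar_hPoly_mul_frac, one_mul]⟩

/-- The linear map `ξ̄_c`. -/
def xiBar (n : ℕ) (hcd : (d : ℕ) = c + 1) : Abar m n →ₗ[ℂ] Abar m n ⧸ Jbar m n where
  toFun := xiBarFun hcd
  map_add' x y := by
    obtain ⟨p, X, hX⟩ := exists_hPoly_mul_eq x
    obtain ⟨q, Y, hY⟩ := exists_hPoly_mul_eq y
    refine cartanMul_injective (shiftDen c d (p * q)) ?_
    change cartanMul n (shift c d (p * q : MvPolynomial (Fin m) ℂ)) _ =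
      cartanMul n (shift c d (p * q : MvPolynomial (Fin m) ℂ)) _
    have h : toBar (hPoly m n ((p * q : denPoly m) : MvPolynomial (Fin m) ℂ)) * (x + y) =
        toBar (hPoly m n q * X + hPoly m n p * Y) := by
      rw [toBar_add, toBar_mul, toBar_mul, ← hX, ← hY, mul_add, Submonoid.coe_mul, map_mul]
      simp only [← mul_assoc, ← toBar_mul]
      rw [hPoly_mul_comm]
    rw [← Submonoid.coe_mul, cartanMul_xiBarFun hcd h, map_add, map_add, xiQ_hPoly_mul,
      xiQ_hPoly_mul, Submonoid.coe_mul, map_mul, cartanMul_mul, cartanMul_mul,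
      cartanMul_xiBarFun hcd hY, cartanMul_comm, cartanMul_xiBarFun hcd hX]
  map_smul' z y := by
    obtain ⟨q, Y, hY⟩ := exists_hPoly_mul_eq y
    refine cartanMul_injective (shiftDen c d q) ?_
    refine (cartanMul_xiBarFun hcd (Y := z • Y)
      (by rw [mul_smul_comm, hY, toBar_smul])).trans ?_
    rw [map_smul, RingHom.id_apply, map_smul, ← cartanMul_xiBarFun hcd hY]
    rfl

lemma isXiBar_xiBar (hcd : (d : ℕ) = c + 1) : IsXiBar c d hcd (xiBar n hcd) := by
  intro p q Y
  refine cartanMul_injective (shiftDen c d q) ?_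
  refine (cartanMul_xiBarFun hcd (Y := hPoly m n p * Y) ?_).trans ?_
  · rw [frac_eq, ← mul_assoc, ← mul_assoc, toBar_hPoly_mul_frac, one_mul, toBar_mul]
  · rw [xiQ_hPoly_mul]
    exact (cartanMul_fracMul _ (shiftDen c d q) _).symm

lemma IsXiBar.unique {hcd : (d : ℕ) = c + 1} {f g : Abar m n →ₗ[ℂ] Abar m n ⧸ Jbar m n}
    (hf : IsXiBar c d hcd f) (hg : IsXiBar c d hcd g) : f = g := by
  refine LinearMap.ext fun y => ?_
  obtain ⟨q, Y, rfl⟩ := exists_frac_mul y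
  rw [hf, hg]

end XiBar

/-! ### The image under `ξ_c` of the ideals of `A` -/

section Ideals

variable {m n : ℕ} {c d : Fin m}

/-- The right ideal of `A` generated by the `E_{ab}` with `a > b` other than `F_c`. -/
def lowerIdeal (n : ℕ) (c d : Fin m) : Submodule ℂ (AA m n) :=
  Submodule.span ℂ {Y | ∃ (a b : Fin m) (Z : AA m n), b < a ∧ ¬ (a = d ∧ b = c) ∧
    Y = eA n a b * Z}

lemma lowerIdeal_le_J : lowerIdeal n c d ≤ J m n :=
  Submodule.span_mono fun _ ⟨a, b, Z, hab, _, h⟩ => ⟨a, b, Z, hab, h⟩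

lemma eA_mul_mem_lowerIdeal {a b : Fin m} (hab : b < a) (h : ¬ (a = d ∧ b = c)) (Z : AA m n) :
    eA n a b * Z ∈ lowerIdeal n c d := Submodule.subset_span ⟨a, b, Z, hab, h, rfl⟩

lemma adFLin_mem_lowerIdeal (hcd : (d : ℕ) = c + 1) {Y : AA m n} (hY : Y ∈ lowerIdeal n c d) :
    adFLin n c d Y ∈ lowerIdeal n c d := by
  induction hY using Submodule.span_induction with
  | mem Y hY =>
    obtain ⟨a, b, Z, hab, h, rfl⟩ := hY
    rw [adFLin_mul, adFLin_apply, eA_eA, sub_mul]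
    refine Submodule.add_mem _ (Submodule.sub_mem _ ?_ ?_) (eA_mul_mem_lowerIdeal hab h _)
    · split_ifs with hc
      · exact eA_mul_mem_lowerIdeal (by omega) (by omega) _
      · rw [zero_mul]; exact Submodule.zero_mem _
    · split_ifs with hc
      · exact eA_mul_mem_lowerIdeal (by omega) (by omega) _
      · rw [zero_mul]; exact Submodule.zero_mem _
  | zero => rw [map_zero]; exact Submodule.zero_mem _
  | add x y _ _ hx hy => rw [map_add]; exact Submodule.add_mem _ hx hy
  | smul z x _ hx => rw [map_smul]; exact Submodule.smul_mem _ _ hx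

lemma E_mul_mem_lowerIdeal (hcd : (d : ℕ) = c + 1) {Y : AA m n} (hY : Y ∈ lowerIdeal n c d) :
    eA n c d * Y ∈ lowerIdeal n c d := by
  induction hY using Submodule.span_induction with
  | mem Y hY =>
    obtain ⟨a, b, Z, hab, h, rfl⟩ := hY
    have e := sub_eq_iff_eq_add.1 (eA_eA (n := n) c d a b)
    rw [← mul_assoc, e, add_mul, sub_mul, mul_assoc]
    refine Submodule.add_mem _ (Submodule.sub_mem _ ?_ ?_) (eA_mul_mem_lowerIdeal hab h _)
    · split_ifs with hc
      · exact eA_mul_mem_lowerIdeal (by omega) (by omega) _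
      · rw [zero_mul]; exact Submodule.zero_mem _
    · split_ifs with hc
      · exact eA_mul_mem_lowerIdeal (by omega) (by omega) _
      · rw [zero_mul]; exact Submodule.zero_mem _
  | zero => rw [mul_zero]; exact Submodule.zero_mem _
  | add x y _ _ hx hy => rw [mul_add]; exact Submodule.add_mem _ hx hy
  | smul z x _ hx => rw [mul_smul_comm]; exact Submodule.smul_mem _ _ hx

lemma pow_mem_of_forall_mem {R M : Type*} [Semiring R] [AddCommMonoid M] [Module R M]
    (f : Module.End R M) (P : M → Prop) (h : ∀ x, P x → P (f x)) (s : ℕ) {x : M} (hx : P x) :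
    P ((f ^ s) x) := by
  induction s with
  | zero => simpa using hx
  | succ s ih => rw [pow_succ', Module.End.mul_apply]; exact h _ ih

lemma xiQ_of_mem_lowerIdeal (hcd : (d : ℕ) = c + 1) {Y : AA m n} (hY : Y ∈ lowerIdeal n c d) :
    xiQ n c d hcd Y = 0 := by
  obtain ⟨N, -, h⟩ := exists_xiQ_eq hcd Y Y
  rw [(h N le_rfl).1]
  refine Finset.sum_eq_zero fun s _ => theta_of_mem hcd s (lowerIdeal_le_J (c := c) (d := d) ?_)
  have h1 := pow_mem_of_forall_mem (adFLin n c d) (· ∈ lowerIdeal n c d)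
    (fun _ => adFLin_mem_lowerIdeal hcd) s hY
  have h2 := pow_mem_of_forall_mem (LinearMap.mulLeft ℂ (eA n c d)) (· ∈ lowerIdeal n c d)
    (fun _ => E_mul_mem_lowerIdeal hcd) s h1
  rwa [LinearMap.pow_mulLeft] at h2

/-- The left ideal of `A` generated by the `E_{ab}` with `a < b` other than `E_c`, and by the
derivations. -/
def upperIdeal (n : ℕ) (c d : Fin m) : Submodule (AA m n) (AA m n) :=
  Submodule.span (AA m n) ({Y | ∃ a b : Fin m, a < b ∧ ¬ (a = c ∧ b = d) ∧ Y = eA n a b} ∪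
    {Y | ∃ (b : Fin m) (k : Fin n), Y = inG (dOp b k)})

lemma upperIdeal_le_Imu (ν : Fin m → ℂ) : upperIdeal n c d ≤ Imu n ν := by
  refine Submodule.span_mono ?_
  rintro _ (⟨a, b, hab, -, rfl⟩ | ⟨b, k, rfl⟩)
  · exact Or.inl (Or.inl ⟨a, b, hab, rfl⟩)
  · exact Or.inr ⟨b, k, rfl⟩

lemma eA_mem_upperIdeal {a b : Fin m} (hab : a < b) (h : ¬ (a = c ∧ b = d)) :
    eA n a b ∈ upperIdeal n c d := Submodule.subset_span (Or.inl ⟨a, b, hab, h, rfl⟩)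

lemma dOp_mem_upperIdeal (b : Fin m) (k : Fin n) : inG (dOp b k) ∈ upperIdeal n c d :=
  Submodule.subset_span (Or.inr ⟨b, k, rfl⟩)

lemma adFLin_mem_upperIdeal (hcd : (d : ℕ) = c + 1) {Y : AA m n} (hY : Y ∈ upperIdeal n c d) :
    adFLin n c d Y ∈ upperIdeal n c d := by
  induction hY using Submodule.span_induction with
  | mem Y hY =>
    rcases hY with ⟨a, b, hab, h, rfl⟩ | ⟨b, k, rfl⟩
    · rw [adFLin_apply, eA_eA]
      refine Submodule.sub_mem _ ?_ ?_
      · split_ifs with hc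
        · exact eA_mem_upperIdeal (by omega) (by omega)
        · exact Submodule.zero_mem _
      · split_ifs with hc
        · exact eA_mem_upperIdeal (by omega) (by omega)
        · exact Submodule.zero_mem _
    · rw [adFLin_apply, eA_inG, gam_dOp]
      split_ifs
      · rw [map_neg]; exact Submodule.neg_mem _ (dOp_mem_upperIdeal _ _)
      · rw [map_zero]; exact Submodule.zero_mem _
  | zero => rw [map_zero]; exact Submodule.zero_mem _
  | add x y _ _ hx hy => rw [map_add]; exact Submodule.add_mem _ hx hy
  | smul X y hy ih =>
    rw [smul_eq_mul, adFLin_mul]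
    exact Submodule.add_mem _ (Submodule.smul_mem _ _ hy) (Submodule.smul_mem _ _ ih)

lemma theta_mem_of_mem_Imu (hcd : (d : ℕ) = c + 1) (ν : Fin m → ℂ) (s : ℕ) {w : AA m n}
    (hw : w ∈ Imu n ν) : theta n c d hcd s w ∈ (Ibar n ν).map (Jbar m n).mkQ := by
  rw [theta_apply]
  exact Submodule.smul_mem _ _ (Submodule.mem_map_of_mem
    (frac_mul_toBar_mem ((Imu n ν).restrictScalars ℂ) _ _ hw))

lemma xiQ_of_mem_upperIdeal (hcd : (d : ℕ) = c + 1) (ν : Fin m → ℂ) {Y : AA m n}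
    (hY : Y ∈ upperIdeal n c d) : xiQ n c d hcd Y ∈ (Ibar n ν).map (Jbar m n).mkQ := by
  obtain ⟨N, -, h⟩ := exists_xiQ_eq hcd Y Y
  rw [(h N le_rfl).1]
  refine Submodule.sum_mem _ fun s _ => theta_mem_of_mem_Imu hcd ν s
    (upperIdeal_le_Imu (c := c) (d := d) ν ?_)
  exact Submodule.smul_mem _ _ (pow_mem_of_forall_mem (adFLin n c d) (· ∈ upperIdeal n c d)
    (fun _ => adFLin_mem_upperIdeal hcd) s hY)

lemma swap_lt_swap (hcd : (d : ℕ) = c + 1) {a b : Fin m} (hab : a < b) (h : ¬ (a = c ∧ b = d)) :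
    Equiv.swap c d a < Equiv.swap c d b ∧
      ¬ (Equiv.swap c d a = c ∧ Equiv.swap c d b = d) := by
  simp only [Equiv.swap_apply_def]
  split_ifs <;> omega

lemma xiQ_permA_of_mem_J (hcd : (d : ℕ) = c + 1) {Y : AA m n} (hY : Y ∈ J m n) :
    xiQ n c d hcd (permA n (Equiv.swap c d) Y) = 0 := by
  induction hY using Submodule.span_induction with
  | mem Y hY =>
    obtain ⟨a, b, Z, hab, rfl⟩ := hY
    rw [map_mul, permA_eA]
    by_cases h : b = c ∧ a = d
    · obtain ⟨rfl, rfl⟩ := h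
      rw [Equiv.swap_apply_left, Equiv.swap_apply_right, xiQ_E_mul]
    · obtain ⟨h1, h2⟩ := swap_lt_swap hcd hab h
      exact xiQ_of_mem_lowerIdeal hcd (eA_mul_mem_lowerIdeal h1 (fun h => h2 h.symm) _)
  | zero => simp
  | add x y _ _ hx hy => rw [map_add, map_add, hx, hy, add_zero]
  | smul z x _ hx => rw [map_smul, map_smul, hx, smul_zero]

lemma dot_swap_apply (hcd : (d : ℕ) = c + 1) (μ : Fin m → ℂ) (a : Fin m) :
    dot (Equiv.swap c d) μ (Equiv.swap c d a) = μ a - eps c d (Equiv.swap c d a) := by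
  have hne := ne_of_succ hcd
  rw [dot, Equiv.swap_inv, Equiv.swap_apply_self, eps]
  by_cases h1 : a = c
  · subst h1
    rw [Equiv.swap_apply_left, if_neg hne.symm, if_pos rfl, hcd]
    push_cast
    ring
  by_cases h2 : a = d
  · subst h2
    rw [Equiv.swap_apply_right, if_neg hne, if_pos rfl, hcd]
    push_cast
    ring
  rw [Equiv.swap_apply_of_ne_of_ne h1 h2, if_neg h1, if_neg h2]
  push_cast
  ring

/-- `ξ_c(σ_c(I_μ))` is contained in `J̄ + Ī_ν` for `ν = σ_c ∘ μ`. -/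
lemma xiQ_permA_of_mem_Imu (hcd : (d : ℕ) = c + 1) (μ : Fin m → ℂ) {Y : AA m n}
    (hY : Y ∈ Imu n μ) : xiQ n c d hcd (permA n (Equiv.swap c d) Y) ∈
      (Ibar n (dot (Equiv.swap c d) μ)).map (Jbar m n).mkQ := by
  induction hY using Submodule.closure_induction with
  | zero => simp
  | add x y _ _ hx hy => rw [map_add, map_add]; exact Submodule.add_mem _ hx hy
  | smul_mem X Y hY =>
    rw [smul_eq_mul, map_mul]
    rcases hY with (⟨a, b, hab, rfl⟩ | ⟨a, rfl⟩) | ⟨b, k, rfl⟩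
    · rw [permA_eA]
      by_cases h : a = c ∧ b = d
      · obtain ⟨rfl, rfl⟩ := h
        rw [Equiv.swap_apply_left, Equiv.swap_apply_right, xiQ_mul_F]
        exact Submodule.zero_mem _
      · obtain ⟨h1, h2⟩ := swap_lt_swap hcd hab h
        exact xiQ_of_mem_upperIdeal hcd _ (Submodule.smul_mem _ _ (eA_mem_upperIdeal h1 h2))
    · rw [map_sub, permA_eA, AlgHom.commutes]
      obtain ⟨N, hN⟩ := xiQ_mul_cartan hcd (Equiv.swap c d a) (μ a) (permA n (Equiv.swap c d) X)
      rw [hN]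
      refine Submodule.sum_mem _ fun s _ => theta_mem_of_mem_Imu hcd _ s
        (Submodule.smul_mem _ _ (Submodule.subset_span (Or.inl (Or.inr ⟨Equiv.swap c d a, ?_⟩))))
      rw [dot_swap_apply hcd]
    · rw [permA_inG, permGD_dOp]
      exact xiQ_of_mem_upperIdeal hcd _ (Submodule.smul_mem _ _ (dOp_mem_upperIdeal _ _))

end Ideals

/-! ### The Zhelobenko operator -/

section Zhelobenko

variable {m n : ℕ} {c d : Fin m}

lemma permBar_toBar (σ : Equiv.Perm (Fin m)) (Y : AA m n) :
    permBar n σ (toBar Y) = toBar (permA n σ Y) :=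
  OreLocalization.universalHom_commutes _ _ _

lemma permA_hPoly (σ : Equiv.Perm (Fin m)) (p : MvPolynomial (Fin m) ℂ) :
    permA n σ (hPoly m n p) = hPoly m n (MvPolynomial.rename σ p) := by
  have h : (permA n σ).comp (hPoly m n) = (hPoly m n).comp (MvPolynomial.rename σ) := by
    refine MvPolynomial.algHom_ext fun a => ?_
    simp only [AlgHom.comp_apply, MvPolynomial.rename_X, hPoly_X, permA_eA]
  exact DFunLike.congr_fun h p

/-- The action of permutations on the denominators. -/
def permDen (σ : Equiv.Perm (Fin m)) (q : denPoly m) : denPoly m :=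
  ⟨MvPolynomial.rename σ q.1, by
    obtain ⟨q, hq⟩ := q
    induction hq using Submonoid.closure_induction with
    | mem q hq =>
      obtain ⟨a, b, z, hab, rfl⟩ := hq
      refine Submonoid.subset_closure ⟨σ a, σ b, z, σ.injective.ne hab, ?_⟩
      simp only [map_add, map_sub, MvPolynomial.rename_X, MvPolynomial.rename_C]
    | one => rw [map_one]; exact Submonoid.one_mem _
    | mul x y _ _ hx hy => rw [map_mul]; exact Submonoid.mul_mem _ hx hy⟩

lemma permBar_frac (σ : Equiv.Perm (Fin m)) (p : MvPolynomial (Fin m) ℂ) (q : denPoly m) :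
    permBar n σ (frac n p q) = frac n (MvPolynomial.rename σ p) (permDen σ q) := by
  have h1 : permBar n σ (frac n 1 q) * toBar (hPoly m n (permDen σ q)) = 1 := by
    rw [permDen, ← permA_hPoly, ← permBar_toBar, ← map_mul, frac_mul_toBar_hPoly, map_one]
  have h2 : permBar n σ (frac n 1 q) = frac n 1 (permDen σ q) := by
    calc permBar n σ (frac n 1 q) = permBar n σ (frac n 1 q) *
          (toBar (hPoly m n (permDen σ q)) * frac n 1 (permDen σ q)) := by
            rw [toBar_hPoly_mul_frac, mul_one]
      _ = _ := by rw [← mul_assoc, h1, one_mul]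
  rw [frac_eq, map_mul, h2, permBar_toBar, permA_hPoly, ← frac_eq]

/-- The action of a permutation on `Ā` as a linear map. -/
def permBarLin (n : ℕ) (σ : Equiv.Perm (Fin m)) : Abar m n →ₗ[ℂ] Abar m n where
  toFun := permBar n σ
  map_add' := map_add _
  map_smul' z y := by
    have h : ∀ y : Abar m n, z • y = toBar (algebraMap ℂ (AA m n) z) * y := fun y =>
      Algebra.smul_def z y
    rw [h, map_mul, permBar_toBar, AlgHom.commutes, RingHom.id_apply, ← h]

lemma permBarLin_apply (σ : Equiv.Perm (Fin m)) (y : Abar m n) :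
    permBarLin n σ y = permBar n σ y := rfl

lemma IsXiBar.apply_permBar {hcd : (d : ℕ) = c + 1} {f : Abar m n →ₗ[ℂ] Abar m n ⧸ Jbar m n}
    (hf : IsXiBar c d hcd f) (σ : Equiv.Perm (Fin m)) (p : MvPolynomial (Fin m) ℂ)
    (q : denPoly m) (Y : AA m n) :
    f (permBar n σ (frac n p q * toBar Y)) =
      fracMul n (shift c d (MvPolynomial.rename σ p)) (shiftDen c d (permDen σ q))
        (xiQ n c d hcd (permA n σ Y)) := by
  rw [map_mul, permBar_frac, permBar_toBar, hf]
  rfl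

/-- `ξ̄_c(σ_c(J̄)) = 0`, so that the Zhelobenko operator is well defined. -/
lemma IsXiBar.Jbar_le_ker {hcd : (d : ℕ) = c + 1}
    {f : Abar m n →ₗ[ℂ] Abar m n ⧸ Jbar m n} (hf : IsXiBar c d hcd f) :
    Jbar m n ≤ LinearMap.ker (f ∘ₗ permBarLin n (Equiv.swap c d)) := by
  refine Submodule.span_le.2 ?_
  rintro _ ⟨p, q, Y, hY, rfl⟩
  refine (hf.apply_permBar (Equiv.swap c d) p q Y).trans ?_
  rw [xiQ_permA_of_mem_J hcd hY, map_zero]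

/-- `ξ̄_c(σ_c(Ī_μ)) ⊆ J̄ + Ī_ν` for `ν = σ_c ∘ μ`. -/
lemma IsXiBar.apply_permBar_Ibar {hcd : (d : ℕ) = c + 1}
    {f : Abar m n →ₗ[ℂ] Abar m n ⧸ Jbar m n} (hf : IsXiBar c d hcd f) (μ : Fin m → ℂ)
    {y : Abar m n} (hy : y ∈ Ibar n μ) : f (permBar n (Equiv.swap c d) y) ∈
      (Ibar n (dot (Equiv.swap c d) μ)).map (Jbar m n).mkQ := by
  have h : Ibar n μ ≤ ((Ibar n (dot (Equiv.swap c d) μ)).map (Jbar m n).mkQ).comap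
      (f ∘ₗ permBarLin n (Equiv.swap c d)) := by
    refine Submodule.span_le.2 ?_
    rintro _ ⟨p, q, Y, hY, rfl⟩
    rw [SetLike.mem_coe, Submodule.mem_comap, LinearMap.comp_apply, permBarLin_apply,
      hf.apply_permBar]
    obtain ⟨z, hz, e⟩ := xiQ_permA_of_mem_Imu hcd μ hY
    rw [← e, fracMul_mkQ]
    exact Submodule.mem_map_of_mem (frac_mem_leftStab _ _ _ z hz)
  exact h hy

/-- The Zhelobenko operator. -/
def zhelobenko (n : ℕ) (hcd : (d : ℕ) = c + 1) :
    (Abar m n ⧸ Jbar m n) →ₗ[ℂ] Abar m n ⧸ Jbar m n :=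
  (Jbar m n).liftQ (xiBar n hcd ∘ₗ permBarLin n (Equiv.swap c d))
    (isXiBar_xiBar hcd).Jbar_le_ker

lemma isZhelobenko_zhelobenko (hcd : (d : ℕ) = c + 1) :
    IsZhelobenko c d hcd (zhelobenko n hcd) :=
  ⟨xiBar n hcd, isXiBar_xiBar hcd, fun y => by
    rw [zhelobenko, Submodule.mkQ_apply, Submodule.liftQ_apply, LinearMap.comp_apply,
      permBarLin_apply]⟩

lemma IsZhelobenko.unique {hcd : (d : ℕ) = c + 1}
    {g g' : (Abar m n ⧸ Jbar m n) →ₗ[ℂ] Abar m n ⧸ Jbar m n}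
    (hg : IsZhelobenko c d hcd g) (hg' : IsZhelobenko c d hcd g') : g = g' := by
  obtain ⟨f, hf, h⟩ := hg
  obtain ⟨f', hf', h'⟩ := hg'
  refine LinearMap.ext fun y => ?_
  obtain ⟨y, rfl⟩ := (Jbar m n).mkQ_surjective y
  rw [h, h', hf.unique hf']

end Zhelobenko

/-! ### The Yangian generators -/

section Yangian

variable {m n : ℕ} {c d : Fin m}

lemma TA_hPoly (s : ℕ) (i j : Fin n) (p : MvPolynomial (Fin m) ℂ) :
    TA s i j * hPoly m n p = hPoly m n p * TA s i j := by
  induction p using MvPolynomial.induction_on with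
  | C z => rw [hPoly_C, Algebra.commutes]
  | add p q hp hq => rw [map_add, mul_add, add_mul, hp, hq]
  | mul_X p a hp => rw [map_mul, hPoly_X, ← mul_assoc, hp, mul_assoc, ← TA_eA, mul_assoc]

lemma permU_pathSum (σ : Equiv.Perm (Fin m)) (s : ℕ) (p q : Fin m) :
    permU σ (pathSum s p q) = pathSum s (σ p) (σ q) := by
  induction s generalizing q with
  | zero =>
    simp only [pathSum, σ.injective.eq_iff]
    split_ifs <;> simp
  | succ s ih =>
    rw [pathSum, pathSum, map_sum]
    refine (Finset.sum_congr rfl fun r _ => ?_).trans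
      (Equiv.sum_comp σ fun r => pathSum s (σ p) r * eU (σ q) r)
    rw [map_mul, ih, permU_eU]

lemma permA_TA (σ : Equiv.Perm (Fin m)) (s : ℕ) (i j : Fin n) :
    permA n σ (TA s i j) = TA s i j := by
  rw [TA_eq, map_sum]
  refine (Finset.sum_congr rfl fun p _ => ?_).trans
    (Equiv.sum_comp σ fun p => ∑ q, inU n (pathSum s p q) * inG (xOp p i * dOp q j))
  rw [map_sum]
  refine (Finset.sum_congr rfl fun q _ => ?_).trans
    (Equiv.sum_comp σ fun q => inU n (pathSum s (σ p) q) * inG (xOp (σ p) i * dOp q j))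
  rw [map_mul, permA_inU, permA_inG, permU_pathSum, map_mul, permGD_xOp, permGD_dOp]

lemma TA_mem_leftStab_Jbar (s : ℕ) (i j : Fin n) :
    toBar (TA s i j : AA m n) ∈ leftStab (Jbar m n) :=
  toBar_mem_leftStab _ _ (TA_hPoly s i j) fun Y hY => by
    induction hY using Submodule.span_induction with
    | mem y hy =>
      obtain ⟨a, b, W, hab, rfl⟩ := hy
      rw [← mul_assoc, ← TA_eA, mul_assoc]
      exact eA_mul_mem_J hab _
    | zero => rw [mul_zero]; exact Submodule.zero_mem _
    | add x y _ _ hx hy => rw [mul_add]; exact Submodule.add_mem _ hx hy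
    | smul c x _ hx => rw [mul_smul_comm]; exact Submodule.smul_mem _ _ hx

/-- The action of `T_{ij}^{(s+1)}` on `J̄ \ Ā` by left multiplication. -/
def TQ (m : ℕ) (s : ℕ) (i j : Fin n) : (Abar m n ⧸ Jbar m n) →ₗ[ℂ] Abar m n ⧸ Jbar m n :=
  quotMul (Jbar m n) ⟨toBar (TA s i j), TA_mem_leftStab_Jbar s i j⟩

lemma TQ_mkQ (s : ℕ) (i j : Fin n) (y : Abar m n) :
    TQ m s i j ((Jbar m n).mkQ y) = (Jbar m n).mkQ (toBar (TA s i j) * y) := rfl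

lemma TA_frac (s : ℕ) (i j : Fin n) (q : denPoly m) :
    toBar (TA s i j) * frac n 1 q = frac n 1 q * toBar (TA s i j) :=
  toBar_mul_frac_comm (TA s i j) q (TA_hPoly s i j _)

lemma xiQ_TA_mul (hcd : (d : ℕ) = c + 1) (s : ℕ) (i j : Fin n) (Y : AA m n) :
    xiQ n c d hcd (TA s i j * Y) = TQ m s i j (xiQ n c d hcd Y) := by
  obtain ⟨N, -, h⟩ := exists_xiQ_eq hcd Y (TA s i j * Y)
  have hD : ∀ k, (adFLin n c d ^ k) (TA s i j * Y) = TA s i j * (adFLin n c d ^ k) Y := by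
    intro k
    induction k with
    | zero => simp
    | succ k ih =>
      rw [adFLin_pow_succ, ih, adFLin_mul, adFLin_pow_succ, adFLin_apply, TA_eA, sub_self,
        zero_mul, zero_add]
  have hE : ∀ k, eA n c d ^ k * TA s i j = TA s i j * eA n c d ^ k := fun k =>
    Commute.pow_left (TA_eA s i j c d) k
  rw [(h N le_rfl).1, (h N le_rfl).2, map_sum]
  refine Finset.sum_congr rfl fun k _ => ?_
  rw [hD, ← mul_assoc, hE, mul_assoc, theta_apply, theta_apply, map_smul, TQ_mkQ, toBar_mul,
    ← mul_assoc, ← mul_assoc, TA_frac]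

lemma IsZhelobenko.comm_TQ {hcd : (d : ℕ) = c + 1}
    {g : (Abar m n ⧸ Jbar m n) →ₗ[ℂ] Abar m n ⧸ Jbar m n} (hg : IsZhelobenko c d hcd g)
    (s : ℕ) (i j : Fin n) (y : Abar m n ⧸ Jbar m n) :
    g (TQ m s i j y) = TQ m s i j (g y) := by
  obtain ⟨f, hf, h⟩ := hg
  obtain ⟨y, rfl⟩ := (Jbar m n).mkQ_surjective y
  obtain ⟨q, Y, rfl⟩ := exists_frac_mul y
  rw [TQ_mkQ, h, h, ← mul_assoc, TA_frac, mul_assoc, ← toBar_mul, hf.apply_permBar,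
    hf.apply_permBar, map_mul, permA_TA, xiQ_TA_mul, map_one, map_one]
  obtain ⟨z, hz⟩ := (Jbar m n).mkQ_surjective (xiQ n c d hcd (permA n (Equiv.swap c d) Y))
  rw [← hz, TQ_mkQ, fracMul_mkQ, fracMul_mkQ, TQ_mkQ, ← mul_assoc, ← mul_assoc, TA_frac]

end Yangian

/-! ### The annihilator of `1_μ ⊗ 1` -/

section Annihilator

variable {m n : ℕ}

lemma dOp_one (a : Fin m) (k : Fin n) : dOp a k (1 : Grass m n) = 0 :=
  CliffordAlgebra.contractLeft_one (Q := (0 : QuadraticForm ℂ (Fin m × Fin n → ℂ))) _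

lemma xOp_mul_self (a : Fin m) (k : Fin n) : (xOp a k * xOp a k : GD m n) = 0 := by
  refine LinearMap.ext fun w => ?_
  simp only [xOp, Module.End.mul_apply, LinearMap.mulLeft_apply, LinearMap.zero_apply]
  rw [← mul_assoc, ExteriorAlgebra.ι_sq_zero, zero_mul]

/-- The product of the operators `1 - x_i ∂_i = ∂_i x_i` over a list of indices; over all indices
it is the projection of the Grassmann algebra to the constants. -/
def constProj : List (Fin m × Fin n) → GD m n
  | [] => 1
  | i :: l => constProj l * (1 - xOp i.1 i.2 * dOp i.1 i.2)

lemma constProj_one (l : List (Fin m × Fin n)) : constProj l 1 = 1 := by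
  induction l with
  | nil => rfl
  | cons i l ih =>
    rw [constProj, Module.End.mul_apply, LinearMap.sub_apply, Module.End.mul_apply, dOp_one,
      map_zero, Module.End.one_apply, sub_zero, ih]

lemma constProj_mul_xOp {l : List (Fin m × Fin n)} {i : Fin m × Fin n} (hi : i ∈ l) :
    constProj l * xOp i.1 i.2 = 0 := by
  induction l with
  | nil => simp at hi
  | cons j l ih =>
    by_cases h : i = j
    · subst h
      have e : (1 - xOp i.1 i.2 * dOp i.1 i.2) * xOp i.1 i.2 = (0 : GD m n) := by
        rw [sub_mul, mul_assoc, dOp_mul_xOp, if_pos ⟨rfl, rfl⟩, mul_sub, ← mul_assoc, xOp_mul_self]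
        simp
      rw [constProj, mul_assoc, e, mul_zero]
    · have e : (1 - xOp j.1 j.2 * dOp j.1 j.2) * xOp i.1 i.2 =
          xOp i.1 i.2 * (1 - xOp j.1 j.2 * dOp j.1 j.2 : GD m n) := by
        rw [sub_mul, mul_assoc, dOp_mul_xOp, if_neg (fun h' => h (Prod.ext h'.1 h'.2)), zero_sub,
          mul_neg, ← mul_assoc, xOp_mul_xOp, mul_sub]
        noncomm_ring
      have hl : i ∈ l := by simpa [h] using hi
      rw [constProj, mul_assoc, e, ← mul_assoc, ih hl, zero_mul]

lemma ι_eq_sum (v : Fin m × Fin n → ℂ) : (ExteriorAlgebra.ι ℂ v : Grass m n) =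
    ∑ i, v i • ExteriorAlgebra.ι ℂ (Pi.single i (1 : ℂ)) := by
  conv_lhs => rw [pi_eq_sum_univ' v]
  rw [map_sum]
  refine Finset.sum_congr rfl fun i _ => ?_
  rw [map_smul]

lemma constProj_univ_mem (w : Grass m n) :
    ∃ r : ℂ, constProj (Finset.univ : Finset (Fin m × Fin n)).toList w = r • 1 := by
  induction w using CliffordAlgebra.left_induction with
  | algebraMap r =>
    refine ⟨r, ?_⟩
    rw [Algebra.algebraMap_eq_smul_one, map_smul]
    exact congrArg _ (constProj_one _)
  | add x y hx hy =>
    obtain ⟨r, hr⟩ := hx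
    obtain ⟨s, hs⟩ := hy
    exact ⟨r + s, by rw [map_add, hr, hs, add_smul]⟩
  | ι_mul w v _ =>
    refine ⟨0, ?_⟩
    have h : (CliffordAlgebra.ι (0 : QuadraticForm ℂ (Fin m × Fin n → ℂ)) v * w : Grass m n) =
        ∑ i : Fin m × Fin n, v i • xOp i.1 i.2 w := by
      refine (congrArg (· * w) (ι_eq_sum v)).trans ?_
      simp only [Finset.sum_mul, smul_mul_assoc]
      rfl
    rw [h, map_sum, zero_smul]
    refine Finset.sum_eq_zero fun i _ => ?_
    rw [map_smul, ← Module.End.mul_apply,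
      constProj_mul_xOp (Finset.mem_toList.2 (Finset.mem_univ i)),
      LinearMap.zero_apply, smul_zero]

/-- The left ideal of the ring of endomorphisms of the Grassmann algebra generated by the
derivations. -/
def dIdeal (m n : ℕ) : Submodule (GD m n) (GD m n) :=
  Submodule.span (GD m n) {Y | ∃ (b : Fin m) (k : Fin n), Y = dOp b k}

lemma one_sub_constProj_mem (l : List (Fin m × Fin n)) : 1 - constProj l ∈ dIdeal m n := by
  induction l with
  | nil => rw [constProj, sub_self]; exact Submodule.zero_mem _
  | cons i l ih =>
    have e : 1 - constProj (i :: l) =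
        (1 - constProj l) + (constProj l * xOp i.1 i.2) • dOp i.1 i.2 := by
      rw [constProj, smul_eq_mul]
      noncomm_ring
    rw [e]
    exact Submodule.add_mem _ ih (Submodule.smul_mem _ _ (Submodule.subset_span ⟨_, _, rfl⟩))

/-- Modulo the left ideal generated by the derivations, every endomorphism of the Grassmann algebra
is a left multiplication. -/
lemma sub_mulLeft_mem_dIdeal (Y : GD m n) : Y - LinearMap.mulLeft ℂ (Y 1) ∈ dIdeal m n := by
  set P : GD m n := constProj (Finset.univ : Finset (Fin m × Fin n)).toList
  set Z := Y - LinearMap.mulLeft ℂ (Y 1) with hZ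
  have h1 : Z 1 = 0 := by
    rw [hZ, LinearMap.sub_apply, LinearMap.mulLeft_apply, mul_one, sub_self]
  have h2 : Z * P = 0 := by
    refine LinearMap.ext fun w => ?_
    obtain ⟨r, hr⟩ := constProj_univ_mem w
    rw [Module.End.mul_apply, hr, map_smul, h1, smul_zero, LinearMap.zero_apply]
  have h3 : Z = Z * (1 - P) := by rw [mul_sub, h2, mul_one, sub_zero]
  rw [h3]
  exact Submodule.smul_mem _ _ (one_sub_constProj_mem _)

variable (ν : Fin m → ℂ)

lemma inG_mem_Imu {Y : GD m n} (hY : Y ∈ dIdeal m n) : inG Y ∈ Imu n ν := by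
  induction hY using Submodule.span_induction with
  | mem Y hY =>
    obtain ⟨b, k, rfl⟩ := hY
    exact Submodule.subset_span (Or.inr ⟨b, k, rfl⟩)
  | zero => rw [map_zero]; exact Submodule.zero_mem _
  | add x y _ _ hx hy => rw [map_add]; exact Submodule.add_mem _ hx hy
  | smul X y _ hy => rw [smul_eq_mul, map_mul]; exact Submodule.smul_mem _ _ hy

lemma gam_mem_dIdeal (a b : Fin m) : gam n a b ∈ dIdeal m n :=
  Submodule.sum_mem _ fun _ _ => Submodule.smul_mem _ _ (Submodule.subset_span ⟨_, _, rfl⟩)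

lemma inU_mem_Imu {u : Ugl m} (hu : u ∈ vermaIdeal ν) : inU n u ∈ Imu n ν := by
  induction hu using Submodule.span_induction with
  | mem u hu =>
    have e : ∀ a b : Fin m, inU n (eU a b) = eA n a b - inG (gam n a b) := fun a b => by
      rw [eA, add_sub_cancel_right]
    rcases hu with ⟨a, b, hab, rfl⟩ | ⟨a, rfl⟩
    · rw [e]
      exact Submodule.sub_mem _ (Submodule.subset_span (Or.inl (Or.inl ⟨a, b, hab, rfl⟩)))
        (inG_mem_Imu ν (gam_mem_dIdeal _ _))
    · rw [map_sub, e, AlgHom.commutes, sub_right_comm]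
      exact Submodule.sub_mem _ (Submodule.subset_span (Or.inl (Or.inr ⟨a, rfl⟩)))
        (inG_mem_Imu ν (gam_mem_dIdeal _ _))
  | zero => rw [map_zero]; exact Submodule.zero_mem _
  | add x y _ _ hx hy => rw [map_add]; exact Submodule.add_mem _ hx hy
  | smul X y _ hy => rw [smul_eq_mul, map_mul]; exact Submodule.smul_mem _ _ hy

/-- The bilinear map `(u, w) ↦ u ⊗ w` to `A / I_ν`. -/
def vgToQuotAux : Ugl m →ₗ[ℂ] Grass m n →ₗ[ℂ] AA m n ⧸ (Imu n ν).restrictScalars ℂ :=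
  LinearMap.mk₂ ℂ
    (fun u w => ((Imu n ν).restrictScalars ℂ).mkQ (inU n u * inG (LinearMap.mulLeft ℂ w)))
    (fun u u' w => by rw [map_add, add_mul, map_add])
    (fun z u w => by rw [map_smul, smul_mul_assoc, map_smul])
    (fun u w w' => by
      have : LinearMap.mulLeft ℂ (w + w') = LinearMap.mulLeft ℂ w + LinearMap.mulLeft ℂ w' :=
        LinearMap.ext fun _ => add_mul _ _ _
      rw [this, map_add, mul_add, map_add])
    (fun z u w => by
      have : LinearMap.mulLeft ℂ (z • w) = z • LinearMap.mulLeft ℂ w :=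
        LinearMap.ext fun _ => smul_mul_assoc _ _ _
      rw [this, map_smul, mul_smul_comm, map_smul])

/-- The linear map `u 1_ν ⊗ w ↦ u ⊗ w + I_ν` from `M_ν ⊗ G` to `A / I_ν`; it inverts the map
`Y + I_ν ↦ Y (1_ν ⊗ 1)`. -/
def vgToQuot : VG n ν →ₗ[ℂ] AA m n ⧸ (Imu n ν).restrictScalars ℂ :=
  TensorProduct.lift ((((vermaIdeal ν).restrictScalars ℂ).liftQ (vgToQuotAux ν) (by
    intro u hu
    rw [LinearMap.mem_ker]
    refine LinearMap.ext fun w => ?_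
    refine (Submodule.Quotient.mk_eq_zero _).2 ?_
    change inU n u * inG (LinearMap.mulLeft ℂ w) ∈ Imu n ν
    rw [← inG_mul_inU]
    exact Submodule.smul_mem _ _ (inU_mem_Imu ν hu))) ∘ₗ
      (Submodule.Quotient.restrictScalarsEquiv ℂ (vermaIdeal ν)).symm.toLinearMap)

lemma act_vac (u : Ugl m) (Z : GD m n) :
    act n ν (inU n u * inG Z) (vac n ν) = (vermaIdeal ν).mkQ u ⊗ₜ Z 1 := by
  rw [inU_mul_inG]
  change ((u • (vermaIdeal ν).mkQ 1) ⊗ₜ[ℂ] Z 1 : VG n ν) = _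
  rw [← map_smul, smul_eq_mul, mul_one]

lemma vgToQuot_act_vac (Y : AA m n) :
    vgToQuot ν (act n ν Y (vac n ν)) = ((Imu n ν).restrictScalars ℂ).mkQ Y := by
  refine AA_induction (P := fun Y => vgToQuot ν (act n ν Y (vac n ν)) =
    ((Imu n ν).restrictScalars ℂ).mkQ Y) ?_ (fun u Z => ?_) (fun X Y hX hY => ?_) Y
  · simp
  · rw [act_vac]
    change ((Imu n ν).restrictScalars ℂ).mkQ (inU n u * inG (LinearMap.mulLeft ℂ (Z 1))) = _
    refine Eq.symm ((Submodule.Quotient.eq _).2 ?_)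
    rw [← mul_sub, ← map_sub]
    exact Submodule.smul_mem (Imu n ν) _ (inG_mem_Imu ν (sub_mulLeft_mem_dIdeal Z))
  · rw [map_add, LinearMap.add_apply, map_add, hX, hY, map_add]

lemma act_gam_vac (a b : Fin m) : gam n a b (1 : Grass m n) = 0 := by
  rw [gam, LinearMap.sum_apply]
  exact Finset.sum_eq_zero fun k _ => by rw [Module.End.mul_apply, dOp_one, map_zero]

lemma act_eA_vac (a b : Fin m) :
    act n ν (eA n a b) (vac n ν) = (vermaIdeal ν).mkQ (eU a b) ⊗ₜ 1 := by
  have h1 := act_vac ν (eU a b) (1 : GD m n)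
  have h2 := act_vac ν 1 (gam n a b)
  rw [map_one, mul_one] at h1
  rw [map_one, one_mul, act_gam_vac, TensorProduct.tmul_zero] at h2
  rw [eA, map_add, LinearMap.add_apply, h1, h2, add_zero]
  rfl

lemma act_diag_vac (a : Fin m) : act n ν (eA n a a) (vac n ν) = ν a • vac n ν := by
  have h : (vermaIdeal ν).mkQ (eU a a - algebraMap ℂ (Ugl m) (ν a)) = 0 :=
    (Submodule.Quotient.mk_eq_zero _).2 (Submodule.subset_span (Or.inr ⟨a, rfl⟩))
  rw [map_sub, sub_eq_zero, Algebra.algebraMap_eq_smul_one] at h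
  rw [act_eA_vac, h]
  rfl

lemma act_vac_eq_zero_iff (Y : AA m n) : act n ν Y (vac n ν) = 0 ↔ Y ∈ Imu n ν := by
  constructor
  · intro h
    have h2 := vgToQuot_act_vac ν Y
    rw [h, map_zero] at h2
    exact (Submodule.Quotient.mk_eq_zero _).1 h2.symm
  · intro hY
    induction hY using Submodule.span_induction with
    | mem Y hY =>
      rcases hY with (⟨a, b, hab, rfl⟩ | ⟨a, rfl⟩) | ⟨b, k, rfl⟩
      · have h : (vermaIdeal ν).mkQ (eU a b) = 0 :=
          (Submodule.Quotient.mk_eq_zero _).2 (Submodule.subset_span (Or.inl ⟨a, b, hab, rfl⟩))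
        rw [act_eA_vac, h, TensorProduct.zero_tmul]
      · rw [map_sub, LinearMap.sub_apply, act_diag_vac, AlgHom.commutes,
          Module.algebraMap_end_apply, sub_self]
      · have h := act_vac ν 1 (dOp b k : GD m n)
        rwa [map_one, one_mul, dOp_one, TensorProduct.tmul_zero] at h
    | zero => simp
    | add x y _ _ hx hy => rw [map_add, LinearMap.add_apply, hx, hy, add_zero]
    | smul X y _ hy => rw [smul_eq_mul, map_mul, Module.End.mul_apply, hy, map_zero]

/-- The vector `1_ν ⊗ 1` generates the `A`-module `M_ν ⊗ G`. -/
lemma exists_act_vac (v : VG n ν) : ∃ Y : AA m n, act n ν Y (vac n ν) = v := by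
  induction v using TensorProduct.induction_on with
  | zero => exact ⟨0, by simp⟩
  | tmul x w =>
    obtain ⟨u, rfl⟩ := (vermaIdeal ν).mkQ_surjective x
    exact ⟨_, (act_vac ν u (LinearMap.mulLeft ℂ w)).trans (by
      rw [LinearMap.mulLeft_apply, mul_one])⟩
  | add x y hx hy =>
    obtain ⟨X, rfl⟩ := hx
    obtain ⟨Y, rfl⟩ := hy
    exact ⟨X + Y, by rw [map_add, LinearMap.add_apply]⟩

end Annihilator

/-! ### The identification of the double quotient with the coinvariants -/

section Identification

variable {m n : ℕ} {ν : Fin m → ℂ}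

lemma iSup_eigenspace_act (ν : Fin m → ℂ) (a b : Fin m) :
    ⨆ z : ℤ, (act n ν (eA n a a - eA n b b)).eigenspace (ν a - ν b + z) = ⊤ := by
  set h := eA n a a - eA n b b with hh
  rw [eq_top_iff]
  intro v _
  obtain ⟨Y, rfl⟩ := exists_act_vac ν v
  have hY : Y ∈ intSpan h := by rw [hh, intSpan_eA]; trivial
  induction hY using Submodule.span_induction with
  | mem Y hY =>
    obtain ⟨z, hz⟩ := hY
    refine Submodule.mem_iSup_of_mem z (Module.End.mem_eigenspace_iff.2 ?_)
    rw [← Module.End.mul_apply, ← map_mul, sub_eq_iff_eq_add'.1 hz, map_add, map_mul, map_smul,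
      LinearMap.add_apply, Module.End.mul_apply, hh, map_sub, LinearMap.sub_apply, act_diag_vac,
      act_diag_vac, map_sub, map_smul, map_smul, LinearMap.smul_apply, add_smul, sub_smul]
  | zero => simp
  | add x y _ _ hx hy =>
    rw [map_add, LinearMap.add_apply]
    exact Submodule.add_mem _ (hx trivial) (hy trivial)
  | smul z x _ hx =>
    rw [map_smul, LinearMap.smul_apply]
    exact Submodule.smul_mem _ _ (hx trivial)

/-- The denominators act by invertible operators, since their eigenvalues on `M_ν ⊗ G` do not
vanish. -/
lemma isUnit_act (hν : ∀ a b : Fin m, a ≠ b → ∀ z : ℤ, ν a - ν b ≠ z) {s : AA m n}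
    (hs : s ∈ den m n) : IsUnit (act n ν s) := by
  induction hs using Submonoid.closure_induction with
  | mem s hs =>
    obtain ⟨a, b, z, hab, rfl⟩ := hs
    set T := act n ν (eA n a a - eA n b b)
    have hT : act n ν (eA n a a - eA n b b + algebraMap ℂ (AA m n) z) =
        T + algebraMap ℂ (Module.End ℂ (VG n ν)) z := by rw [map_add, AlgHom.commutes]
    have hne : ∀ w : ℤ, ν a - ν b + w + z ≠ 0 := fun w h =>
      hν a b hab (-w - z) (by push_cast; linear_combination h)
    rw [hT, Module.End.isUnit_iff]
    constructor
    · rw [← LinearMap.ker_eq_bot, eq_bot_iff]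
      intro v hv
      have hv' : v ∈ T.eigenspace (-(z : ℂ)) := by
        rw [Module.End.mem_eigenspace_iff, neg_smul, eq_neg_iff_add_eq_zero]
        exact hv
      have hd := Module.End.eigenspaces_iSupIndep T (-(z : ℂ))
      refine hd.le_bot ⟨hv', ?_⟩
      have htop : (⊤ : Submodule ℂ (VG n ν)) ≤ ⨆ j, ⨆ (_ : j ≠ -(z : ℂ)), T.eigenspace j := by
        rw [← iSup_eigenspace_act ν a b]
        refine iSup_le fun w => le_iSup₂_of_le (ν a - ν b + w) ?_ le_rfl
        exact fun h => hne w (by rw [h]; ring)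
      exact htop trivial
    · rw [← LinearMap.range_eq_top, eq_top_iff, ← iSup_eigenspace_act ν a b]
      refine iSup_le fun w v hv => ⟨(ν a - ν b + w + z)⁻¹ • v, ?_⟩
      rw [map_smul, LinearMap.add_apply, Module.End.mem_eigenspace_iff.1 hv,
        Module.algebraMap_end_apply, ← add_smul, smul_smul, inv_mul_cancel₀ (hne w), one_smul]
  | one => rw [map_one]; exact isUnit_one
  | mul x y _ _ hx hy => rw [map_mul]; exact hx.mul hy

/-- The action of `Ā` on `M_ν ⊗ G` for a generic weight `ν`. -/
def actBar (hν : ∀ a b : Fin m, a ≠ b → ∀ z : ℤ, ν a - ν b ≠ z) :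
    Abar m n →+* Module.End ℂ (VG n ν) :=
  OreLocalization.universalHom (act n ν : AA m n →+* Module.End ℂ (VG n ν))
    (IsUnit.liftRight ((act n ν : AA m n →* Module.End ℂ (VG n ν)).comp (den m n).subtype)
      fun s => isUnit_act hν s.2)
    fun _ => rfl

variable (hν : ∀ a b : Fin m, a ≠ b → ∀ z : ℤ, ν a - ν b ≠ z)

lemma actBar_toBar (Y : AA m n) : actBar hν (toBar Y) = act n ν Y :=
  OreLocalization.universalHom_commutes _ _ _

/-- The linear map `y ↦ y (1_ν ⊗ 1)` from `Ā` to the coinvariants. -/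
def toCoinv : Abar m n →ₗ[ℂ] Coinv n ν where
  toFun y := (nSub n ν).mkQ (actBar hν y (vac n ν))
  map_add' x y := by rw [map_add, LinearMap.add_apply, map_add]
  map_smul' z y := by
    have h : z • y = toBar (algebraMap ℂ (AA m n) z) * y := Algebra.smul_def z y
    rw [h, map_mul, actBar_toBar, AlgHom.commutes, Module.End.mul_apply,
      Module.algebraMap_end_apply, map_smul, RingHom.id_apply]

lemma toCoinv_apply (y : Abar m n) :
    toCoinv hν y = (nSub n ν).mkQ (actBar hν y (vac n ν)) := rfl

/-- `E_{ab}` is a weight vector for the adjoint action of `U(h)`. -/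
lemma hPoly_mul_eA (p : MvPolynomial (Fin m) ℂ) (a b : Fin m) :
    hPoly m n p * eA n a b = eA n a b * hPoly m n (shift a b p) := by
  induction p using MvPolynomial.induction_on with
  | C z =>
    have h : shift a b (MvPolynomial.C z) = MvPolynomial.C z := MvPolynomial.algHom_C _ _
    rw [h, hPoly_C, Algebra.commutes]
  | add p q hp hq => rw [map_add, map_add, map_add, add_mul, mul_add, hp, hq]
  | mul_X p x hp =>
    have hX : eA n x x * eA n a b =
        eA n a b * (eA n x x + algebraMap ℂ (AA m n) (eps a b x : ℂ)) := by
      rw [mul_add, E_mul_cartan, ← Algebra.commutes, ← Algebra.smul_def, sub_add_cancel]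
    rw [map_mul, mul_assoc, hPoly_X, hX, ← mul_assoc, hp, map_mul, map_mul, mul_assoc]
    simp only [shift, MvPolynomial.aeval_X, map_add, hPoly_X, hPoly_C]

lemma frac_mul_eA (p : MvPolynomial (Fin m) ℂ) (q : denPoly m) (a b : Fin m) :
    frac n p q * toBar (eA n a b) =
      toBar (eA n a b) * frac n (shift a b p) (shiftDen a b q) := by
  have h : frac n 1 q * toBar (eA n a b) = toBar (eA n a b) * frac n 1 (shiftDen a b q) := by
    calc frac n 1 q * toBar (eA n a b)
        = frac n 1 q * (toBar (eA n a b) * toBar (hPoly m n (shiftDen a b q))) *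
            frac n 1 (shiftDen a b q) := by
          rw [mul_assoc, mul_assoc, toBar_hPoly_mul_frac, mul_one]
      _ = frac n 1 q * (toBar (hPoly m n q) * toBar (eA n a b)) * frac n 1 (shiftDen a b q) := by
          rw [← toBar_mul, ← toBar_mul, hPoly_mul_eA]; rfl
      _ = _ := by rw [← mul_assoc, frac_mul_toBar_hPoly, one_mul]
  rw [frac_eq, mul_assoc, ← toBar_mul, hPoly_mul_eA, toBar_mul, ← mul_assoc, h, mul_assoc,
    ← frac_eq]

lemma actBar_frac_mem (p : MvPolynomial (Fin m) ℂ) (q : denPoly m) {v : VG n ν}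
    (hv : v ∈ nSub n ν) : actBar hν (frac n p q) v ∈ nSub n ν := by
  induction hv using Submodule.span_induction with
  | mem v hv =>
    obtain ⟨a, b, w, hab, rfl⟩ := hv
    refine Submodule.subset_span
      ⟨a, b, actBar hν (frac n (shift a b p) (shiftDen a b q)) w, hab, ?_⟩
    rw [← actBar_toBar hν, ← Module.End.mul_apply, ← map_mul, frac_mul_eA, map_mul,
      Module.End.mul_apply]
  | zero => rw [map_zero]; exact Submodule.zero_mem _
  | add x y _ _ hx hy => rw [map_add]; exact Submodule.add_mem _ hx hy
  | smul z x _ hx => rw [map_smul]; exact Submodule.smul_mem _ _ hx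

lemma act_vac_mem_nSub {Y : AA m n} (hY : Y ∈ J m n) : act n ν Y (vac n ν) ∈ nSub n ν := by
  induction hY using Submodule.span_induction with
  | mem Y hY =>
    obtain ⟨a, b, Z, hab, rfl⟩ := hY
    exact Submodule.subset_span ⟨a, b, act n ν Z (vac n ν), hab, by
      rw [map_mul, Module.End.mul_apply]⟩
  | zero => rw [map_zero, LinearMap.zero_apply]; exact Submodule.zero_mem _
  | add x y _ _ hx hy =>
    rw [map_add, LinearMap.add_apply]; exact Submodule.add_mem _ hx hy
  | smul z x _ hx =>
    rw [map_smul, LinearMap.smul_apply]; exact Submodule.smul_mem _ _ hx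

lemma exists_mem_J_of_mem_nSub {v : VG n ν} (hv : v ∈ nSub n ν) :
    ∃ Y ∈ J m n, act n ν Y (vac n ν) = v := by
  induction hv using Submodule.span_induction with
  | mem v hv =>
    obtain ⟨a, b, w, hab, rfl⟩ := hv
    obtain ⟨Z, rfl⟩ := exists_act_vac ν w
    exact ⟨_, eA_mul_mem_J hab Z, by rw [map_mul, Module.End.mul_apply]⟩
  | zero => exact ⟨0, Submodule.zero_mem _, by simp⟩
  | add x y _ _ hx hy =>
    obtain ⟨X, hX, rfl⟩ := hx
    obtain ⟨Y, hY, rfl⟩ := hy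
    exact ⟨X + Y, Submodule.add_mem _ hX hY, by rw [map_add, LinearMap.add_apply]⟩
  | smul z x _ hx =>
    obtain ⟨X, hX, rfl⟩ := hx
    exact ⟨z • X, Submodule.smul_mem _ _ hX, by rw [map_smul, LinearMap.smul_apply]⟩

lemma ker_toCoinv : LinearMap.ker (toCoinv (n := n) hν) = Jbar m n ⊔ Ibar n ν := by
  refine le_antisymm (fun y hy => ?_) (sup_le (Submodule.span_le.2 ?_) (Submodule.span_le.2 ?_))
  · -- clear the denominator `q` and write `Y (1_ν ⊗ 1)` as `Z (1_ν ⊗ 1)` with `Z` in `J`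
    obtain ⟨q, Y, rfl⟩ := exists_frac_mul y
    have h1 : actBar hν (frac n 1 q * toBar Y) (vac n ν) ∈ nSub n ν :=
      (Submodule.Quotient.mk_eq_zero _).1 hy
    have h2 := actBar_frac_mem hν q 1 h1
    rw [frac_one_right, ← Module.End.mul_apply, ← map_mul, ← mul_assoc, toBar_hPoly_mul_frac,
      one_mul, actBar_toBar] at h2
    obtain ⟨Z, hZ, e⟩ := exists_mem_J_of_mem_nSub h2
    have h3 : Y - Z ∈ Imu n ν := by
      rw [← act_vac_eq_zero_iff, map_sub, LinearMap.sub_apply, e, sub_self]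
    rw [← add_sub_cancel Z Y, toBar_add, mul_add]
    exact Submodule.add_mem_sup (frac_mul_toBar_mem _ _ _ hZ)
      (frac_mul_toBar_mem ((Imu n ν).restrictScalars ℂ) _ _ h3)
  · rintro _ ⟨p, q, Y, hY, rfl⟩
    refine (Submodule.Quotient.mk_eq_zero _).2 ?_
    rw [map_mul, Module.End.mul_apply, actBar_toBar]
    exact actBar_frac_mem hν p q (act_vac_mem_nSub hY)
  · rintro _ ⟨p, q, Y, hY, rfl⟩
    refine (Submodule.Quotient.mk_eq_zero _).2 ?_
    rw [map_mul, Module.End.mul_apply, actBar_toBar, (act_vac_eq_zero_iff ν Y).2 hY, map_zero]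
    exact Submodule.zero_mem _

lemma toCoinv_toBar (Y : AA m n) :
    toCoinv hν (toBar Y) = (nSub n ν).mkQ (act n ν Y (vac n ν)) := by
  rw [toCoinv_apply, actBar_toBar]

lemma exists_isIdent (hν : ∀ a b : Fin m, a ≠ b → ∀ z : ℤ, ν a - ν b ≠ z) :
    ∃ e : DQ n ν ≃ₗ[ℂ] Coinv n ν, IsIdent ν e := by
  let φ : DQ n ν →ₗ[ℂ] Coinv n ν :=
    (Jbar m n ⊔ Ibar n ν).liftQ (toCoinv hν) (ker_toCoinv hν).ge
  have hφ : ∀ y, φ ((Jbar m n ⊔ Ibar n ν).mkQ y) = toCoinv hν y := fun y =>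
    Submodule.liftQ_apply _ _ _
  refine ⟨LinearEquiv.ofBijective φ ⟨?_, ?_⟩, fun Y => ?_⟩
  · rw [← LinearMap.ker_eq_bot, Submodule.ker_liftQ_eq_bot]
    exact (ker_toCoinv hν).le
  · intro v
    obtain ⟨v, rfl⟩ := (nSub n ν).mkQ_surjective v
    obtain ⟨Y, rfl⟩ := exists_act_vac ν v
    exact ⟨_, (hφ (toBar Y)).trans (toCoinv_toBar hν Y)⟩
  · exact (hφ (toBar Y)).trans (toCoinv_toBar hν Y)

/-- Every class in the double quotient is the class of an element of `A`. -/
lemma IsIdent.exists_toBar {e : DQ n ν ≃ₗ[ℂ] Coinv n ν} (he : IsIdent ν e) (y : DQ n ν) :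
    ∃ Y : AA m n, (Jbar m n ⊔ Ibar n ν).mkQ (toBar Y) = y := by
  obtain ⟨v, hv⟩ := (nSub n ν).mkQ_surjective (e y)
  obtain ⟨Y, rfl⟩ := exists_act_vac ν v
  exact ⟨Y, e.injective ((he Y).trans hv)⟩

lemma IsIdent.unique {e e' : DQ n ν ≃ₗ[ℂ] Coinv n ν} (he : IsIdent ν e) (he' : IsIdent ν e') :
    e = e' := by
  refine LinearEquiv.ext fun y => ?_
  obtain ⟨Y, rfl⟩ := he.exists_toBar y
  rw [he, he']

lemma TA_mul_mem_of_mem_sup (s : ℕ) (i j : Fin n) {y : Abar m n}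
    (hy : y ∈ Jbar m n ⊔ Ibar n ν) : toBar (TA s i j) * y ∈ Jbar m n ⊔ Ibar n ν := by
  obtain ⟨x, hx, z, hz, rfl⟩ := Submodule.mem_sup.1 hy
  rw [mul_add]
  exact Submodule.add_mem_sup (TA_mem_leftStab_Jbar s i j x hx)
    (toBar_mem_leftStab ((Imu n ν).restrictScalars ℂ) _ (TA_hPoly s i j)
      (fun Y hY => Submodule.smul_mem (Imu n ν) _ hY) z hz)

/-- The identification intertwines left multiplication by a Yangian generator with its action on
the coinvariants. -/
lemma IsIdent.TCoinv_apply {e : DQ n ν ≃ₗ[ℂ] Coinv n ν} (he : IsIdent ν e) (s : ℕ) (i j : Fin n)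
    (y : Abar m n ⧸ Jbar m n) :
    TCoinv ν s i j (e (Submodule.factor (le_sup_left : Jbar m n ≤ Jbar m n ⊔ Ibar n ν) y)) =
      e (Submodule.factor (le_sup_left : Jbar m n ≤ Jbar m n ⊔ Ibar n ν) (TQ m s i j y)) := by
  obtain ⟨z, rfl⟩ := (Jbar m n).mkQ_surjective y
  obtain ⟨Y, hY⟩ := he.exists_toBar ((Jbar m n ⊔ Ibar n ν).mkQ z)
  have h1 : (Jbar m n ⊔ Ibar n ν).mkQ (toBar (TA s i j) * z) =
      (Jbar m n ⊔ Ibar n ν).mkQ (toBar (TA s i j * Y)) := by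
    refine (Submodule.Quotient.eq _).2 ?_
    rw [toBar_mul, ← mul_sub]
    exact TA_mul_mem_of_mem_sup s i j ((Submodule.Quotient.eq _).1 hY.symm)
  have h2 : ∀ x : Abar m n, Submodule.factor (le_sup_left : Jbar m n ≤ Jbar m n ⊔ Ibar n ν)
      ((Jbar m n).mkQ x) = (Jbar m n ⊔ Ibar n ν).mkQ x := fun _ => rfl
  rw [TQ_mkQ, h2, h2, h1, ← hY, he, he, map_mul, Module.End.mul_apply]
  rfl

end Identification

/-! ### The induced map of coinvariants -/

section Induced

variable {m n : ℕ} {c d : Fin m} {hcd : (d : ℕ) = c + 1}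
  {g : (Abar m n ⧸ Jbar m n) →ₗ[ℂ] Abar m n ⧸ Jbar m n}

lemma IsZhelobenko.sup_le_ker (hg : IsZhelobenko c d hcd g) (μ : Fin m → ℂ) :
    Jbar m n ⊔ Ibar n μ ≤ LinearMap.ker (Submodule.factor
      (le_sup_left : Jbar m n ≤ Jbar m n ⊔ Ibar n (dot (Equiv.swap c d) μ)) ∘ₗ g ∘ₗ
        (Jbar m n).mkQ) := by
  refine sup_le (fun y hy => ?_) (fun y hy => ?_)
  · have h : (Jbar m n).mkQ y = 0 := (Submodule.Quotient.mk_eq_zero _).2 hy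
    rw [LinearMap.mem_ker, LinearMap.comp_apply, LinearMap.comp_apply, h, map_zero, map_zero]
  · obtain ⟨f, hf, hgf⟩ := hg
    obtain ⟨z, hz, e⟩ := hf.apply_permBar_Ibar μ hy
    rw [LinearMap.mem_ker, LinearMap.comp_apply, LinearMap.comp_apply, hgf, ← e]
    exact (Submodule.Quotient.mk_eq_zero _).2 (le_sup_right (a := Jbar m n) hz)

lemma IsZhelobenko.exists_isInduced (hg : IsZhelobenko c d hcd g) (μ : Fin m → ℂ)
    (e : DQ n μ ≃ₗ[ℂ] Coinv n μ)
    (e' : DQ n (dot (Equiv.swap c d) μ) ≃ₗ[ℂ] Coinv n (dot (Equiv.swap c d) μ)) :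
    ∃ I, IsInduced g e e' I := by
  refine ⟨e'.toLinearMap ∘ₗ (Jbar m n ⊔ Ibar n μ).liftQ _ (hg.sup_le_ker μ) ∘ₗ
    e.symm.toLinearMap, fun y => ?_⟩
  obtain ⟨y, rfl⟩ := (Jbar m n).mkQ_surjective y
  rw [LinearMap.comp_apply, LinearMap.comp_apply, LinearEquiv.coe_coe, LinearEquiv.coe_coe,
    LinearEquiv.symm_apply_apply]
  congr 1

lemma exists_factor_eq {μ : Fin m → ℂ} (e : DQ n μ ≃ₗ[ℂ] Coinv n μ) (v : Coinv n μ) :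
    ∃ y, e (Submodule.factor (le_sup_left : Jbar m n ≤ Jbar m n ⊔ Ibar n μ) y) = v := by
  obtain ⟨z, hz⟩ := (Jbar m n ⊔ Ibar n μ).mkQ_surjective (e.symm v)
  exact ⟨(Jbar m n).mkQ z, (congrArg e hz).trans (e.apply_symm_apply v)⟩

lemma IsInduced.unique {μ ν : Fin m → ℂ} {e : DQ n μ ≃ₗ[ℂ] Coinv n μ}
    {e' : DQ n ν ≃ₗ[ℂ] Coinv n ν} {I I' : Coinv n μ →ₗ[ℂ] Coinv n ν}
    (hI : IsInduced g e e' I) (hI' : IsInduced g e e' I') : I = I' := by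
  refine LinearMap.ext fun v => ?_
  obtain ⟨y, rfl⟩ := exists_factor_eq e v
  rw [hI, hI']

lemma dot_generic (σ : Equiv.Perm (Fin m)) {μ : Fin m → ℂ}
    (hμ : ∀ a b : Fin m, a ≠ b → ∀ z : ℤ, μ a - μ b ≠ z) (a b : Fin m) (hab : a ≠ b) (z : ℤ) :
    dot σ μ a - dot σ μ b ≠ z := by
  intro h
  refine hμ (σ⁻¹ a) (σ⁻¹ b) (σ⁻¹.injective.ne hab)
    (z + ((σ⁻¹ a : Fin m) : ℕ) - ((σ⁻¹ b : Fin m) : ℕ) - (a : ℕ) + (b : ℕ)) ?_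
  simp only [dot] at h
  push_cast
  linear_combination h

end Induced

end

end MickelssonGL

theorem proposition3p6 (m n : ℕ) (c d : Fin m) (hcd : (d : ℕ) = c + 1) (μ : Fin m → ℂ)
    (hμ : ∀ a b : Fin m, a ≠ b → ∀ z : ℤ, μ a - μ b ≠ z) :
    -- the linear map `ξ̄_c`, the Zhelobenko operator `ξ̌_c` and the identifications of
    -- `J̄ \ Ā / Ī_μ` with the space of coinvariants, for `μ` and for `σ_c ∘ μ`, are well defined
    (∃! f : Abar m n →ₗ[ℂ] Abar m n ⧸ Jbar m n,
      IsXiBar c d hcd f) ∧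
    (∃! g : (Abar m n ⧸ Jbar m n) →ₗ[ℂ]
        Abar m n ⧸ Jbar m n,
      IsZhelobenko c d hcd g) ∧
    (∃! e : DQ n μ ≃ₗ[ℂ] Coinv n μ, IsIdent μ e) ∧
    (∃! e' : DQ n (dot (Equiv.swap c d) μ) ≃ₗ[ℂ]
        Coinv n (dot (Equiv.swap c d) μ),
      IsIdent (dot (Equiv.swap c d) μ) e') ∧
    ∀ (g : (Abar m n ⧸ Jbar m n) →ₗ[ℂ]
        Abar m n ⧸ Jbar m n)
      (e : DQ n μ ≃ₗ[ℂ] Coinv n μ)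
      (e' : DQ n (dot (Equiv.swap c d) μ) ≃ₗ[ℂ]
        Coinv n (dot (Equiv.swap c d) μ)),
      IsZhelobenko c d hcd g → IsIdent μ e →
      IsIdent (dot (Equiv.swap c d) μ) e' →
      -- `ξ̌_c` induces a unique linear map of coinvariants, which commutes with `T_{ij}^{(s+1)}`
      (∃! I : Coinv n μ →ₗ[ℂ] Coinv n (dot (Equiv.swap c d) μ), IsInduced g e e' I) ∧
      ∀ I : Coinv n μ →ₗ[ℂ] Coinv n (dot (Equiv.swap c d) μ),
        IsInduced g e e' I →
        ∀ (s : ℕ) (i j : Fin n),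
          I ∘ₗ TCoinv μ s i j =
            TCoinv (dot (Equiv.swap c d) μ) s i j ∘ₗ I := by
  have hμ' := dot_generic (Equiv.swap c d) hμ
  obtain ⟨e₀, he₀⟩ := exists_isIdent (n := n) hμ
  obtain ⟨e₁, he₁⟩ := exists_isIdent (n := n) hμ'
  refine ⟨⟨xiBar n hcd, isXiBar_xiBar hcd, fun f hf => hf.unique (isXiBar_xiBar hcd)⟩,
    ⟨zhelobenko n hcd, isZhelobenko_zhelobenko hcd,
      fun g hg => hg.unique (isZhelobenko_zhelobenko hcd)⟩,
    ⟨e₀, he₀, fun e he => he.unique he₀⟩, ⟨e₁, he₁, fun e he => he.unique he₁⟩,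
    fun g e e' hg he he' => ⟨?_, fun I hI s i j => LinearMap.ext fun v => ?_⟩⟩
  · obtain ⟨I, hI⟩ := hg.exists_isInduced μ e e'
    exact ⟨I, hI, fun I' hI' => hI'.unique hI⟩
  · obtain ⟨y, rfl⟩ := exists_factor_eq e v
    rw [LinearMap.comp_apply, LinearMap.comp_apply, he.TCoinv_apply, hI, hI, hg.comm_TQ,
      he'.TCoinv_apply]
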